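/- Let $\Sigma$ be a connected, oriented surface with (possibly empty) boundary, endowed with a flat structure with holonomy in $\{\pm\mathrm{Id}\}$: a Euclidean metric with geodesic boundary outside a discrete set $Z$ of conical singularities, of angle $k\pi$ with $k\ge 3$ at interior points and $k\ge 2$ at boundary points, whose holonomy takes values in $\{\pm\mathrm{Id}\}$. Let $d$ be the associated length distance, assumed complete (for instance $\Sigma$ compact, or a locally isometric covering of a compact surface), and let $p:\widetilde\Sigma\to\Sigma$ be a locally isometric universal cover. Local geodesics $\ell:\mathbb R\to\Sigma$ are parametrised by arc length, and their set $\mathcal G$ carries the compact-open topology; $[\mathcal G]$ is its quotient by changes of origin, $[\ell]$ is the class of $\ell$, and $\ell^-(t)=\ell(-t)$. Two local geodesics are interlaced if they have lifts to $\widetilde\Sigma$ whose pairs of points at infinity are interlaced for the cyclic order of $\partial_\infty\widetilde\Sigma$ given by the orientation. A flat lamination $\Lambda$ is a non-empty closed subset of $[\mathcal G]$, invariant under $\ell\mapsto\ell^-$, whose elements (the leaves) are not self-interlaced and are pairwise not interlaced. An arc is an injective piecewise $C^1$ map $\alpha:[0,1]\to\Sigma$ (with non-zero one-sided derivatives). It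 is transverse to a local geodesic, or geodesic segment, $\ell$ if they are not tangent at any common point, and if moreover, whenever $x=\alpha(s)=\ell(t)$, $0<s<1$, is a singularity of the metric or a singular point of $\alpha$, there are a neighbourhood $D$ of $x$ that is a topological disc and a segment $S$ of $\ell$ containing the time $t$, such that $D\setminus S$ has exactly two connected components, one containing the part of $\alpha$ in $D$ before $x$ and the other the part after $x$. Let $G(\alpha)$ be the set of $g\in\mathcal G$ transverse to $\alpha$ with $g(0)\in\alpha([0,1])$. An arc is transverse to $\Lambda$ if it is transverse to every leaf. Let $\alpha_1,\alpha_2$ be disjoint arcs and $F_1\subseteq G(\alpha_1)$ a set of parametrised leaves of $\Lambda$, transverse to $\alpha_2$, each of which meets $\alpha_2$ at a positive time; let $t_g$ be the first such time. A holonomy is a homeomorphism $h:F_1\to F_2\subseteq G(\alpha_2)$ of the form $h(g)=g(\cdot+t_g)$ such that there is a homotopy $H:[0,1]^2\to\Sigma$ with $H(\cdot,0)=\alpha_1$ and $H(\cdot,1)=\alpha_2$ for which: every $H(\cdot,t)$ is an arc transverse to all the segments $g|_{[0,t_g]}$, $g\in F_1$; for every $g\in F_1$ there is $s$ such that $t\mapsto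 H(s,t)$ is the segment $g|_{[0,t_g]}$ up to increasing reparametrisation; and $H([0,1]\times\,]0,1[)$ is disjoint from the images of $\alpha_1$ and $\alpha_2$. A transverse measure on $\Lambda$ is the datum, for every arc $\alpha$ transverse to $\Lambda$, of a Radon measure $\mu_\alpha$ on $G(\alpha)$ such that: (1) the support of $\mu_\alpha$ is $\{\ell\in G(\alpha):[\ell]\in\Lambda\}$; (2) $h_*(\mu_{\alpha_1}|_{F_1})=\mu_{\alpha_2}|_{F_2}$ for every holonomy $h:F_1\to F_2$ with $F_1$ Borel in $G(\alpha_1)$ and $\alpha_1,\alpha_2$ transverse to $\Lambda$; (3) $\mu_\alpha$ is invariant under $\ell\mapsto\ell^-$; (4) $\mu_\alpha|_{G(\alpha')}=\mu_{\alpha'}$ if $\alpha'([0,1])\subseteq\alpha([0,1])$. A leaf is positively recurrent if it can be parametrised so that $\ell(0)\notin Z$ and for all $T,\varepsilon>0$ there is $t>T$ with $d(\ell(t),\ell(0))<\varepsilon$; it is periodic if $\ell(t+T)=\ell(t)$ for some $T>0$ and all $t$; it is isolated if its class is an isolated point of $\Lambda$. Theorem. If a flat lamination $\Lambda$ on $\Sigma$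 carries a transverse measure, then $\Lambda$ has no isolated leaf that is positively recurrent without being periodic. -/

import Mathlib

open Set Filter Topology MeasureTheory

noncomputable section

/-! ### Half-translation surfaces -/

/-- The metric of `X` is a length metric: the distance between two points is the infimum of the
lengths of the curves joining them (in particular `X` is path connected). -/
def IsLengthMetric (X : Type*) [MetricSpace X] : Prop :=
  ∀ x y : X, ∀ ε : ℝ, 0 < ε → ∃ γ : ℝ → X, ContinuousOn γ (Icc 0 1) ∧ γ 0 = x ∧ γ 1 = y ∧
    eVariationOn γ (Icc 0 1) ≤ ENNReal.ofReal (dist x y + ε)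

/-- Admissible polar angles at a point of total angle `k * π`: at a boundary point (`b` true) the
space of directions is the segment `[τ, τ + k π]`; at an interior point it is the circle of
length `k π`, and an angle is a real number read modulo `k π`. -/
def linkSet (b : Prop) (k : ℕ) (τ : ℝ) : Set ℝ :=
  {θ | b → θ ∈ Icc τ (τ + k * Real.pi)}

open Classical in
/-- The distance between two directions, in the segment or in the circle of length `k π`. -/
def linkDist (b : Prop) (k : ℕ) (θ θ' : ℝ) : ℝ :=
  if b then |θ - θ'| else ‖((θ - θ' : ℝ) : AddCircle ((k : ℝ) * Real.pi))‖

/-- The distance, in a Euclidean cone, between the points at distances `ρ`, `ρ'` of the apex in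
directions which are at distance `φ`. -/
def coneDist (ρ ρ' φ : ℝ) : ℝ :=
  √(ρ ^ 2 + ρ' ^ 2 - 2 * ρ * ρ' * Real.cos (min φ Real.pi))

/-- The complex number of polar coordinates `ρ`, `θ`. -/
def polarPt (ρ θ : ℝ) : ℂ := (ρ : ℂ) * Complex.exp ((θ : ℂ) * Complex.I)

/-- A flat structure with holonomy in `{± Id}` on a connected oriented surface with (possibly
empty) boundary, whose length metric is the metric of `S`. Every point `x` has a ball which is
isometric, through polar coordinates `pol x`, to a ball centred at the apex of a Euclidean cone of
angle `k π`, with `k ≥ 2`, if `x` is an interior point, or of a Euclidean sector of angle `k π`,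
with `k ≥ 1`, if `x` is a boundary point. Away from the centres, the flat coordinates
`ρ exp (i θ)` given by these charts differ from each other locally by maps `z ↦ ± z + c`. -/
structure HalfTranslationSurface (S : Type*) [MetricSpace S] where
  lengthMetric : IsLengthMetric S
  bdry : Set S
  k : S → ℕ
  τ : S → ℝ
  rad : S → ℝ
  pol : S → ℝ → ℝ → S
  two_le_k : ∀ x, x ∉ bdry → 2 ≤ k x
  one_le_k : ∀ x, x ∈ bdry → 1 ≤ k x
  rad_pos : ∀ x, 0 < rad x
  pol_zero : ∀ x θ, θ ∈ linkSet (x ∈ bdry) (k x) (τ x) → pol x 0 θ = x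
  dist_pol : ∀ x, ∀ ρ ∈ Ico 0 (rad x), ∀ ρ' ∈ Ico 0 (rad x),
    ∀ θ ∈ linkSet (x ∈ bdry) (k x) (τ x), ∀ θ' ∈ linkSet (x ∈ bdry) (k x) (τ x),
    dist (pol x ρ θ) (pol x ρ' θ') = coneDist ρ ρ' (linkDist (x ∈ bdry) (k x) θ θ')
  pol_surj : ∀ x, ∀ y ∈ Metric.ball x (rad x),
    ∃ ρ ∈ Ico 0 (rad x), ∃ θ ∈ linkSet (x ∈ bdry) (k x) (τ x), pol x ρ θ = y
  holonomy : ∀ x y : S, ∀ ρ ∈ Ioo 0 (rad x), ∀ ρ' ∈ Ioo 0 (rad y),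
    ∀ θ ∈ linkSet (x ∈ bdry) (k x) (τ x), ∀ θ' ∈ linkSet (y ∈ bdry) (k y) (τ y),
    pol x ρ θ = pol y ρ' θ' →
    ∃ ε : ℂ, (ε = 1 ∨ ε = -1) ∧ ∃ c : ℂ, ∃ δ : ℝ, 0 < δ ∧
      ∀ ρ₁ ∈ Ioo 0 (rad x), ∀ ρ₁' ∈ Ioo 0 (rad y),
      ∀ θ₁ ∈ linkSet (x ∈ bdry) (k x) (τ x), ∀ θ₁' ∈ linkSet (y ∈ bdry) (k y) (τ y),
      |ρ₁ - ρ| < δ → |ρ₁' - ρ'| < δ → |θ₁ - θ| < δ → |θ₁' - θ'| < δ →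
      pol x ρ₁ θ₁ = pol y ρ₁' θ₁' → polarPt ρ₁' θ₁' = ε * polarPt ρ₁ θ₁ + c

namespace HalfTranslationSurface

variable {S : Type*} [MetricSpace S] (M : HalfTranslationSurface S)

/-- The admissible polar angles at `x`. -/
def link (x : S) : Set ℝ := linkSet (x ∈ M.bdry) (M.k x) (M.τ x)

/-- Two admissible polar angles at `x` are the same direction. -/
def SameDir (x : S) (θ θ' : ℝ) : Prop := linkDist (x ∈ M.bdry) (M.k x) θ θ' = 0

/-- The singularities: interior points of angle different from `2π`, boundary points of angle
different from `π`. -/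
def sing : Set S := {x | (x ∉ M.bdry ∧ M.k x ≠ 2) ∨ (x ∈ M.bdry ∧ M.k x ≠ 1)}

/-- `y` has flat coordinate `z` in the polar chart at `x`. -/
def HasCoord (x y : S) (z : ℂ) : Prop :=
  ‖z‖ < M.rad x ∧ ∃ θ ∈ M.link x, z = polarPt ‖z‖ θ ∧ y = M.pol x ‖z‖ θ

/-- The germ at `0⁺` of the curve `c`, which starts from `x`, has initial direction `θ`. -/
def HasDir (c : ℝ → S) (x : S) (θ : ℝ) : Prop :=
  θ ∈ M.link x ∧ ∃ ρ ϑ : ℝ → ℝ,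
    (∀ᶠ u in 𝓝[>] (0 : ℝ), ρ u ∈ Ioo 0 (M.rad x) ∧ ϑ u ∈ M.link x ∧ c u = M.pol x (ρ u) (ϑ u)) ∧
    Tendsto ρ (𝓝[>] 0) (𝓝 0) ∧ Tendsto ϑ (𝓝[>] 0) (𝓝 θ)

/-- Three directions at `x` are pairwise distinct and met in this cyclic order when turning around
`x` in the positive sense. -/
def DirOrdered (x : S) (θ₁ θ₂ θ₃ : ℝ) : Prop :=
  (x ∉ M.bdry ∧ θ₁ < θ₂ ∧ θ₂ < θ₃ ∧ θ₃ < θ₁ + M.k x * Real.pi) ∨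
  (x ∈ M.bdry ∧ ((θ₁ < θ₂ ∧ θ₂ < θ₃) ∨ (θ₂ < θ₃ ∧ θ₃ < θ₁) ∨ (θ₃ < θ₁ ∧ θ₁ < θ₂)))

end HalfTranslationSurface

/-! ### Local geodesics -/

/-- `c` is, on the set of times `I`, a local geodesic parametrised by arc length. -/
def IsLocalGeodesicOn {X : Type*} [MetricSpace X] (c : ℝ → X) (I : Set ℝ) : Prop :=
  ∀ t ∈ I, ∃ ε > 0, ∀ s ∈ I, ∀ s' ∈ I, |s - t| < ε → |s' - t| < ε → dist (c s) (c s') = |s - s'|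

/-- Parametrised local geodesics defined on `ℝ`, with the compact-open topology. -/
def LocalGeodesic (X : Type*) [MetricSpace X] : Type _ :=
  {g : C(ℝ, X) // IsLocalGeodesicOn g univ}

namespace LocalGeodesic

variable {X : Type*} [MetricSpace X]

instance : TopologicalSpace (LocalGeodesic X) :=
  inferInstanceAs (TopologicalSpace {g : C(ℝ, X) // IsLocalGeodesicOn g univ})

instance : MeasurableSpace (LocalGeodesic X) := borel _

instance : BorelSpace (LocalGeodesic X) := ⟨rfl⟩

instance : CoeFun (LocalGeodesic X) (fun _ => ℝ → X) := ⟨fun g => g.1⟩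

/-- Change of origin: `t ↦ g (t + a)`. -/
def shift (g : LocalGeodesic X) (a : ℝ) : LocalGeodesic X :=
  ⟨⟨fun t => g (t + a), by fun_prop⟩, by
    intro t _
    obtain ⟨ε, hε, h⟩ := g.2 (t + a) (mem_univ _)
    refine ⟨ε, hε, fun s _ s' _ hs hs' => ?_⟩
    have := h (s + a) (mem_univ _) (s' + a) (mem_univ _) (by simpa using hs) (by simpa using hs')
    simpa using this⟩

/-- Change of orientation: `t ↦ g (-t)`. -/
def rev (g : LocalGeodesic X) : LocalGeodesic X :=
  ⟨⟨fun t => g (-t), by fun_prop⟩, by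
    intro t _
    obtain ⟨ε, hε, h⟩ := g.2 (-t) (mem_univ _)
    refine ⟨ε, hε, fun s _ s' _ hs hs' => ?_⟩
    have h1 : |-s - -t| < ε := by rw [← abs_neg]; convert hs using 2; ring
    have h2 : |-s' - -t| < ε := by rw [← abs_neg]; convert hs' using 2; ring
    have := h (-s) (mem_univ _) (-s') (mem_univ _) h1 h2
    rw [← abs_neg (s - s')]
    simpa [add_comm, sub_eq_add_neg] using this⟩

/-- Two parametrised local geodesics which differ by a change of origin. -/
instance originSetoid (X : Type*) [MetricSpace X] : Setoid (LocalGeodesic X) where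
  r g h := ∃ a : ℝ, ∀ t, h t = g (t + a)
  iseqv := {
    refl := fun g => ⟨0, fun t => by simp⟩
    symm := fun {g h} ⟨a, ha⟩ => ⟨-a, fun t => by rw [ha]; simp⟩
    trans := fun {g h l} ⟨a, ha⟩ ⟨b, hb⟩ => ⟨b + a, fun t => by rw [hb, ha, add_assoc]⟩ }

end LocalGeodesic

/-- Local geodesics defined up to change of origin, with the quotient topology. -/
def GeodesicClass (X : Type*) [MetricSpace X] : Type _ :=
  Quotient (LocalGeodesic.originSetoid X)

instance {X : Type*} [MetricSpace X] : TopologicalSpace (GeodesicClass X) :=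
  inferInstanceAs (TopologicalSpace (Quotient (LocalGeodesic.originSetoid X)))

/-- The class of a parametrised local geodesic. -/
def LocalGeodesic.cls {X : Type*} [MetricSpace X] (g : LocalGeodesic X) : GeodesicClass X :=
  Quotient.mk (LocalGeodesic.originSetoid X) g

/-! ### Universal cover, boundary at infinity, interlacing -/

/-- `p : E → S` is a locally isometric universal cover, `E` being endowed with its length
metric. -/
structure IsIsometricUniversalCover {E S : Type*} [MetricSpace E] [MetricSpace S]
    (p : E → S) : Prop where
  lengthMetric : IsLengthMetric E
  simplyConnected : SimplyConnectedSpace E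
  covering : IsCoveringMap p
  localIsometry : ∀ x : E, ∃ r > 0, ∀ y ∈ Metric.ball x r, ∀ z ∈ Metric.ball x r,
    dist (p y) (p z) = dist y z

/-- Geodesic rays of the universal cover `E` (as `E` is a `CAT(0)` space, its local geodesics are
its geodesics). Only the values at non-negative times are meaningful. -/
def Ray (E : Type*) [MetricSpace E] : Type _ := {r : ℝ → E // IsLocalGeodesicOn r (Ici 0)}

/-- Asymptotic rays: rays which stay at bounded distance from each other. -/
instance asymptoticSetoid (E : Type*) [MetricSpace E] : Setoid (Ray E) where
  r a b := ∃ C : ℝ, ∀ t ≥ 0, dist (a.1 t) (b.1 t) ≤ C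
  iseqv := {
    refl := fun a => ⟨0, fun t _ => by simp⟩
    symm := fun {a b} ⟨C, h⟩ => ⟨C, fun t ht => by rw [dist_comm]; exact h t ht⟩
    trans := fun {a b c} ⟨C, h⟩ ⟨D, h'⟩ => ⟨C + D, fun t ht =>
      (dist_triangle _ (b.1 t) _).trans (add_le_add (h t ht) (h' t ht))⟩ }

/-- The boundary at infinity. -/
def BoundaryAtInfinity (E : Type*) [MetricSpace E] : Type _ := Quotient (asymptoticSetoid E)

/-- The endpoint of a ray. -/
def Ray.endpoint {E : Type*} [MetricSpace E] (r : Ray E) : BoundaryAtInfinity E :=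
  Quotient.mk (asymptoticSetoid E) r

section Interlacing

variable {E S : Type*} [MetricSpace E] [MetricSpace S] (M : HalfTranslationSurface S) (p : E → S)

/-- The cyclic order on the boundary at infinity defined by the orientation: the triple
`(ξ₁, ξ₂, ξ₃)` is positive if it is seen in positive order from some point `x` of `E`, i.e. the
rays from `x` to `ξ₁, ξ₂, ξ₃` leave `x` in pairwise distinct and positively ordered directions.
(From any three distinct points at infinity, such a point `x` exists, up to the order, and the
order does not depend on it, since two geodesic rays from `x` with distinct initial directions
meet only at `x`.) -/
def CyclicPos (ξ₁ ξ₂ ξ₃ : BoundaryAtInfinity E) : Prop :=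
  ∃ x : E, ∃ r₁ r₂ r₃ : Ray E, r₁.1 0 = x ∧ r₂.1 0 = x ∧ r₃.1 0 = x ∧
    r₁.endpoint = ξ₁ ∧ r₂.endpoint = ξ₂ ∧ r₃.endpoint = ξ₃ ∧
    ∃ θ₁ θ₂ θ₃ : ℝ, M.HasDir (p ∘ r₁.1) (p x) θ₁ ∧ M.HasDir (p ∘ r₂.1) (p x) θ₂ ∧
      M.HasDir (p ∘ r₃.1) (p x) θ₃ ∧ M.DirOrdered (p x) θ₁ θ₂ θ₃

/-- The pairs `(ξ, ξ')` and `(η, η')` of points at infinity are interlaced: `η` and `η'` are in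
different intervals of the complement of `{ξ, ξ'}` for the cyclic order. -/
def PairsInterlaced (ξ ξ' η η' : BoundaryAtInfinity E) : Prop :=
  (CyclicPos M p ξ η ξ' ∧ CyclicPos M p ξ' η' ξ) ∨ (CyclicPos M p ξ η' ξ' ∧ CyclicPos M p ξ' η ξ)

/-- `(ξ, ξ')` is the pair of points at infinity, at `-∞` and `+∞`, of the line `c`. -/
def HasEnds (c : ℝ → E) (ξ ξ' : BoundaryAtInfinity E) : Prop :=
  (∃ r : Ray E, (∀ t ≥ 0, r.1 t = c (-t)) ∧ r.endpoint = ξ) ∧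
  (∃ r : Ray E, (∀ t ≥ 0, r.1 t = c t) ∧ r.endpoint = ξ')

/-- Two local geodesics of `S` (possibly equal) are interlaced if they have lifts whose pairs of
points at infinity are interlaced. -/
def Interlaced (g h : LocalGeodesic S) : Prop :=
  ∃ g' h' : C(ℝ, E), (∀ t, p (g' t) = g t) ∧ (∀ t, p (h' t) = h t) ∧
    ∃ ξ ξ' η η', HasEnds g' ξ ξ' ∧ HasEnds h' η η' ∧ PairsInterlaced M p ξ ξ' η η'

/-- Flat laminations: non-empty closed sets of local geodesics (defined up to change of origin),
invariant under change of orientation, and which are not self-interlaced and pairwise not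
interlaced. -/
structure FlatLamination where
  leaves : Set (GeodesicClass S)
  nonempty : leaves.Nonempty
  isClosed : IsClosed leaves
  rev_mem : ∀ g : LocalGeodesic S, g.cls ∈ leaves → g.rev.cls ∈ leaves
  not_interlaced : ∀ g h : LocalGeodesic S, g.cls ∈ leaves → h.cls ∈ leaves →
    ¬ Interlaced M p g h

end Interlacing

/-! ### Arcs and transversality -/

section Transversality

variable {S : Type*} [MetricSpace S] (M : HalfTranslationSurface S)

/-- `α` is `C¹` with non-zero derivative on `[a, b]` (up to the end points, in flat coordinates),
and meets no singularity on `]a, b[`. -/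
def IsC1On (α : ℝ → S) (a b : ℝ) : Prop :=
  (∀ s ∈ Ioo a b, α s ∉ M.sing) ∧
  ∀ s ∈ Icc a b, ∃ z : ℝ → ℂ, ContDiffWithinAt ℝ 1 z (Icc a b) s ∧
    derivWithin z (Icc a b) s ≠ 0 ∧ ∀ᶠ s' in 𝓝[Icc a b] s, M.HasCoord (α s) (α s') (z s')

/-- Arcs: piecewise `C¹` maps `[0, 1] → S` which are homeomorphisms onto their image. -/
structure Arc where
  toMap : C(unitInterval, S)
  injective : Function.Injective toMap
  piecewiseC1 : ∃ (n : ℕ) (a : ℕ → ℝ), a 0 = 0 ∧ a n = 1 ∧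
    ∀ i < n, a i < a (i + 1) ∧ IsC1On M (Set.IccExtend zero_le_one toMap) (a i) (a (i + 1))

variable {M}

/-- The arc, extended by constants outside `[0, 1]`. -/
def Arc.ext (α : Arc M) : ℝ → S := Set.IccExtend zero_le_one α.toMap

/-- The image `α([0, 1])`. -/
def Arc.image (α : Arc M) : Set S := Set.range α.toMap

/-- The interior parameter `s` gives neither a singularity nor a singular point of `α`. -/
def Arc.RegularAt (α : Arc M) (s : ℝ) : Prop :=
  ∃ a b, 0 ≤ a ∧ a < s ∧ s < b ∧ b ≤ 1 ∧ IsC1On M α.ext a b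

/-- `α` at the parameter `s` and `g`, restricted to the times in `I`, at the time `t`, are tangent
at `α s = g t`: a half-tangent of `α` at `s` is a half-tangent of `g` at `t`. -/
def Arc.TangentAt (α : Arc M) (s : ℝ) (g : ℝ → S) (I : Set ℝ) (t : ℝ) : Prop :=
  ∃ σ ∈ ({1, -1} : Set ℝ), ∃ υ ∈ ({1, -1} : Set ℝ), (∀ᶠ u in 𝓝[>] (0 : ℝ), t + υ * u ∈ I) ∧
    ∃ θ θ', M.HasDir (fun u => α.ext (s + σ * u)) (α.ext s) θ ∧
      M.HasDir (fun u => g (t + υ * u)) (α.ext s) θ' ∧ M.SameDir (α.ext s) θ θ'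

/-- `α` crosses topologically, at the parameter `s`, the path `g` restricted to `I`, at the
time `t`: there are a neighbourhood `D` of `x = α s` which is a topological disc and a segment
`g([a, b])` of `g` through `g t` such that `D - g([a, b])` has exactly two connected components,
and these contain the parts in `D` of `α` before and after `x`, respectively. -/
def Arc.CrossesAt (α : Arc M) (s : ℝ) (g : ℝ → S) (I : Set ℝ) (t : ℝ) : Prop :=
  ∃ D ∈ 𝓝 (α.ext s), Nonempty (D ≃ₜ Metric.closedBall (0 : ℂ) 1) ∧
    ∃ a b, a ≤ t ∧ t ≤ b ∧ Icc a b ⊆ I ∧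
    ∃ y₁ ∈ D \ g '' Icc a b, ∃ y₂ ∈ D \ g '' Icc a b,
      connectedComponentIn (D \ g '' Icc a b) y₁ ≠ connectedComponentIn (D \ g '' Icc a b) y₂ ∧
      D \ g '' Icc a b = connectedComponentIn (D \ g '' Icc a b) y₁ ∪
        connectedComponentIn (D \ g '' Icc a b) y₂ ∧
      (∀ s' ∈ Ico 0 s, α.ext s' ∈ D → α.ext s' ∈ connectedComponentIn (D \ g '' Icc a b) y₁) ∧
      (∀ s' ∈ Ioc s 1, α.ext s' ∈ D → α.ext s' ∈ connectedComponentIn (D \ g '' Icc a b) y₂)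

/-- `α` is transverse to the path `g` restricted to the interval of times `I`: at each common
point, they are not tangent, and at each common point which is a singularity or a singular point
of `α` and is not an end point of `α`, they cross topologically. -/
def Arc.TransverseTo (α : Arc M) (g : ℝ → S) (I : Set ℝ) : Prop :=
  ∀ s ∈ Icc (0 : ℝ) 1, ∀ t ∈ I, g t = α.ext s →
    ¬ α.TangentAt s g I t ∧ (s ∈ Ioo (0 : ℝ) 1 → ¬ α.RegularAt s → α.CrossesAt s g I t)

/-- `α` is transverse to a set of leaves. -/
def Arc.TransverseToLeaves (α : Arc M) (L : Set (GeodesicClass S)) : Prop :=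
  ∀ g : LocalGeodesic S, g.cls ∈ L → α.TransverseTo g univ

/-- `G(α)`: the local geodesics transverse to `α` whose origin is on `α`. -/
def Arc.geodesics (α : Arc M) : Set (LocalGeodesic S) :=
  {g | α.TransverseTo g univ ∧ g 0 ∈ α.image}

/-! ### Holonomies and transverse measures -/

/-- Holonomies of the set of leaves `L` from `F₁ ⊆ G(α₁)` to `F₂ ⊆ G(α₂)`. Here `T g` is the first
positive time at which `g ∈ F₁` meets `α₂`, the holonomy is `g ↦ g.shift (T g)`, and `F₂` is
the image of `F₁`. -/
structure IsHolonomy (L : Set (GeodesicClass S)) (α₁ α₂ : Arc M)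
    (F₁ F₂ : Set (LocalGeodesic S)) (T : LocalGeodesic S → ℝ) : Prop where
  subset : F₁ ⊆ α₁.geodesics
  leaf : ∀ g ∈ F₁, g.cls ∈ L
  disjoint : Disjoint α₁.image α₂.image
  transverse : ∀ g ∈ F₁, α₂.TransverseTo g univ
  first : ∀ g ∈ F₁, IsLeast {t | 0 < t ∧ g t ∈ α₂.image} (T g)
  image : F₂ = (fun g => g.shift (T g)) '' F₁
  homeo : ∃ e : F₁ ≃ₜ F₂, ∀ g : F₁, ((e g : F₂) : LocalGeodesic S) = g.1.shift (T g.1)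
  homotopy : ∃ H : C(unitInterval × unitInterval, S),
    (∀ s, H (s, 0) = α₁.toMap s) ∧ (∀ s, H (s, 1) = α₂.toMap s) ∧
    (∀ t, ∃ β : Arc M, (∀ s, β.toMap s = H (s, t)) ∧
      ∀ g ∈ F₁, β.TransverseTo g (Icc 0 (T g))) ∧
    (∀ g ∈ F₁, ∃ s, ∃ φ : unitInterval → ℝ, Continuous φ ∧ StrictMono φ ∧ φ 0 = 0 ∧ φ 1 = T g ∧
      ∀ t, H (s, t) = g (φ t)) ∧
    (∀ s t, 0 < t → t < 1 → H (s, t) ∉ α₁.image ∧ H (s, t) ∉ α₂.image)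

/-- Transverse measures: for every arc `α` transverse to the set of leaves `L`, a Radon measure on
`G(α)`, with the four properties below (the values of `μ` at the other arcs are irrelevant).
The equalities of measures are written on Borel sets. -/
structure TransverseMeasure (M : HalfTranslationSurface S) (L : Set (GeodesicClass S)) where
  μ : ∀ α : Arc M, Measure α.geodesics
  locallyFinite : ∀ α, α.TransverseToLeaves L → IsLocallyFiniteMeasure (μ α)
  innerRegular : ∀ α, α.TransverseToLeaves L → (μ α).InnerRegular
  support_eq : ∀ α, α.TransverseToLeaves L → (μ α).support = {g | g.1.cls ∈ L}
  holonomy_inv : ∀ α₁ α₂, α₁.TransverseToLeaves L → α₂.TransverseToLeaves L →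
    ∀ F₁ F₂ T, MeasurableSet {g : α₁.geodesics | g.1 ∈ F₁} → IsHolonomy L α₁ α₂ F₁ F₂ T →
    ∀ B : Set (LocalGeodesic S), MeasurableSet B →
      μ α₁ {g | g.1 ∈ F₁ ∧ g.1.shift (T g.1) ∈ B} = μ α₂ {g | g.1 ∈ F₂ ∧ g.1 ∈ B}
  rev_inv : ∀ α, α.TransverseToLeaves L → ∀ B : Set (LocalGeodesic S), MeasurableSet B →
    μ α {g | g.1.rev ∈ B} = μ α {g | g.1 ∈ B}
  restrict : ∀ α α', α.TransverseToLeaves L → α'.TransverseToLeaves L → α'.image ⊆ α.image →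
    ∀ B : Set (LocalGeodesic S), MeasurableSet B →
      μ α {g | g.1 ∈ α'.geodesics ∧ g.1 ∈ B} = μ α' {g | g.1 ∈ B}

/-! ### Properties of leaves -/

/-- `l` is an isolated point of the set of leaves `L`. -/
def IsIsolatedLeaf (L : Set (GeodesicClass S)) (l : GeodesicClass S) : Prop :=
  ∃ U : Set (GeodesicClass S), IsOpen U ∧ U ∩ L = {l}

/-- `l` is positively recurrent: for a choice of origin outside the singularities, it comes back
arbitrarily close to its origin at arbitrarily large times. -/
def PositivelyRecurrent (M : HalfTranslationSurface S) (l : GeodesicClass S) : Prop :=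
  ∃ g : LocalGeodesic S, g.cls = l ∧ g 0 ∉ M.sing ∧
    ∀ T > 0, ∀ ε > 0, ∃ t > T, dist (g t) (g 0) < ε

/-- `l` is periodic. -/
def IsPeriodicLeaf (l : GeodesicClass S) : Prop :=
  ∃ g : LocalGeodesic S, g.cls = l ∧ ∃ T > 0, ∀ t, g (t + T) = g t

end Transversality

end

/-! ### Euclidean cones -/

/-! A leaf has a mass: the measure that a transverse arc gives to the single parametrised geodesic
whose origin is the point where the leaf meets the arc. Holonomy invariance makes this mass constant
along the leaf. Over regular points, a short transverse segment slides inside a flat half disc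
bounded by the leaf (`IsFlatMap.atom_eq`). At a singularity, a local geodesic bounds a sector of
some angle φ ≥ π; arcs attached to the leaf are swept across this sector, become its bisector when
they reach the singularity, and come out on the other side (`IsSector.mass_eq`). The connectedness
of ℝ then gives one mass `m` for the whole leaf (`exists_forall_hasMass`).

Suppose that an isolated leaf g is positively recurrent but not periodic, and take a short
perpendicular α to g at a regular point to which g returns. Since leaves are not interlaced, those
passing near the centre of a flat chart along g are almost parallel to g
(`IsFlatChart.exists_line`). Hence α is transverse to the whole lamination, and g crosses it at
every close return. The crossing times form an infinite, countable set and, g not being periodic,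
they give pairwise distinct points of G(α), all of mass `m`. But the leaves in G(α) form a compact
set: closed balls are compact by Hopf-Rinow, and Ascoli's theorem applies to the local geodesics
whose origin is in a compact set (`isCompact_localGeodesic`). Their measure is finite, so `m = 0`.

Since g is isolated, the part of the support of μ_α close to g consists only of the points where g
itself crosses α, which are countably many atoms of mass zero. So a neighbourhood of g is null
although g is in the support, a contradiction. -/

lemma norm_polarPt_sub_sq (ρ ρ' θ θ' : ℝ) :
    ‖polarPt ρ θ - polarPt ρ' θ'‖ ^ 2 = ρ ^ 2 + ρ' ^ 2 - 2 * ρ * ρ' * Real.cos (θ - θ') := by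
  rw [Complex.sq_norm, Complex.normSq_apply]
  simp only [polarPt, Complex.exp_mul_I, Complex.sub_re, Complex.mul_re, Complex.ofReal_re,
    Complex.add_re, Complex.sub_im, Complex.mul_im, Complex.ofReal_im, Complex.add_im,
    Complex.I_re, Complex.I_im, Complex.cos_ofReal_re, Complex.cos_ofReal_im,
    Complex.sin_ofReal_re, Complex.sin_ofReal_im, Real.cos_sub]
  have h1 := Real.sin_sq_add_cos_sq θ
  have h2 := Real.sin_sq_add_cos_sq θ'
  linear_combination ρ ^ 2 * h1 + ρ' ^ 2 * h2

lemma norm_polarPt (ρ θ : ℝ) : ‖polarPt ρ θ‖ = |ρ| := by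
  simp [polarPt, Complex.norm_exp_ofReal_mul_I]

lemma coneDist_of_le_pi {ρ ρ' φ : ℝ} (h : φ ≤ Real.pi) :
    coneDist ρ ρ' φ = ‖polarPt ρ φ - polarPt ρ' 0‖ := by
  rw [coneDist, min_eq_left h, ← Real.sqrt_sq (norm_nonneg (polarPt ρ φ - polarPt ρ' 0)),
    norm_polarPt_sub_sq]
  simp

lemma coneDist_abs_sub {ρ ρ' θ θ' : ℝ} (h : |θ - θ'| ≤ Real.pi) :
    coneDist ρ ρ' |θ - θ'| = ‖polarPt ρ θ - polarPt ρ' θ'‖ := by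
  rw [coneDist, min_eq_left h, Real.cos_abs, ← Real.sqrt_sq (norm_nonneg (polarPt ρ θ - _)),
    norm_polarPt_sub_sq]

lemma coneDist_of_pi_le {ρ ρ' φ : ℝ} (hρ : 0 ≤ ρ) (hρ' : 0 ≤ ρ') (h : Real.pi ≤ φ) :
    coneDist ρ ρ' φ = ρ + ρ' := by
  rw [coneDist, min_eq_right h, Real.cos_pi, ← Real.sqrt_sq (add_nonneg hρ hρ')]
  congr 1; ring

lemma coneDist_zero_right {ρ ρ' : ℝ} : coneDist ρ ρ' 0 = |ρ - ρ'| := by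
  rw [coneDist, min_eq_left Real.pi_pos.le, Real.cos_zero, ← Real.sqrt_sq_eq_abs]
  congr 1; ring

lemma coneDist_zero_left {ρ' φ : ℝ} (h : 0 ≤ ρ') : coneDist 0 ρ' φ = ρ' := by
  rw [coneDist]
  have : (0:ℝ) ^ 2 + ρ' ^ 2 - 2 * 0 * ρ' * Real.cos (min φ Real.pi) = ρ' ^ 2 := by ring
  rw [this, Real.sqrt_sq h]

lemma coneDist_mono {ρ ρ' φ φ' : ℝ} (hρ : 0 ≤ ρ) (hρ' : 0 ≤ ρ') (h0 : 0 ≤ φ) (h : φ ≤ φ') :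
    coneDist ρ ρ' φ ≤ coneDist ρ ρ' φ' := by
  unfold coneDist
  apply Real.sqrt_le_sqrt
  have : Real.cos (min φ' Real.pi) ≤ Real.cos (min φ Real.pi) :=
    Real.cos_le_cos_of_nonneg_of_le_pi (le_min h0 Real.pi_pos.le) (min_le_right _ _)
      (min_le_min_right _ h)
  have h2 : 0 ≤ 2 * ρ * ρ' := by positivity
  nlinarith [mul_le_mul_of_nonneg_left this h2]

lemma coneDist_sq {ρ ρ' φ : ℝ} (hρ : 0 ≤ ρ) (hρ' : 0 ≤ ρ') :
    coneDist ρ ρ' φ ^ 2 = ρ ^ 2 + ρ' ^ 2 - 2 * ρ * ρ' * Real.cos (min φ Real.pi) := by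
  rw [coneDist, Real.sq_sqrt]
  nlinarith [Real.cos_le_one (min φ Real.pi), mul_nonneg hρ hρ', sq_nonneg (ρ - ρ')]

lemma eq_zero_of_coneDist {ρ ρ' φ : ℝ} (hρ : 0 < ρ) (hρ' : 0 < ρ') (h0 : 0 ≤ φ)
    (h : coneDist ρ ρ' φ = |ρ - ρ'|) : φ = 0 := by
  have h1 := coneDist_sq (φ := φ) hρ.le hρ'.le
  rw [h, sq_abs] at h1
  have h2 : ρ * ρ' * (Real.cos (min φ Real.pi) - 1) = 0 := by nlinarith
  have h3 : Real.cos (min φ Real.pi) = 1 := by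
    rcases mul_eq_zero.1 h2 with h | h
    · exact absurd h (mul_pos hρ hρ').ne'
    · linarith
  have hm : 0 ≤ min φ Real.pi := le_min h0 Real.pi_pos.le
  rw [Real.cos_eq_one_iff_of_lt_of_lt (by linarith [Real.pi_pos])
    (by linarith [min_le_right φ Real.pi, Real.pi_pos])] at h3
  rcases min_choice φ Real.pi with h | h
  · rw [← h, h3]
  · rw [h] at h3; exact absurd h3 Real.pi_ne_zero

lemma pi_le_of_coneDist {ρ ρ' φ : ℝ} (hρ : 0 < ρ) (hρ' : 0 < ρ') (h0 : 0 ≤ φ)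
    (h : coneDist ρ ρ' φ = ρ + ρ') : Real.pi ≤ φ := by
  have h1 := coneDist_sq (φ := φ) hρ.le hρ'.le
  rw [h] at h1
  have h2 : ρ * ρ' * (Real.cos (min φ Real.pi) + 1) = 0 := by nlinarith
  have h3 : Real.cos (min φ Real.pi) = Real.cos Real.pi := by
    rw [Real.cos_pi]
    rcases mul_eq_zero.1 h2 with h | h
    · exact absurd h (mul_pos hρ hρ').ne'
    · linarith
  have := Real.injOn_cos ⟨le_min h0 Real.pi_pos.le, min_le_right _ _⟩ ⟨Real.pi_pos.le, le_rfl⟩ h3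
  rw [← this]; exact min_le_left _ _

/-- An arc of circle of radius ρ, of length at most ρφ, followed by a piece of radius joins the two
points. The factor ρ in front of the angle gives continuity of polar coordinates even at the apex.
-/
lemma coneDist_le {ρ ρ' φ : ℝ} (hρ : 0 ≤ ρ) (hρ' : 0 ≤ ρ') (h0 : 0 ≤ φ) :
    coneDist ρ ρ' φ ≤ |ρ - ρ'| + ρ * φ := by
  have h1 := coneDist_sq (φ := φ) hρ hρ'
  have hc : 1 - min φ Real.pi ^ 2 / 2 ≤ Real.cos (min φ Real.pi) := Real.one_sub_sq_div_two_le_cos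
  have hm : 0 ≤ min φ Real.pi := le_min h0 Real.pi_pos.le
  have hm' : min φ Real.pi ≤ φ := min_le_left _ _
  have key : coneDist ρ ρ' φ ^ 2 ≤ (ρ - ρ') ^ 2 + ρ * ρ' * φ ^ 2 := by
    rw [h1]
    have h3 : 0 ≤ ρ * ρ' := by positivity
    have h4 : min φ Real.pi ^ 2 ≤ φ ^ 2 := by gcongr
    nlinarith [mul_le_mul_of_nonneg_left hc h3, mul_le_mul_of_nonneg_left h4 h3]
  by_cases hle : ρ' ≤ ρ
  · apply abs_le_of_sq_le_sq' _ (by positivity) |>.2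
    rw [abs_of_nonneg (sub_nonneg.2 hle)]
    have : ρ * ρ' * φ ^ 2 ≤ ρ * ρ * φ ^ 2 := by gcongr
    nlinarith [mul_nonneg (sub_nonneg.2 hle) (mul_nonneg hρ h0)]
  · push Not at hle
    have hs : 0 ≤ ρ' - ρ := by linarith
    have hcl : coneDist ρ ρ' φ ≤ coneDist ρ ρ φ + (ρ' - ρ) := by
      have e : ∀ r, coneDist ρ r φ = ‖polarPt ρ (min φ Real.pi) - polarPt r 0‖ := by
        intro r
        rw [← coneDist_of_le_pi (min_le_right _ _)]
        unfold coneDist; simp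
      rw [e, e]
      have := norm_sub_le_norm_sub_add_norm_sub (polarPt ρ (min φ Real.pi)) (polarPt ρ 0)
        (polarPt ρ' 0)
      have h5 : ‖polarPt ρ 0 - polarPt ρ' 0‖ = ρ' - ρ := by
        simp only [polarPt, Complex.ofReal_zero, zero_mul, Complex.exp_zero, mul_one]
        rw [← Complex.ofReal_sub, Complex.norm_real, Real.norm_eq_abs, abs_sub_comm,
          abs_of_nonneg hs]
      linarith
    have h6 : coneDist ρ ρ φ ≤ ρ * φ := by
      apply abs_le_of_sq_le_sq' _ (by positivity) |>.2
      rw [coneDist_sq hρ hρ]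
      have h3 : 0 ≤ ρ * ρ := by positivity
      have h4 : min φ Real.pi ^ 2 ≤ φ ^ 2 := by gcongr
      nlinarith [mul_le_mul_of_nonneg_left hc h3, mul_le_mul_of_nonneg_left h4 h3]
    rw [abs_sub_comm, abs_of_nonneg hs]; linarith

/-! ### Spaces of directions -/

lemma linkDist_nonneg (b : Prop) (k : ℕ) (θ θ' : ℝ) : 0 ≤ linkDist b k θ θ' := by
  unfold linkDist; split_ifs <;> positivity

lemma linkDist_self (b : Prop) (k : ℕ) (θ : ℝ) : linkDist b k θ θ = 0 := by
  unfold linkDist; split_ifs <;> simp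

lemma linkDist_comm (b : Prop) (k : ℕ) (θ θ' : ℝ) : linkDist b k θ θ' = linkDist b k θ' θ := by
  unfold linkDist; split_ifs
  · exact abs_sub_comm _ _
  · rw [← norm_neg, ← AddCircle.coe_neg, neg_sub]

lemma linkDist_triangle (b : Prop) (k : ℕ) (θ₁ θ₂ θ₃ : ℝ) :
    linkDist b k θ₁ θ₃ ≤ linkDist b k θ₁ θ₂ + linkDist b k θ₂ θ₃ := by
  unfold linkDist; split_ifs
  · exact abs_sub_le _ _ _
  · rw [show θ₁ - θ₃ = (θ₁ - θ₂) + (θ₂ - θ₃) by ring, AddCircle.coe_add]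
    exact norm_add_le _ _

lemma linkDist_le_abs (b : Prop) (k : ℕ) (θ θ' : ℝ) : linkDist b k θ θ' ≤ |θ - θ'| := by
  unfold linkDist; split_ifs
  · exact le_rfl
  · rw [AddCircle.norm_eq]
    rcases eq_or_ne ((k : ℝ) * Real.pi) 0 with h | h
    · simp [h]
    have := round_le (((k : ℝ) * Real.pi)⁻¹ * (θ - θ')) 0
    have e : ∀ m : ℤ, |(θ - θ') - m * (k * Real.pi)| =
        |(k : ℝ) * Real.pi| * |((k : ℝ) * Real.pi)⁻¹ * (θ - θ') - m| := by
      intro m; rw [← abs_mul, mul_sub, mul_inv_cancel_left₀ h, mul_comm]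
    have h0 := e 0
    simp only [Int.cast_zero, zero_mul, sub_zero] at h0 this
    rw [e, h0]
    gcongr

/-- The circle of directions at an interior point has length at least 2π, so an angle at most π is
at most half of it and is not shortened by going around the other way. -/
lemma linkDist_eq_abs {b : Prop} {k : ℕ} (hk : ¬ b → 2 ≤ k) {θ θ' : ℝ}
    (h : |θ - θ'| ≤ Real.pi) : linkDist b k θ θ' = |θ - θ'| := by
  unfold linkDist; split_ifs with hb
  · rfl
  · have hk' : (2 : ℝ) ≤ k := by exact_mod_cast hk hb
    have hp := Real.pi_pos
    have hpos : 0 < (k : ℝ) * Real.pi := mul_pos (by linarith) hp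
    rw [AddCircle.norm_coe_eq_abs_iff _ hpos.ne', abs_of_pos hpos]
    nlinarith

lemma linkDist_congr_left {b : Prop} {k : ℕ} {θ₁ θ₂ : ℝ} (h : linkDist b k θ₁ θ₂ = 0) (θ : ℝ) :
    linkDist b k θ₁ θ = linkDist b k θ₂ θ := by
  have h1 := linkDist_triangle b k θ₁ θ₂ θ
  have h2 := linkDist_triangle b k θ₂ θ₁ θ
  rw [linkDist_comm b k θ₂ θ₁] at h2
  linarith

/-- A direction has a representative at the right distance of a given angle. -/
lemma exists_rep_linkDist {b : Prop} {k : ℕ} {τ θ θ' : ℝ} (h' : θ' ∈ linkSet b k τ) :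
    ∃ θ'' ∈ linkSet b k τ, linkDist b k θ'' θ' = 0 ∧ |θ'' - θ| = linkDist b k θ' θ := by
  by_cases hb : b
  · refine ⟨θ', h', linkDist_self _ _ _, ?_⟩
    simp [linkDist, hb]
  · refine ⟨θ' - round (((k : ℝ) * Real.pi)⁻¹ * (θ' - θ)) * (k * Real.pi), fun h => absurd h hb,
      ?_, ?_⟩
    · simp only [linkDist, hb, if_false]
      rw [sub_sub_cancel_left, norm_eq_zero, AddCircle.coe_eq_zero_iff]
      exact ⟨-round (((k : ℝ) * Real.pi)⁻¹ * (θ' - θ)), by simp⟩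
    · simp only [linkDist, hb, if_false]
      rw [AddCircle.norm_eq]
      congr 1; ring

namespace HalfTranslationSurface

variable {S : Type*} [MetricSpace S] (M : HalfTranslationSurface S)

/-- The distance between two directions at `x`. -/
noncomputable def ldist (x : S) (θ θ' : ℝ) : ℝ := linkDist (x ∈ M.bdry) (M.k x) θ θ'

variable {M}

lemma dist_pol_pol {x : S} {ρ ρ' θ θ' : ℝ} (hρ : 0 ≤ ρ) (hρR : ρ < M.rad x) (hρ' : 0 ≤ ρ')
    (hρR' : ρ' < M.rad x) (hθ : θ ∈ M.link x) (hθ' : θ' ∈ M.link x) :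
    dist (M.pol x ρ θ) (M.pol x ρ' θ') = coneDist ρ ρ' (M.ldist x θ θ') :=
  M.dist_pol x ρ ⟨hρ, hρR⟩ ρ' ⟨hρ', hρR'⟩ θ hθ θ' hθ'

/-- Sectors of angle at most π are flat pieces of the plane, singular centre or not. All the planar
geometry near a point is imported through this isometry. -/
lemma dist_pol_planar {x : S} {ρ ρ' θ θ' : ℝ} (hρ : 0 ≤ ρ) (hρR : ρ < M.rad x) (hρ' : 0 ≤ ρ')
    (hρR' : ρ' < M.rad x) (hθ : θ ∈ M.link x) (hθ' : θ' ∈ M.link x) (h : |θ - θ'| ≤ Real.pi) :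
    dist (M.pol x ρ θ) (M.pol x ρ' θ') = ‖polarPt ρ θ - polarPt ρ' θ'‖ := by
  rw [dist_pol_pol hρ hρR hρ' hρR' hθ hθ', ldist, linkDist_eq_abs (M.two_le_k x) h,
    coneDist_abs_sub h]

lemma dist_center_pol {x : S} {ρ θ : ℝ} (hρ : 0 ≤ ρ) (hρR : ρ < M.rad x) (hθ : θ ∈ M.link x) :
    dist x (M.pol x ρ θ) = ρ := by
  have h0 := M.pol_zero x θ hθ
  have : dist x (M.pol x ρ θ) = dist (M.pol x 0 θ) (M.pol x ρ θ) := by rw [h0]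
  rw [this, dist_pol_pol le_rfl (M.rad_pos x) hρ hρR hθ hθ, coneDist_zero_left hρ]

lemma pol_eq_of_ldist {x : S} {ρ θ θ' : ℝ} (hρ : 0 ≤ ρ) (hρR : ρ < M.rad x)
    (hθ : θ ∈ M.link x) (hθ' : θ' ∈ M.link x) (h : M.ldist x θ θ' = 0) :
    M.pol x ρ θ = M.pol x ρ θ' := by
  rw [← dist_eq_zero, dist_pol_pol hρ hρR hρ hρR hθ hθ', h, coneDist_zero_right, sub_self, abs_zero]

/-- Every point near `x` has polar coordinates. -/
lemma exists_pol {x y : S} (h : dist x y < M.rad x) :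
    ∃ θ ∈ M.link x, y = M.pol x (dist x y) θ := by
  obtain ⟨ρ, hρ, θ, hθ, rfl⟩ := M.pol_surj x y (by rwa [Metric.mem_ball, dist_comm])
  exact ⟨θ, hθ, by rw [dist_center_pol hρ.1 hρ.2 hθ]⟩

/-- Every point near `x` has polar coordinates, with an angle close to a given one. -/
lemma exists_pol_near {x y : S} (h : dist x y < M.rad x) (θ₀ : ℝ) :
    ∃ θ ∈ M.link x, y = M.pol x (dist x y) θ ∧ |θ - θ₀| = M.ldist x θ θ₀ := by
  obtain ⟨θ', hθ', hy⟩ := exists_pol h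
  obtain ⟨θ, hθ, h1, h2⟩ := exists_rep_linkDist (θ := θ₀) hθ'
  refine ⟨θ, hθ, ?_, ?_⟩
  · rw [pol_eq_of_ldist dist_nonneg h hθ hθ' h1]; exact hy
  · rw [h2]; exact (linkDist_congr_left h1 _).symm

/-- Near a point different from the centre, the angle is close to the angle of the point. -/
lemma exists_angle_near {x : S} {ρ θ : ℝ} (hρ : 0 < ρ) (hρR : ρ < M.rad x) (hθ : θ ∈ M.link x)
    {η : ℝ} (hη : 0 < η) : ∃ δ > 0, ∀ y, dist (M.pol x ρ θ) y < δ →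
      ∃ ρ' θ', 0 < ρ' ∧ ρ' < M.rad x ∧ θ' ∈ M.link x ∧ |θ' - θ| < η ∧ y = M.pol x ρ' θ' := by
  set η' := min η Real.pi with hη'
  have hη0 : 0 < η' := lt_min hη Real.pi_pos
  have hc : Real.cos η' < 1 := by
    rw [← Real.cos_zero]
    exact Real.cos_lt_cos_of_nonneg_of_le_pi le_rfl (min_le_right _ _) hη0
  -- The first two bounds keep the radius ρ' of y above ρ/2 and below `M.rad x`. An angle at least
  -- η' would then give a squared distance at least (ρ - ρ')² + 2ρρ'(1 - cos η') ≥ ρ²(1 - cos η'),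
  -- against the third bound.
  refine ⟨min (min (ρ / 2) (M.rad x - ρ)) (ρ * √(1 - Real.cos η')), ?_, fun y hy => ?_⟩
  · have : 0 < √(1 - Real.cos η') := Real.sqrt_pos.2 (by linarith)
    have h2 : 0 < M.rad x - ρ := by linarith
    positivity
  rw [lt_min_iff, lt_min_iff] at hy
  obtain ⟨⟨h1, h2⟩, h3⟩ := hy
  have hxz := dist_center_pol hρ.le hρR hθ
  have hd : dist x y < M.rad x := by
    have := dist_triangle x (M.pol x ρ θ) y; linarith
  have hd2 : ρ / 2 < dist x y := by
    have := dist_triangle x y (M.pol x ρ θ)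
    rw [dist_comm y] at this; linarith
  obtain ⟨θ', hθ', hy, ha⟩ := exists_pol_near hd θ
  refine ⟨dist x y, θ', by linarith, hd, hθ', ?_, hy⟩
  by_contra hcon
  push Not at hcon
  rw [ha] at hcon
  have h4 : dist (M.pol x ρ θ) y = coneDist ρ (dist x y) (M.ldist x θ' θ) := by
    conv_lhs => rw [hy]
    rw [dist_pol_pol hρ.le hρR dist_nonneg hd hθ hθ', ldist, linkDist_comm]; rfl
  have h5 : coneDist ρ (dist x y) η' ≤ dist (M.pol x ρ θ) y := by
    rw [h4]; exact coneDist_mono hρ.le dist_nonneg hη0.le (le_trans (min_le_left _ _) hcon)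
  have h6 := coneDist_sq (φ := η') hρ.le (dist_nonneg (x := x) (y := y))
  rw [min_eq_left (min_le_right _ _ : η' ≤ Real.pi)] at h6
  have h7 : (ρ * √(1 - Real.cos η')) ^ 2 = ρ ^ 2 * (1 - Real.cos η') := by
    rw [mul_pow, Real.sq_sqrt (by linarith)]
  have h8 : coneDist ρ (dist x y) η' ^ 2 < (ρ * √(1 - Real.cos η')) ^ 2 := by
    have : coneDist ρ (dist x y) η' < ρ * √(1 - Real.cos η') := lt_of_le_of_lt h5 h3
    have h0 : 0 ≤ coneDist ρ (dist x y) η' := Real.sqrt_nonneg _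
    gcongr
  rw [h6, h7] at h8
  nlinarith [sq_nonneg (ρ - dist x y), mul_pos hρ (sub_pos.2 hc)]

end HalfTranslationSurface

/-! ### Metric characterisation of regular points -/

lemma not_three_antipodal {o a b c : ℂ} {r : ℝ} (hr : 0 < r) (ha : dist o a = r)
    (hb : dist o b = r) (hc : dist o c = r) (hab : dist a b = 2 * r) (hbc : dist b c = 2 * r)
    (hac : dist a c = 2 * r) : False := by
  have key : ∀ p q : ℂ, dist o p = r → dist o q = r → dist p q = 2 * r → p - o = -(q - o) := by
    intro p q hp hq hpq
    -- Equality in the triangle inequality makes two such points antipodal with respect to o; three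
    -- points cannot be pairwise antipodal.
    have h := parallelogram_law_with_norm ℝ (p - o) (q - o)
    rw [sub_sub_sub_cancel_right, ← dist_eq_norm p o, ← dist_eq_norm q o, ← dist_eq_norm p q,
      dist_comm p o, dist_comm q o, hp, hq, hpq] at h
    have : ‖p - o + (q - o)‖ = 0 := by
      have h0 : ‖p - o + (q - o)‖ * ‖p - o + (q - o)‖ = 0 := by linarith
      exact mul_self_eq_zero.1 h0
    exact eq_neg_of_add_eq_zero_left (norm_eq_zero.1 this)
  have h1 := key a b ha hb hab
  have h2 := key b c hb hc hbc
  have h3 := key a c ha hc hac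
  have h4 : a - c = 0 := by linear_combination h1 - h2
  rw [dist_eq_norm, h4, norm_zero] at hac
  linarith

lemma le_norm_addCircle {C a x : ℝ} (hC : 0 ≤ C) (hax : a ≤ x) (hxC : x ≤ C - a) :
    a ≤ ‖(x : AddCircle C)‖ := by
  rw [AddCircle.norm_eq]
  set m := round (C⁻¹ * x)
  rcases lt_trichotomy m 0 with h | h | h
  · have : (m : ℝ) ≤ -1 := by exact_mod_cast (by omega : m ≤ -1)
    apply le_trans _ (le_abs_self _)
    nlinarith
  · rw [h]; simp only [Int.cast_zero, zero_mul, sub_zero]; exact hax.trans (le_abs_self _)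
  · have : (1 : ℝ) ≤ m := by exact_mod_cast (by omega : 1 ≤ m)
    apply le_trans _ (neg_le_abs _)
    nlinarith

namespace HalfTranslationSurface

variable {S : Type*} [MetricSpace S] {M : HalfTranslationSurface S}

lemma dist_pol_of_pi_le {x : S} {r θ θ' : ℝ} (hr : 0 ≤ r) (hrR : r < M.rad x)
    (hθ : θ ∈ M.link x) (hθ' : θ' ∈ M.link x) (h : Real.pi ≤ M.ldist x θ θ') :
    dist (M.pol x r θ) (M.pol x r θ') = 2 * r := by
  rw [dist_pol_pol hr hrR hr hrR hθ hθ', coneDist_of_pi_le hr hr h]; ring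

/-- A singular point has total angle at least 3π in the interior and at least 2π on the boundary,
which leaves room for three directions at pairwise distance at least π. By `not_three_antipodal`
this configuration does not exist in the plane, so it detects singularities metrically. -/
lemma exists_antipodal_of_mem_sing {y : S} (hy : y ∈ M.sing) {r : ℝ} (hr : 0 < r)
    (hrR : r < M.rad y) : ∃ a b c : S, dist y a = r ∧ dist y b = r ∧ dist y c = r ∧
      dist a b = 2 * r ∧ dist b c = 2 * r ∧ dist a c = 2 * r := by
  have hpi := Real.pi_pos
  suffices h : ∃ θ₁ ∈ M.link y, ∃ θ₂ ∈ M.link y, ∃ θ₃ ∈ M.link y,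
      Real.pi ≤ M.ldist y θ₁ θ₂ ∧ Real.pi ≤ M.ldist y θ₂ θ₃ ∧ Real.pi ≤ M.ldist y θ₁ θ₃ by
    obtain ⟨θ₁, h1, θ₂, h2, θ₃, h3, h12, h23, h13⟩ := h
    exact ⟨M.pol y r θ₁, M.pol y r θ₂, M.pol y r θ₃, dist_center_pol hr.le hrR h1,
      dist_center_pol hr.le hrR h2, dist_center_pol hr.le hrR h3,
      dist_pol_of_pi_le hr.le hrR h1 h2 h12, dist_pol_of_pi_le hr.le hrR h2 h3 h23,
      dist_pol_of_pi_le hr.le hrR h1 h3 h13⟩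
  rcases hy with ⟨hb, hk⟩ | ⟨hb, hk⟩
  · have h3 : (3 : ℝ) ≤ M.k y := by
      have := M.two_le_k y hb
      exact_mod_cast (by omega : 3 ≤ M.k y)
    refine ⟨2 * Real.pi, fun h => absurd h hb, Real.pi, fun h => absurd h hb, 0,
      fun h => absurd h hb, ?_⟩
    simp only [ldist, linkDist, hb, if_false]
    refine ⟨le_norm_addCircle ?_ ?_ ?_, le_norm_addCircle ?_ ?_ ?_, le_norm_addCircle ?_ ?_ ?_⟩ <;>
      nlinarith
  · have h2 : (2 : ℝ) ≤ M.k y := by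
      have := M.one_le_k y hb
      exact_mod_cast (by omega : 2 ≤ M.k y)
    refine ⟨M.τ y, fun _ => ⟨by linarith, by nlinarith⟩, M.τ y + Real.pi,
      fun _ => ⟨by linarith, by nlinarith⟩, M.τ y + 2 * Real.pi,
      fun _ => ⟨by linarith, by nlinarith⟩, ?_⟩
    simp only [ldist, linkDist, hb, if_true]
    refine ⟨?_, ?_, ?_⟩ <;> rw [abs_sub_comm] <;> refine le_trans ?_ (le_abs_self _) <;> linarith

/-- A point with a neighbourhood which embeds isometrically in the plane is regular. -/
lemma notMem_sing_of_isometric {y : S} {r : ℝ} (hr : 0 < r) (Z : S → ℂ)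
    (hZ : ∀ q ∈ Metric.ball y r, ∀ q' ∈ Metric.ball y r, dist (Z q) (Z q') = dist q q') :
    y ∉ M.sing := by
  intro hy
  have hR := M.rad_pos y
  set s := min (r / 2) (M.rad y / 2) with hs
  have hs0 : 0 < s := by positivity
  have hsr : s < r := lt_of_le_of_lt (min_le_left _ _) (by linarith)
  obtain ⟨a, b, c, ha, hb, hc, hab, hbc, hac⟩ := exists_antipodal_of_mem_sing hy hs0
    (lt_of_le_of_lt (min_le_right _ _) (by linarith))
  have my : y ∈ Metric.ball y r := Metric.mem_ball_self hr
  have ma : a ∈ Metric.ball y r := by rwa [Metric.mem_ball, dist_comm, ha]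
  have mb : b ∈ Metric.ball y r := by rwa [Metric.mem_ball, dist_comm, hb]
  have mc : c ∈ Metric.ball y r := by rwa [Metric.mem_ball, dist_comm, hc]
  refine not_three_antipodal (o := Z y) (a := Z a) (b := Z b) (c := Z c) hs0 ?_ ?_ ?_ ?_ ?_ ?_ <;>
    rw [hZ] <;> assumption

/-- In the ball of its polar chart, only the centre can be singular. -/
lemma notMem_sing_of_dist_lt {x y : S} (h : dist x y < M.rad x) (hne : y ≠ x) : y ∉ M.sing := by
  have hρ : 0 < dist x y := dist_pos.2 hne.symm
  obtain ⟨θ, hθ, hy⟩ := exists_pol h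
  obtain ⟨δ, hδ, H⟩ := exists_angle_near hρ h hθ (half_pos Real.pi_pos)
  rw [← hy] at H
  have H' : ∀ q : S, ∃ z : ℂ, dist y q < δ → ∃ ρ' θ', 0 < ρ' ∧ ρ' < M.rad x ∧ θ' ∈ M.link x ∧
      |θ' - θ| < Real.pi / 2 ∧ q = M.pol x ρ' θ' ∧ z = polarPt ρ' θ' := by
    intro q
    by_cases hq : dist y q < δ
    · obtain ⟨ρ', θ', h1, h2, h3, h4, h5⟩ := H q hq
      exact ⟨_, fun _ => ⟨ρ', θ', h1, h2, h3, h4, h5, rfl⟩⟩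
    · exact ⟨0, fun h => absurd h hq⟩
  choose Z hZ using H'
  refine notMem_sing_of_isometric hδ Z fun q hq q' hq' => ?_
  obtain ⟨ρ₁, θ₁, h1, h2, h3, h4, h5, h6⟩ := hZ q (by rwa [Metric.mem_ball, dist_comm] at hq)
  obtain ⟨ρ₂, θ₂, k1, k2, k3, k4, k5, k6⟩ := hZ q' (by rwa [Metric.mem_ball, dist_comm] at hq')
  rw [h6, k6, h5, k5, dist_pol_planar h1.le h2 k1.le k2 h3 k3, dist_eq_norm]
  have := abs_sub_le θ₁ θ θ₂
  rw [abs_sub_comm θ θ₂] at this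
  linarith

/-! ### Flat coordinates at a regular point -/

lemma exists_hasCoord {x y : S} (h : dist x y < M.rad x) : ∃ z, M.HasCoord x y z := by
  obtain ⟨θ, hθ, hy⟩ := exists_pol h
  have hn : ‖polarPt (dist x y) θ‖ = dist x y := by rw [norm_polarPt, abs_of_nonneg dist_nonneg]
  exact ⟨polarPt (dist x y) θ, by rwa [hn], θ, hθ, by rw [hn], by rw [hn]; exact hy⟩

lemma HasCoord.norm_eq {x y : S} {z : ℂ} (h : M.HasCoord x y z) : ‖z‖ = dist x y := by
  obtain ⟨h1, θ, hθ, h2, h3⟩ := h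
  conv_rhs => rw [h3]
  rw [dist_center_pol (norm_nonneg _) h1 hθ]

lemma polarPt_eq_of_ldist {x : S} (hb : x ∉ M.bdry) (hk : M.k x = 2) {θ θ' : ℝ}
    (h : M.ldist x θ θ' = 0) (ρ : ℝ) : polarPt ρ θ = polarPt ρ θ' := by
  simp only [ldist, linkDist, hb, if_false] at h
  rw [norm_eq_zero, AddCircle.coe_eq_zero_iff] at h
  obtain ⟨n, hn⟩ := h
  have : θ = θ' + n * (2 * Real.pi) := by rw [hk] at hn; simp at hn; linarith
  rw [this, polarPt, polarPt]
  congr 1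
  rw [Complex.exp_eq_exp_iff_exists_int]
  exact ⟨n, by push_cast; ring⟩

lemma ldist_le_pi {x : S} (hb : x ∉ M.bdry) (hk : M.k x = 2) (θ θ' : ℝ) :
    M.ldist x θ θ' ≤ Real.pi := by
  simp only [ldist, linkDist, hb, if_false]
  have h0 : ((M.k x : ℕ) : ℝ) * Real.pi ≠ 0 := by rw [hk]; positivity
  refine (AddCircle.norm_le_half_period _ h0).trans ?_
  rw [hk, abs_of_pos (by positivity)]; push_cast; linarith

/-- At a regular centre the angle is 2π (disc) or π (half disc), so any two directions are at
distance at most π and the whole polar chart is planar. -/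
lemma HasCoord.dist_eq {x y y' : S} (hx : x ∉ M.sing) {z z' : ℂ} (h : M.HasCoord x y z)
    (h' : M.HasCoord x y' z') : dist y y' = dist z z' := by
  obtain ⟨h1, θ, hθ, h2, h3⟩ := h
  obtain ⟨h1', θ', hθ', h2', h3'⟩ := h'
  by_cases hb : x ∈ M.bdry
  · have hk : M.k x = 1 := by
      by_contra hk; exact hx (Or.inr ⟨hb, hk⟩)
    have a1 := hθ hb
    have a2 := hθ' hb
    rw [hk] at a1 a2
    rw [h3, h3', dist_pol_planar (norm_nonneg _) h1 (norm_nonneg _) h1' hθ hθ', ← h2, ← h2',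
      dist_eq_norm]
    rw [abs_le]; push_cast at a1 a2
    constructor <;> linarith [a1.1, a1.2, a2.1, a2.2]
  · have hk : M.k x = 2 := by
      by_contra hk; exact hx (Or.inl ⟨hb, hk⟩)
    obtain ⟨θ'', hθ'', e1, e2⟩ := exists_rep_linkDist (θ := θ') hθ
    rw [h3, h3', ← pol_eq_of_ldist (norm_nonneg _) h1 hθ'' hθ e1,
      dist_pol_planar (norm_nonneg _) h1 (norm_nonneg _) h1' hθ'' hθ',
      polarPt_eq_of_ldist hb hk e1, ← h2, ← h2', dist_eq_norm]
    rw [e2]; exact ldist_le_pi hb hk _ _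

/-! ### Geodesic rays in polar coordinates -/

/-- Two points of the ray are at a distance equal to the difference of their distances to x; by
`eq_zero_of_coneDist` this is possible only on the same radius. -/
lemma exists_angle_of_isometric_ray {x : S} {c : ℝ → S} {σ : ℝ} (hσ : 0 < σ) (h0 : c 0 = x)
    (hc : ∀ s ∈ Ico 0 σ, ∀ s' ∈ Ico 0 σ, dist (c s) (c s') = |s - s'|) :
    ∃ θ ∈ M.link x, ∀ s ∈ Ico 0 σ, s < M.rad x → c s = M.pol x s θ := by
  have hR := M.rad_pos x
  have hd : ∀ s ∈ Ico 0 σ, dist x (c s) = s := by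
    intro s hs
    rw [← h0, hc 0 ⟨le_rfl, hσ⟩ s hs, zero_sub, abs_neg, abs_of_nonneg hs.1]
  set s₁ := min (σ / 2) (M.rad x / 2) with hs₁
  have hp : 0 < s₁ := by positivity
  have m₁ : s₁ ∈ Ico 0 σ := ⟨hp.le, lt_of_le_of_lt (min_le_left _ _) (by linarith)⟩
  have r₁ : s₁ < M.rad x := lt_of_le_of_lt (min_le_right _ _) (by linarith)
  obtain ⟨θ, hθ, e⟩ := exists_pol (M := M) (x := x) (y := c s₁) (by rwa [hd _ m₁])
  rw [hd _ m₁] at e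
  refine ⟨θ, hθ, fun s hs hsR => ?_⟩
  rcases hs.1.eq_or_lt with h | h
  · rw [← h, h0, M.pol_zero x θ hθ]
  obtain ⟨θ', hθ', e'⟩ := exists_pol (M := M) (x := x) (y := c s) (by rwa [hd _ hs])
  rw [hd _ hs] at e'
  have := hc s hs s₁ m₁
  rw [e, e', dist_pol_pol h.le hsR hp.le r₁ hθ' hθ] at this
  have := eq_zero_of_coneDist h hp (linkDist_nonneg _ _ _ _) this
  rw [e', pol_eq_of_ldist h.le hsR hθ' hθ this]

lemma pi_le_ldist {x : S} {r r' θ θ' : ℝ} (hr : 0 < r) (hrR : r < M.rad x) (hr' : 0 < r')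
    (hrR' : r' < M.rad x) (hθ : θ ∈ M.link x)
    (hθ' : θ' ∈ M.link x) (h : dist (M.pol x r θ) (M.pol x r' θ') = r + r') :
    Real.pi ≤ M.ldist x θ θ' := by
  rw [dist_pol_pol hr.le hrR hr'.le hrR' hθ hθ'] at h
  exact pi_le_of_coneDist hr hr' (linkDist_nonneg _ _ _ _) h

/-- A local geodesic is, near each of its points, the union of two radii which make an angle at
least `π`. -/
lemma exists_directions (g : ℝ → S) (hg : IsLocalGeodesicOn g univ) (t : ℝ) :
    ∃ ε > 0, ε ≤ M.rad (g t) ∧ ∃ θp ∈ M.link (g t), ∃ θm ∈ M.link (g t),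
      Real.pi ≤ M.ldist (g t) θp θm ∧
      (∀ u ∈ Ico 0 ε, g (t + u) = M.pol (g t) u θp) ∧
      (∀ u ∈ Ico 0 ε, g (t - u) = M.pol (g t) u θm) ∧
      (∀ s s', |s - t| < ε → |s' - t| < ε → dist (g s) (g s') = |s - s'|) := by
  obtain ⟨ε₀, hε₀, H⟩ := hg t (mem_univ _)
  have hR := M.rad_pos (g t)
  set ε := min ε₀ (M.rad (g t)) with hε
  have hε0 : 0 < ε := by positivity
  have H' : ∀ s s', |s - t| < ε → |s' - t| < ε → dist (g s) (g s') = |s - s'| := fun s s' h h' =>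
    H s (mem_univ _) s' (mem_univ _) (h.trans_le (min_le_left _ _)) (h'.trans_le (min_le_left _ _))
  have aux : ∀ u ∈ Ico 0 ε, |u| < ε := fun u hu => by rw [abs_of_nonneg hu.1]; exact hu.2
  obtain ⟨θp, hθp, hp⟩ := exists_angle_of_isometric_ray (M := M) (c := fun u => g (t + u)) hε0
    (x := g t) (by simp) (fun s hs s' hs' => by
      rw [H' _ _ (by simpa using aux s hs) (by simpa using aux s' hs')]; congr 1; ring)
  obtain ⟨θm, hθm, hm⟩ := exists_angle_of_isometric_ray (M := M) (c := fun u => g (t - u)) hε0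
    (x := g t) (by simp) (fun s hs s' hs' => by
      rw [H' _ _ (by simpa using aux s hs) (by simpa using aux s' hs'), abs_sub_comm]
      congr 1; ring)
  have hp' : ∀ u ∈ Ico 0 ε, g (t + u) = M.pol (g t) u θp :=
    fun u hu => hp u hu (hu.2.trans_le (min_le_right _ _))
  have hm' : ∀ u ∈ Ico 0 ε, g (t - u) = M.pol (g t) u θm :=
    fun u hu => hm u hu (hu.2.trans_le (min_le_right _ _))
  refine ⟨ε, hε0, min_le_right _ _, θp, hθp, θm, hθm, ?_, hp', hm', H'⟩
  have m2 : ε / 2 ∈ Ico 0 ε := ⟨by positivity, by linarith⟩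
  have r2 : ε / 2 < M.rad (g t) := m2.2.trans_le (min_le_right _ _)
  apply pi_le_ldist (half_pos hε0) r2 (half_pos hε0) r2 hθp hθm
  rw [← hp' _ m2, ← hm' _ m2, H' _ _ (by simpa using aux _ m2) (by simpa using aux _ m2)]
  rw [abs_of_nonneg] <;> linarith

end HalfTranslationSurface

/-! ### Tangency of arcs and geodesics, and construction of C¹ arcs -/

section Tangency

open HalfTranslationSurface

variable {S : Type*} [MetricSpace S] {M : HalfTranslationSurface S}

/-- If an arc is tangent to a geodesic at a point, then the points of the arc near this point are
closer and closer to the points of the geodesic at the same distance. -/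
lemma Arc.TangentAt.eventually_dist_le {α : Arc M} {s t : ℝ} {g : ℝ → S} {I : Set ℝ}
    (h : α.TangentAt s g I t) (hst : g t = α.ext s) {ε : ℝ} (hε : 0 < ε)
    (hg : ∀ u u', |u - t| < ε → |u' - t| < ε → dist (g u) (g u') = |u - u'|) :
    ∃ σ ∈ ({1, -1} : Set ℝ), ∃ υ ∈ ({1, -1} : Set ℝ),
      (∀ᶠ u in 𝓝[>] (0 : ℝ), t + υ * u ∈ I) ∧
      Tendsto (fun u => dist (α.ext s) (α.ext (s + σ * u))) (𝓝[>] 0) (𝓝[>] 0) ∧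
      ∀ δ > 0, ∀ᶠ u in 𝓝[>] (0 : ℝ),
        dist (α.ext (s + σ * u)) (g (t + υ * dist (α.ext s) (α.ext (s + σ * u)))) ≤
          δ * dist (α.ext s) (α.ext (s + σ * u)) := by
  obtain ⟨σ, hσ, υ, hυ, hI, θ, θ', ⟨hθ, ρ, ϑ, hev, hρ, hϑ⟩, ⟨hθ', ρ', ϑ', hev', hρ', hϑ'⟩, hsame⟩ := h
  set d : ℝ → ℝ := fun u => dist (α.ext s) (α.ext (s + σ * u)) with hd
  have hdρ : ∀ᶠ u in 𝓝[>] (0 : ℝ), d u = ρ u := by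
    filter_upwards [hev] with u hu
    simp only [hd]
    rw [hu.2.2, dist_center_pol hu.1.1.le hu.1.2 hu.2.1]
  have hd0 : Tendsto d (𝓝[>] 0) (𝓝[>] 0) := by
    refine tendsto_nhdsWithin_iff.2 ⟨(tendsto_congr' hdρ).2 hρ, ?_⟩
    filter_upwards [hev, hdρ] with u hu hu'
    rw [hu']; exact hu.1.1
  have hυ1 : |υ| = 1 := by rcases hυ with rfl | rfl <;> simp
  have hsmall : ∀ᶠ u in 𝓝[>] (0 : ℝ), u ∈ Ioo 0 ε := Ioo_mem_nhdsGT hε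
  have hg' : ∀ᶠ u in 𝓝[>] (0 : ℝ), u < M.rad (α.ext s) ∧ 0 < u ∧ ϑ' u ∈ M.link (α.ext s) ∧
      g (t + υ * u) = M.pol (α.ext s) u (ϑ' u) := by
    filter_upwards [hev', hsmall] with u hu hu'
    have e : ρ' u = u := by
      rw [← dist_center_pol hu.1.1.le hu.1.2 hu.2.1, ← hu.2.2, ← hst,
        hg t (t + υ * u) (by simpa using hε) (by
          rw [add_sub_cancel_left, abs_mul, hυ1, one_mul, abs_of_pos hu'.1]; exact hu'.2)]
      rw [sub_add_cancel_left, abs_neg, abs_mul, hυ1, one_mul, abs_of_pos hu'.1]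
    have h2 := hu.2.2
    rw [e] at h2
    exact ⟨e ▸ hu.1.2, hu'.1, hu.2.1, h2⟩
  refine ⟨σ, hσ, υ, hυ, hI, hd0, fun δ hδ => ?_⟩
  have hA : ∀ᶠ u in 𝓝[>] (0 : ℝ), |ϑ u - θ| < δ / 2 := by
    have := (Metric.tendsto_nhds.1 hϑ) (δ / 2) (half_pos hδ)
    simpa [Real.dist_eq] using this
  have hB : ∀ᶠ u in 𝓝[>] (0 : ℝ), |ϑ' u - θ'| < δ / 2 := by
    have := (Metric.tendsto_nhds.1 hϑ') (δ / 2) (half_pos hδ)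
    simpa [Real.dist_eq] using this
  filter_upwards [hev, hdρ, hd0.eventually hg', hA, hd0.eventually hB] with u h1 h2 h3 h4 h5
  change dist (α.ext (s + σ * u)) (g (t + υ * d u)) ≤ δ * d u
  rw [h1.2.2, h3.2.2.2, ← h2, dist_pol_pol h3.2.1.le h3.1 h3.2.1.le h3.1 h1.2.1 h3.2.2.1]
  -- Both half-tangents have the same direction, and each polar angle is within δ/2 of its limit.
  -- The two points compared have the same radius, so this angle bounds their distance.
  have hl : M.ldist (α.ext s) (ϑ u) (ϑ' (d u)) ≤ δ := by
    have a1 := linkDist_triangle (α.ext s ∈ M.bdry) (M.k (α.ext s)) (ϑ u) θ (ϑ' (d u))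
    have a2 := linkDist_triangle (α.ext s ∈ M.bdry) (M.k (α.ext s)) θ θ' (ϑ' (d u))
    have a3 := linkDist_le_abs (α.ext s ∈ M.bdry) (M.k (α.ext s)) (ϑ u) θ
    have a4 := linkDist_le_abs (α.ext s ∈ M.bdry) (M.k (α.ext s)) θ' (ϑ' (d u))
    have a5 : linkDist (α.ext s ∈ M.bdry) (M.k (α.ext s)) θ θ' = 0 := hsame
    rw [abs_sub_comm] at a4
    unfold ldist
    linarith
  refine (coneDist_le h3.2.1.le h3.2.1.le (linkDist_nonneg _ _ _ _)).trans ?_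
  rw [sub_self, abs_zero, zero_add, mul_comm]
  exact mul_le_mul_of_nonneg_right hl h3.2.1.le

/-- The flat coordinates at a regular point, in terms of an isometric map from a piece of the
plane. -/
lemma HalfTranslationSurface.exists_isometry_hasCoord {y : S} (hy : y ∉ M.sing) {F : ℂ → S}
    {W : Set ℂ} {z₀ : ℂ} (hz₀ : F z₀ = y) (h0 : z₀ ∈ W)
    (hF : ∀ z ∈ W, ∀ w ∈ W, dist (F z) (F w) = dist z w)
    (hW : ∀ᶠ r : ℝ in 𝓝[>] 0, z₀ + r ∈ W ∧ z₀ + r * Complex.I ∈ W) :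
    ∃ A : ℂ →L[ℝ] ℂ, (∀ z, ‖A z‖ = ‖z‖) ∧
      ∀ z ∈ W, dist z z₀ < M.rad y → M.HasCoord y (F z) (A (z - z₀)) := by
  have hex : ∀ z, ∃ ζ, z ∈ W → dist z z₀ < M.rad y → M.HasCoord y (F z) ζ := by
    intro z
    by_cases hz : z ∈ W ∧ dist z z₀ < M.rad y
    · obtain ⟨ζ, hζ⟩ := exists_hasCoord (M := M) (x := y) (y := F z)
        (by
          have h := hz.2
          rwa [dist_comm, ← hF _ h0 _ hz.1, hz₀] at h)
      exact ⟨ζ, fun _ _ => hζ⟩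
    · exact ⟨0, fun h h' => absurd ⟨h, h'⟩ hz⟩
  choose ζ hζ using hex
  have hn : ∀ z ∈ W, dist z z₀ < M.rad y → ‖ζ z‖ = ‖z - z₀‖ := by
    intro z hz hz'
    rw [(hζ z hz hz').norm_eq, ← hz₀, hF _ h0 _ hz, dist_comm, dist_eq_norm]
  have hin : ∀ z ∈ W, dist z z₀ < M.rad y → ∀ w ∈ W, dist w z₀ < M.rad y →
      inner ℝ (ζ z) (ζ w) = inner ℝ (z - z₀) (w - z₀) := by
    intro z hz hz' w hw hw'
    have h1 : ‖ζ z - ζ w‖ = ‖(z - z₀) - (w - z₀)‖ := by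
      rw [sub_sub_sub_cancel_right, ← dist_eq_norm, ← dist_eq_norm,
        ← (hζ z hz hz').dist_eq hy (hζ w hw hw'), hF _ hz _ hw]
    have h2 := norm_sub_sq_real (ζ z) (ζ w)
    have h3 := norm_sub_sq_real (z - z₀) (w - z₀)
    rw [h1, h3, hn z hz hz', hn w hw hw'] at h2
    linarith
  obtain ⟨r, ⟨hr1, hr2⟩, hr0, hrR⟩ := (hW.and (Ioo_mem_nhdsGT (M.rad_pos y))).exists
  have hr' : (r : ℂ) ≠ 0 := by exact_mod_cast hr0.ne'
  have d1 : dist (z₀ + r) z₀ < M.rad y := by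
    rw [dist_eq_norm, add_sub_cancel_left, Complex.norm_real, Real.norm_eq_abs, abs_of_pos hr0]
    exact hrR
  have d2 : dist (z₀ + r * Complex.I) z₀ < M.rad y := by
    rw [dist_eq_norm, add_sub_cancel_left, norm_mul, Complex.norm_real, Real.norm_eq_abs,
      abs_of_pos hr0, Complex.norm_I, mul_one]
    exact hrR
  -- Distances to the origin and mutual distances are preserved, hence so are inner products.
  -- Rescaling the coordinates of two orthogonal displacements gives an orthonormal frame, in which
  -- the new coordinate has the components of z - z₀: the change of coordinates is linear.
  set e₁ := r⁻¹ • ζ (z₀ + r) with he₁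
  set e₂ := r⁻¹ • ζ (z₀ + r * Complex.I) with he₂
  have i1 : ∀ z ∈ W, dist z z₀ < M.rad y → inner ℝ (ζ z) e₁ = (z - z₀).re := by
    intro z hz hz'
    rw [he₁, inner_smul_right, hin z hz hz' _ hr1 d1, add_sub_cancel_left]
    simp only [Complex.inner, Complex.mul_re, Complex.conj_re, Complex.conj_im,
      Complex.ofReal_re, Complex.ofReal_im]
    field_simp; ring
  have i2 : ∀ z ∈ W, dist z z₀ < M.rad y → inner ℝ (ζ z) e₂ = (z - z₀).im := by
    intro z hz hz'
    rw [he₂, inner_smul_right, hin z hz hz' _ hr2 d2, add_sub_cancel_left]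
    simp only [Complex.inner, Complex.mul_re, Complex.conj_re, Complex.conj_im,
      Complex.ofReal_re, Complex.ofReal_im, Complex.mul_im, Complex.I_re, Complex.I_im]
    field_simp; ring
  have n11 : inner ℝ e₁ e₁ = 1 := by
    nth_rewrite 1 [he₁]
    rw [real_inner_smul_left, i1 _ hr1 d1, add_sub_cancel_left, Complex.ofReal_re]
    field_simp
  have n12 : inner ℝ e₁ e₂ = 0 := by
    nth_rewrite 1 [he₁]
    rw [real_inner_smul_left, i2 _ hr1 d1, add_sub_cancel_left, Complex.ofReal_im, mul_zero]
  have n22 : inner ℝ e₂ e₂ = 1 := by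
    nth_rewrite 1 [he₂]
    rw [real_inner_smul_left, i2 _ hr2 d2, add_sub_cancel_left]
    simp only [Complex.mul_im, Complex.ofReal_re, Complex.I_im, Complex.ofReal_im, Complex.I_re]
    field_simp; ring
  have nn : ∀ a b : ℝ, ‖a • e₁ + b • e₂‖ ^ 2 = a ^ 2 + b ^ 2 := by
    intro a b
    rw [← real_inner_self_eq_norm_sq]
    simp only [inner_add_left, inner_add_right, real_inner_smul_left, real_inner_smul_right,
      n11, n12, n22, real_inner_comm e₁ e₂]
    ring
  clear_value e₁ e₂
  refine ⟨Complex.reCLM.smulRight e₁ + Complex.imCLM.smulRight e₂, fun z => ?_,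
    fun z hz hz' => ?_⟩
  · rw [← sq_eq_sq₀ (norm_nonneg _) (norm_nonneg _)]
    simp only [add_apply, ContinuousLinearMap.smulRight_apply,
      Complex.reCLM_apply, Complex.imCLM_apply]
    rw [nn, Complex.sq_norm, Complex.normSq_apply]; ring
  · suffices h : ζ z = (z - z₀).re • e₁ + (z - z₀).im • e₂ by
      have h' := hζ z hz hz'
      rwa [h] at h'
    rw [← sub_eq_zero, ← norm_eq_zero, ← sq_eq_zero_iff, norm_sub_sq_real, nn, hn z hz hz',
      inner_add_right, real_inner_smul_right, real_inner_smul_right, i1 z hz hz', i2 z hz hz',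
      Complex.sq_norm, Complex.normSq_apply]
    ring

/-! ### Construction of arcs -/

lemma IsC1On.congr {c c' : ℝ → S} {a b : ℝ} (h : IsC1On M c a b) (e : EqOn c' c (Icc a b)) :
    IsC1On M c' a b := by
  refine ⟨fun s hs => by rw [e (Ioo_subset_Icc_self hs)]; exact h.1 s hs, fun s hs => ?_⟩
  obtain ⟨z, h1, h2, h3⟩ := h.2 s hs
  refine ⟨z, h1, h2, ?_⟩
  filter_upwards [h3, self_mem_nhdsWithin] with s' hs' hm
  rw [e hs, e hm]; exact hs'

/-- The arc with a given `C¹` parametrisation. -/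
noncomputable def mkArc (c : ℝ → S) (hc : ContinuousOn c (Icc 0 1)) (hinj : InjOn c (Icc 0 1))
    (hC : IsC1On M c 0 1) : Arc M where
  toMap := ⟨fun s => c s, continuousOn_iff_continuous_domRestrict.1 hc⟩
  injective := fun s s' h => Subtype.ext (hinj s.2 s'.2 h)
  piecewiseC1 := by
    refine ⟨1, fun i => i, by simp, by simp, fun i hi => ?_⟩
    obtain rfl : i = 0 := by omega
    refine ⟨by simp, ?_⟩
    simp only [Nat.cast_zero, zero_add, Nat.cast_one]
    exact hC.congr fun s hs => by rw [IccExtend_of_mem _ _ hs]; rfl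

lemma mkArc_ext {c : ℝ → S} {hc : ContinuousOn c (Icc 0 1)} {hinj : InjOn c (Icc 0 1)}
    {hC : IsC1On M c 0 1} {s : ℝ} (hs : s ∈ Icc (0 : ℝ) 1) : (mkArc c hc hinj hC).ext s = c s := by
  rw [Arc.ext, IccExtend_of_mem _ _ hs]; rfl

lemma mkArc_image {c : ℝ → S} {hc : ContinuousOn c (Icc 0 1)} {hinj : InjOn c (Icc 0 1)}
    {hC : IsC1On M c 0 1} : (mkArc c hc hinj hC).image = c '' Icc 0 1 := by
  ext y; constructor
  · rintro ⟨s, rfl⟩; exact ⟨s, s.2, rfl⟩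
  · rintro ⟨s, hs, rfl⟩; exact ⟨⟨s, hs⟩, rfl⟩

lemma Arc.ext_mem_image (α : Arc M) (s : ℝ) : α.ext s ∈ α.image :=
  ⟨projIcc 0 1 zero_le_one s, rfl⟩

/-- An arc made of one C¹ piece has no singular interior parameter, so the topological crossing
condition is never called for and only tangency has to be excluded. -/
lemma mkArc_transverseTo {c : ℝ → S} {hc : ContinuousOn c (Icc 0 1)} {hinj : InjOn c (Icc 0 1)}
    {hC : IsC1On M c 0 1} {g : ℝ → S} {I : Set ℝ}
    (h : ∀ s ∈ Icc (0 : ℝ) 1, ∀ t ∈ I, g t = c s → ¬ (mkArc c hc hinj hC).TangentAt s g I t) :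
    (mkArc c hc hinj hC).TransverseTo g I := by
  intro s hs t ht e
  refine ⟨h s hs t ht (by rw [e, mkArc_ext hs]), fun hs' hr => absurd ?_ hr⟩
  exact ⟨0, 1, le_rfl, hs'.1, hs'.2, le_rfl, hC.congr fun s hs => mkArc_ext hs⟩

/-- A curve read in an isometric map from a piece of the plane is `C¹` at a parameter. -/
lemma exists_c1_coord {c : ℝ → S} {s : ℝ} (hs : s ∈ Icc (0 : ℝ) 1) (hy : c s ∉ M.sing)
    {F : ℂ → S} {W : Set ℂ} {Z : ℝ → ℂ} {Z' : ℂ} (h0 : Z s ∈ W) (hz₀ : F (Z s) = c s)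
    (hF : ∀ z ∈ W, ∀ w ∈ W, dist (F z) (F w) = dist z w)
    (hW : ∀ᶠ r : ℝ in 𝓝[>] 0, Z s + r ∈ W ∧ Z s + r * Complex.I ∈ W)
    (hZ : ContDiffWithinAt ℝ 1 Z (Icc 0 1) s) (hZ' : HasDerivWithinAt Z Z' (Icc 0 1) s)
    (hne : Z' ≠ 0) (hc : ∀ᶠ s' in 𝓝[Icc 0 1] s, Z s' ∈ W ∧ c s' = F (Z s')) :
    ∃ z : ℝ → ℂ, ContDiffWithinAt ℝ 1 z (Icc 0 1) s ∧
      derivWithin z (Icc 0 1) s ≠ 0 ∧ ∀ᶠ s' in 𝓝[Icc 0 1] s, M.HasCoord (c s) (c s') (z s') := by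
  obtain ⟨A, hA, hA'⟩ := exists_isometry_hasCoord hy hz₀ h0 hF hW
  refine ⟨fun s' => A (Z s' - Z s), ?_, ?_, ?_⟩
  · exact A.contDiff.contDiffAt.comp_contDiffWithinAt _ (hZ.sub contDiffWithinAt_const)
  · have h1 : HasDerivWithinAt (fun s' => A (Z s' - Z s)) (A Z') (Icc 0 1) s :=
      A.hasFDerivAt.comp_hasDerivWithinAt s (hZ'.sub_const _)
    rw [h1.derivWithin (uniqueDiffOn_Icc zero_lt_one s hs), ← norm_ne_zero_iff, hA]
    exact norm_ne_zero_iff.2 hne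
  · have : ∀ᶠ s' in 𝓝[Icc 0 1] s, dist (Z s') (Z s) < M.rad (c s) :=
      Metric.tendsto_nhds.1 hZ.continuousWithinAt _ (M.rad_pos _)
    filter_upwards [this, hc] with s' h1 h2
    rw [h2.2]
    exact hA' _ h2.1 h1

end Tangency

/-! ### Lifts to the universal cover, and what non-interlacing forbids -/

section Crossing

open HalfTranslationSurface

variable {S E : Type*} [MetricSpace S] [MetricSpace E] {M : HalfTranslationSurface S} {p : E → S}

lemma IsLengthMetric.exists_curve {X : Type*} [MetricSpace X] (h : IsLengthMetric X) (x y : X) :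
    ∃ γ : C(unitInterval, X), γ 0 = x ∧ γ 1 = y := by
  obtain ⟨γ, hγ, h0, h1, -⟩ := h x y 1 one_pos
  exact ⟨⟨fun s => γ s, continuousOn_iff_continuous_domRestrict.1 hγ⟩, by
    rw [← h0]; exact congrArg γ (by simp), by rw [← h1]; exact congrArg γ (by simp)⟩

lemma IsIsometricUniversalCover.surjective (hp : IsIsometricUniversalCover p)
    (hS : IsLengthMetric S) : Function.Surjective p := by
  intro y
  have := hp.simplyConnected
  obtain ⟨e⟩ : Nonempty E := inferInstance
  obtain ⟨γ, h0, h1⟩ := hS.exists_curve (p e) y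
  refine ⟨hp.covering.liftPath γ e h0 1, ?_⟩
  rw [← h1]
  exact congrFun (hp.covering.liftPath_lifts γ e h0) 1

lemma IsIsometricUniversalCover.exists_lift (hp : IsIsometricUniversalCover p) (g : C(ℝ, S))
    {x : E} (hx : p x = g 0) : ∃ G : C(ℝ, E), G 0 = x ∧ ∀ t, p (G t) = g t := by
  obtain ⟨G, ⟨h0, h1⟩, -⟩ := hp.covering.existsUnique_continuousMap_lifts g (a₀ := 0) (e₀ := x) hx
  exact ⟨G, h0, fun t => congrFun h1 t⟩

/-- The ray which lifts a half of a local geodesic. -/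
lemma IsIsometricUniversalCover.isLocalGeodesicOn_lift (hp : IsIsometricUniversalCover p)
    {g : ℝ → S} (hg : IsLocalGeodesicOn g univ) {G : ℝ → E} (hG : Continuous G)
    (h : ∀ t, p (G t) = g t) : IsLocalGeodesicOn G univ := by
  intro t _
  obtain ⟨ε, hε, H⟩ := hg t (mem_univ _)
  obtain ⟨r, hr, Hr⟩ := hp.localIsometry (G t)
  obtain ⟨δ, hδ, Hδ⟩ := Metric.continuousAt_iff.1 (hG.continuousAt (x := t)) r hr
  refine ⟨min ε δ, lt_min hε hδ, fun s _ s' _ hs hs' => ?_⟩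
  rw [lt_min_iff] at hs hs'
  rw [← Hr _ (Hδ (by rw [Real.dist_eq]; exact hs.2)) _ (Hδ (by rw [Real.dist_eq]; exact hs'.2)),
    h, h]
  exact H s (mem_univ _) s' (mem_univ _) hs.1 hs'.1

lemma hasDir_of_radial {c : ℝ → S} {x : S} {θ θ' ε : ℝ} (hε : 0 < ε) (hεR : ε ≤ M.rad x)
    (hθ : θ ∈ M.link x) (hθ' : θ' ∈ M.link x) (h : M.ldist x θ θ' = 0)
    (hc : ∀ u ∈ Ico 0 ε, c u = M.pol x u θ) : M.HasDir c x θ' := by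
  refine ⟨hθ', fun u => u, fun _ => θ', ?_, nhdsWithin_le_nhds, tendsto_const_nhds⟩
  filter_upwards [Ioo_mem_nhdsGT hε] with u hu
  refine ⟨⟨hu.1, hu.2.trans_le hεR⟩, hθ', ?_⟩
  rw [hc u ⟨hu.1.le, hu.2⟩, pol_eq_of_ldist hu.1.le (hu.2.trans_le hεR) hθ hθ' h]

/-- The two halves of the lift through x serve as the rays from x to the ends of the lifted line.
This makes the point of crossing itself a viewpoint for `CyclicPos`. -/
lemma exists_ray_halves (hp : IsIsometricUniversalCover p) (g : LocalGeodesic S) {x : E}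
    (hx : p x = g 0) (hb : p x ∉ M.bdry) {θp θm ε : ℝ} (hε : 0 < ε) (hεR : ε ≤ M.rad (p x))
    (hgp : ∀ u ∈ Ico 0 ε, g u = M.pol (p x) u θp)
    (hgm : ∀ u ∈ Ico 0 ε, g (-u) = M.pol (p x) u θm) :
    ∃ G : C(ℝ, E), (∀ t, p (G t) = g t) ∧ ∃ rm rp : Ray E, HasEnds G rm.endpoint rp.endpoint ∧
      rm.1 0 = x ∧ rp.1 0 = x ∧
      (∀ θ, M.ldist (p x) θm θ = 0 → M.HasDir (p ∘ rm.1) (p x) θ) ∧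
      (∀ θ, M.ldist (p x) θp θ = 0 → M.HasDir (p ∘ rp.1) (p x) θ) := by
  obtain ⟨G, hG0, hG⟩ := hp.exists_lift g.1 hx
  have hl := hp.isLocalGeodesicOn_lift g.2 G.continuous hG
  have hl' := hp.isLocalGeodesicOn_lift g.rev.2 (G := fun t => G (-t)) (by fun_prop)
    (fun t => hG _)
  have hr : ∀ c : ℝ → E, IsLocalGeodesicOn c univ → IsLocalGeodesicOn c (Ici 0) := by
    intro c hc t _
    obtain ⟨e, he, H⟩ := hc t (mem_univ _)
    exact ⟨e, he, fun s _ s' _ => H s (mem_univ _) s' (mem_univ _)⟩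
  have hlink : ∀ θ, θ ∈ M.link (p x) := fun θ h => absurd h hb
  refine ⟨G, hG, ⟨_, hr _ hl'⟩, ⟨_, hr _ hl⟩, ⟨⟨_, fun t _ => rfl, rfl⟩, ⟨_, fun t _ => rfl, rfl⟩⟩,
    by simpa using hG0, hG0, fun θ h => ?_, fun θ h => ?_⟩
  · refine hasDir_of_radial hε hεR (hlink _) (hlink _) h fun u hu => ?_
    simp only [Function.comp]; rw [hG]; exact hgm u hu
  · refine hasDir_of_radial hε hεR (hlink _) (hlink _) h fun u hu => ?_
    simp only [Function.comp]; rw [hG]; exact hgp u hu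

lemma ldist_add_int_mul {x : S} (hb : x ∉ M.bdry) (hk : M.k x = 2) (θ : ℝ) (n : ℤ) :
    M.ldist x θ (θ + n * (2 * Real.pi)) = 0 := by
  simp only [ldist, linkDist, hb, if_false]
  rw [norm_eq_zero, AddCircle.coe_eq_zero_iff]
  exact ⟨-n, by rw [hk]; push_cast; simp⟩

/-- On a circle of length 2π only the antipode is at distance π: a local geodesic goes straight at a
regular interior point. -/
lemma exists_int_of_pi_le_ldist {x : S} (hb : x ∉ M.bdry) (hk : M.k x = 2) {θ θ' : ℝ}
    (h : Real.pi ≤ M.ldist x θ θ') : ∃ n : ℤ, θ' = θ + Real.pi + n * (2 * Real.pi) := by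
  have hpi := Real.pi_pos
  obtain ⟨n, hn⟩ : ∃ n : ℤ, θ + Real.pi + n * (2 * Real.pi) - Real.pi ≤ θ' ∧
      θ' < θ + Real.pi + n * (2 * Real.pi) + Real.pi := by
    refine ⟨⌊(θ' - θ) / (2 * Real.pi)⌋, ?_⟩
    have h1 := Int.floor_le ((θ' - θ) / (2 * Real.pi))
    have h2 := Int.lt_floor_add_one ((θ' - θ) / (2 * Real.pi))
    rw [le_div_iff₀ (by positivity)] at h1
    rw [div_lt_iff₀ (by positivity)] at h2
    constructor <;> linarith
  refine ⟨n, ?_⟩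
  have e1 := linkDist_congr_left (b := x ∈ M.bdry) (ldist_add_int_mul hb hk θ n) θ'
  have e2 := linkDist_congr_left (b := x ∈ M.bdry) (ldist_add_int_mul hb hk θ (n + 1)) θ'
  have l1 := linkDist_le_abs (x ∈ M.bdry) (M.k x) (θ + n * (2 * Real.pi)) θ'
  have l2 := linkDist_le_abs (x ∈ M.bdry) (M.k x) (θ + (n + 1 : ℤ) * (2 * Real.pi)) θ'
  rw [← e1] at l1
  rw [← e2] at l2
  have h1 := h.trans l1
  have h2 := h.trans l2
  push_cast at h2
  rw [abs_of_nonpos (by linarith)] at h1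
  rw [abs_of_nonneg (by linarith)] at h2
  linarith

/-- Two leaves which are not interlaced do not cross at a regular interior point. -/
lemma ldist_eq_zero_of_not_interlaced (hp : IsIsometricUniversalCover p) {g h : LocalGeodesic S}
    (hgh : ¬ Interlaced M p g h) (he : g 0 = h 0) (hb : g 0 ∉ M.bdry) (hk : M.k (g 0) = 2)
    {θp θm φp φm ε : ℝ} (hε : 0 < ε) (hεR : ε ≤ M.rad (g 0))
    (hgp : ∀ u ∈ Ico 0 ε, g u = M.pol (g 0) u θp)
    (hgm : ∀ u ∈ Ico 0 ε, g (-u) = M.pol (g 0) u θm)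
    (hhp : ∀ u ∈ Ico 0 ε, h u = M.pol (g 0) u φp)
    (hhm : ∀ u ∈ Ico 0 ε, h (-u) = M.pol (g 0) u φm)
    (hθ : Real.pi ≤ M.ldist (g 0) θp θm) (hφ : Real.pi ≤ M.ldist (g 0) φp φm) :
    M.ldist (g 0) θp φp = 0 ∨ M.ldist (g 0) θm φp = 0 := by
  by_contra hcon
  push Not at hcon
  apply hgh
  have hpi := Real.pi_pos
  obtain ⟨x, hx⟩ := hp.surjective M.lengthMetric (g 0)
  rw [← hx] at hb hk hεR hgp hgm hhp hhm hθ hφ hcon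
  obtain ⟨G, hG, rm, rp, hE, m0, p0, dm, dp⟩ := exists_ray_halves hp g hx hb hε hεR hgp hgm
  obtain ⟨H, hH, sm, sp, hE', m0', p0', dm', dp'⟩ :=
    exists_ray_halves hp h (hx.trans he) hb hε hεR hhp hhm
  have tr : ∀ a b c, M.ldist (p x) a b = 0 → M.ldist (p x) a c = M.ldist (p x) b c :=
    fun a b c hab => linkDist_congr_left hab c
  have per := ldist_add_int_mul (M := M) hb hk
  have cm : ∀ a b, M.ldist (p x) a b = M.ldist (p x) b a := fun a b => linkDist_comm _ _ _ _
  obtain ⟨n, hn⟩ := exists_int_of_pi_le_ldist hb hk hθ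
  obtain ⟨n', hn'⟩ := exists_int_of_pi_le_ldist hb hk hφ
  -- directions of the two geodesics, modulo `2π`
  have DP : ∀ m : ℤ, M.HasDir (p ∘ rp.1) (p x) (θp + m * (2 * Real.pi)) := fun m => dp _ (per _ _)
  have DM : ∀ m : ℤ, M.HasDir (p ∘ rm.1) (p x) (θp + Real.pi + m * (2 * Real.pi)) := by
    intro m; apply dm
    rw [hn, ← tr _ _ _ (per _ _)]; exact per _ _
  have DP' : ∀ m : ℤ, M.HasDir (p ∘ sp.1) (p x) (φp + m * (2 * Real.pi)) := fun m => dp' _ (per _ _)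
  have DM' : ∀ m : ℤ, M.HasDir (p ∘ sm.1) (p x) (φp + Real.pi + m * (2 * Real.pi)) := by
    intro m; apply dm'
    rw [hn', ← tr _ _ _ (per _ _)]; exact per _ _
  -- Representative of the positive direction of h within one turn after that of g. By hypothesis it
  -- is neither direction of g, so it lies strictly on one side.
  obtain ⟨j, hj1, hj2⟩ : ∃ j : ℤ, θp ≤ φp + j * (2 * Real.pi) ∧
      φp + j * (2 * Real.pi) < θp + 2 * Real.pi := by
    refine ⟨-⌊(φp - θp) / (2 * Real.pi)⌋, ?_⟩
    have h1 := Int.floor_le ((φp - θp) / (2 * Real.pi))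
    have h2 := Int.lt_floor_add_one ((φp - θp) / (2 * Real.pi))
    rw [le_div_iff₀ (by positivity)] at h1
    rw [div_lt_iff₀ (by positivity)] at h2
    push_cast
    constructor <;> linarith
  have ne1 : θp ≠ φp + j * (2 * Real.pi) := by
    intro e; apply hcon.1; rw [e, cm]; exact per _ _
  have ne2 : φp + j * (2 * Real.pi) ≠ θp + Real.pi := by
    intro e; apply hcon.2
    rw [hn, ← tr _ _ _ (per _ _), ← e, cm]; exact per _ _
  have j1 : θp < φp + j * (2 * Real.pi) := lt_of_le_of_ne hj1 ne1
  refine ⟨G, H, hG, hH, _, _, _, _, hE, hE', ?_⟩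
  have ord : ∀ {a b c : ℝ}, a < b → b < c → c < a + 2 * Real.pi → M.DirOrdered (p x) a b c := by
    intro a b c h1 h2 h3
    refine Or.inl ⟨hb, h1, h2, ?_⟩
    rw [hk]; push_cast; exact h3
  -- The positive half of h leaves on the left or on the right of g, and the negative half on the
  -- other side; these are the two cases of `PairsInterlaced`. The shifts by 2π list each triple of
  -- angles increasingly within one turn.
  rcases lt_or_gt_of_ne ne2 with hlt | hgt
  · left
    refine ⟨⟨x, rm, sm, rp, m0, m0', p0, rfl, rfl, rfl, _, _, _, DM 0, DM' j, DP 1, ord ?_ ?_ ?_⟩,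
      ⟨x, rp, sp, rm, p0, p0', m0, rfl, rfl, rfl, _, _, _, DP 0, DP' j, DM 0, ord ?_ ?_ ?_⟩⟩ <;>
      push_cast <;> linarith
  · right
    refine ⟨⟨x, rm, sp, rp, m0, p0', p0, rfl, rfl, rfl, _, _, _, DM 0, DP' j, DP 1, ord ?_ ?_ ?_⟩,
      ⟨x, rp, sm, rm, p0, m0', m0, rfl, rfl, rfl, _, _, _, DP 0, DM' (j - 1), DM 0,
        ord ?_ ?_ ?_⟩⟩ <;>
      push_cast <;> linarith

lemma LocalGeodesic.cls_shift (g : LocalGeodesic S) (a : ℝ) : (g.shift a).cls = g.cls :=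
  Quotient.sound ⟨-a, fun t => by
    show g t = g (t + -a + a)
    rw [neg_add_cancel_right]⟩

/-- Two leaves through a regular interior point have there the same germ, up to orientation. -/
lemma FlatLamination.parallel (hp : IsIsometricUniversalCover p) (Λ : FlatLamination M p)
    {g h : LocalGeodesic S} (hg : g.cls ∈ Λ.leaves) (hh : h.cls ∈ Λ.leaves) {t t' : ℝ}
    (he : g t = h t') (hb : g t ∉ M.bdry) (hs : g t ∉ M.sing) :
    ∃ ε > 0, (∀ u ∈ Ico 0 ε, h (t' + u) = g (t + u)) ∨ (∀ u ∈ Ico 0 ε, h (t' + u) = g (t - u)) := by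
  have hk : M.k (g t) = 2 := by
    by_contra hk; exact hs (Or.inl ⟨hb, hk⟩)
  obtain ⟨ε₁, hε₁, hR₁, θp, hθp, θm, hθm, hθ, h1, h2, -⟩ := exists_directions (M := M) g g.2 t
  obtain ⟨ε₂, hε₂, hR₂, φp, hφp, φm, hφm, hφ, k1, k2, -⟩ := exists_directions (M := M) h h.2 t'
  rw [← he] at hR₂ hφp hφm hφ k1 k2
  have hmem : ∀ u ∈ Ico 0 (min ε₁ ε₂), u ∈ Ico 0 ε₁ ∧ u ∈ Ico 0 ε₂ := fun u hu =>
    ⟨⟨hu.1, hu.2.trans_le (min_le_left _ _)⟩, ⟨hu.1, hu.2.trans_le (min_le_right _ _)⟩⟩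
  have hsh : ∀ (f : LocalGeodesic S) (a u : ℝ), f.shift a u = f (u + a) := fun _ _ _ => rfl
  have g0 : g.shift t 0 = g t := by rw [hsh, zero_add]
  have key := ldist_eq_zero_of_not_interlaced (M := M) (g := g.shift t) (h := h.shift t') hp
    (Λ.not_interlaced _ _ (by rwa [LocalGeodesic.cls_shift]) (by rwa [LocalGeodesic.cls_shift]))
    (by rw [g0, hsh, zero_add, he]) (by rwa [g0]) (by rw [g0]; exact hk) (θp := θp) (θm := θm)
    (φp := φp) (φm := φm) (ε := min ε₁ ε₂) (lt_min hε₁ hε₂)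
    (by rw [g0]; exact (min_le_left _ _).trans hR₁)
    (fun u hu => by rw [hsh, g0, add_comm]; exact h1 u (hmem u hu).1)
    (fun u hu => by rw [hsh, g0, neg_add_eq_sub]; exact h2 u (hmem u hu).1)
    (fun u hu => by rw [hsh, g0, add_comm]; exact k1 u (hmem u hu).2)
    (fun u hu => by rw [hsh, g0, neg_add_eq_sub]; exact k2 u (hmem u hu).2)
    (by rw [g0]; exact hθ) (by rw [g0]; exact hφ)
  rw [g0] at key
  refine ⟨min ε₁ ε₂, lt_min hε₁ hε₂, ?_⟩
  have hR : ∀ u ∈ Ico 0 (min ε₁ ε₂), u < M.rad (g t) := fun u hu =>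
    ((hmem u hu).1.2).trans_le hR₁
  rcases key with h | h
  · left; intro u hu
    rw [k1 u (hmem u hu).2, h1 u (hmem u hu).1, pol_eq_of_ldist hu.1 (hR u hu) hθp hφp h]
  · right; intro u hu
    rw [k1 u (hmem u hu).2, h2 u (hmem u hu).1, pol_eq_of_ldist hu.1 (hR u hu) hθm hφp h]

end Crossing

/-! ### Local geodesics: Lipschitz bound, gluing, the planar case -/

section LocalGeodesics

variable {X : Type*} [MetricSpace X]

lemma IsLocalGeodesicOn.mono {c : ℝ → X} {I J : Set ℝ} (h : IsLocalGeodesicOn c I) (hJ : J ⊆ I) :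
    IsLocalGeodesicOn c J := by
  intro t ht
  obtain ⟨ε, hε, H⟩ := h t (hJ ht)
  exact ⟨ε, hε, fun s hs s' hs' => H s (hJ hs) s' (hJ hs')⟩

lemma IsLocalGeodesicOn.continuousOn {c : ℝ → X} {I : Set ℝ} (h : IsLocalGeodesicOn c I) :
    ContinuousOn c I := by
  intro t ht
  obtain ⟨ε, hε, H⟩ := h t ht
  rw [Metric.continuousWithinAt_iff]
  intro η hη
  refine ⟨min ε η, lt_min hε hη, fun s hs hst => ?_⟩
  rw [Real.dist_eq, lt_min_iff] at hst
  rw [H s hs t ht hst.1 (by simpa using hε)]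
  exact hst.2

/-- Continuous induction: the times at which the bound holds form a closed set, and the local
isometry together with the triangle inequality pushes it further. -/
lemma IsLocalGeodesicOn.dist_le {c : ℝ → X} {a b : ℝ} (h : IsLocalGeodesicOn c (Icc a b)) :
    ∀ s ∈ Icc a b, dist (c a) (c s) ≤ s - a := by
  have hc := h.continuousOn
  have hcl : IsClosed ({s | dist (c a) (c s) - s ≤ -a} ∩ Icc a b) := by
    rw [inter_comm]
    exact ContinuousOn.preimage_isClosed_of_isClosed
      ((((continuous_const (y := c a)).dist continuous_id).comp_continuousOn hc).sub continuousOn_id) isClosed_Icc isClosed_Iic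
  intro s hs
  have hab := hs.1.trans hs.2
  have := hcl.Icc_subset_of_forall_exists_gt (by simp) (fun t ht u hu => ?_) hs
  · simp only [mem_ofPred_eq] at this; linarith
  obtain ⟨ε, hε, H⟩ := h t ⟨ht.2.1, ht.2.2.le⟩
  have hu' : t < u := hu
  set v := min (t + ε / 2) (min u b) with hv
  have htv : t < v := lt_min (by linarith) (lt_min hu' ht.2.2)
  have hvb : v ≤ b := (min_le_right _ _).trans (min_le_right _ _)
  have hve : v ≤ t + ε / 2 := min_le_left _ _
  refine ⟨v, ?_, htv, (min_le_right _ _).trans (min_le_left _ _)⟩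
  have h1 := H t ⟨ht.2.1, ht.2.2.le⟩ v ⟨ht.2.1.trans htv.le, hvb⟩ (by simpa using hε)
    (by rw [abs_of_pos (by linarith)]; linarith)
  have h2 := ht.1
  simp only [mem_ofPred_eq] at h2 ⊢
  rw [abs_sub_comm, abs_of_pos (by linarith)] at h1
  have := dist_triangle (c a) (c t) (c v)
  linarith

lemma LocalGeodesic.dist_le (g : LocalGeodesic X) (s t : ℝ) : dist (g s) (g t) ≤ |s - t| := by
  wlog hst : s ≤ t
  · rw [dist_comm, abs_sub_comm]; exact this g t s (le_of_not_ge hst)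
  have h : IsLocalGeodesicOn g (Icc s t) := IsLocalGeodesicOn.mono g.2 (subset_univ _)
  rw [abs_sub_comm, abs_of_nonneg (by linarith)]
  exact h.dist_le t ⟨hst, le_rfl⟩

/-- Continuous induction for local geodesics: if a geodesic from `c a` which is prolonged by a
short geodesic is still a geodesic, then the local geodesic is a geodesic. -/
lemma IsLocalGeodesicOn.dist_eq_of_glue {c : ℝ → X} {a b : ℝ} (h : IsLocalGeodesicOn c (Icc a b))
    (glue : ∀ t ∈ Ioo a b, dist (c a) (c t) = t - a → ∃ δ > 0, ∀ m₁ q, dist (c t) m₁ < δ →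
      dist (c t) q < δ → m₁ ≠ c t → dist (c a) m₁ + dist m₁ (c t) = dist (c a) (c t) →
      dist m₁ (c t) + dist (c t) q = dist m₁ q →
      dist (c a) (c t) + dist (c t) q = dist (c a) q) :
    ∀ t ∈ Icc a b, dist (c a) (c t) = t - a := by
  have hc := h.continuousOn
  have hcl : IsClosed ({s | dist (c a) (c s) - s = -a} ∩ Icc a b) := by
    rw [inter_comm]
    exact ContinuousOn.preimage_isClosed_of_isClosed
      ((((continuous_const (y := c a)).dist continuous_id).comp_continuousOn hc).sub continuousOn_id) isClosed_Icc isClosed_singleton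
  intro s hs
  have hab := hs.1.trans hs.2
  have := hcl.Icc_subset_of_forall_exists_gt (by simp) (fun t ht u hu => ?_) hs
  · simp only [mem_ofPred_eq] at this; linarith
  obtain ⟨ε, hε, H⟩ := h t ⟨ht.2.1, ht.2.2.le⟩
  have hu' : t < u := hu
  have h2 : dist (c a) (c t) = t - a := by have := ht.1; simp only [mem_ofPred_eq] at this; linarith
  -- At the initial time nothing has to be glued. Later, `glue` is applied to a point `c w` slightly
  -- before `c t` and a point `c v` slightly after: the three are aligned by the local isometry, and
  -- `c w` is on the geodesic from `c a` to `c t`.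
  rcases ht.2.1.eq_or_lt with hat | hat
  · set v := min (t + ε / 2) (min u b) with hv
    have htv : t < v := lt_min (by linarith) (lt_min hu' ht.2.2)
    have hvb : v ≤ b := (min_le_right _ _).trans (min_le_right _ _)
    have hve : v ≤ t + ε / 2 := min_le_left _ _
    refine ⟨v, ?_, htv, (min_le_right _ _).trans (min_le_left _ _)⟩
    have h1 := H t ⟨ht.2.1, ht.2.2.le⟩ v ⟨ht.2.1.trans htv.le, hvb⟩ (by simpa using hε)
      (by rw [abs_of_pos (by linarith)]; linarith)
    simp only [mem_ofPred_eq]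
    rw [hat, h1, abs_sub_comm, abs_of_pos (by linarith)]; ring
  obtain ⟨δ, hδ, G⟩ := glue t ⟨hat, ht.2.2⟩ h2
  set η := min ε δ / 2 with hη
  have hη0 : 0 < η := by positivity
  have hηε : η < ε := by have := min_le_left ε δ; have : 0 < min ε δ := by positivity
                         linarith
  have hηδ : η < δ := by have := min_le_right ε δ; have : 0 < min ε δ := by positivity
                         linarith
  set v := min (t + η) (min u b) with hv
  have htv : t < v := lt_min (by linarith) (lt_min hu' ht.2.2)
  have hvb : v ≤ b := (min_le_right _ _).trans (min_le_right _ _)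
  have hve : v ≤ t + η := min_le_left _ _
  set w := max (t - η) a with hw
  have hwt : w < t := max_lt (by linarith) hat
  have hwa : a ≤ w := le_max_right _ _
  have hwe : t - η ≤ w := le_max_left _ _
  have mt : t ∈ Icc a b := ⟨ht.2.1, ht.2.2.le⟩
  have mv : v ∈ Icc a b := ⟨ht.2.1.trans htv.le, hvb⟩
  have mw : w ∈ Icc a b := ⟨hwa, hwt.le.trans mt.2⟩
  have at' : |t - t| < ε := by simpa using hε
  have av : |v - t| < ε := by rw [abs_of_pos (by linarith)]; linarith
  have aw : |w - t| < ε := by rw [abs_of_neg (by linarith)]; linarith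
  have d1 : dist (c w) (c t) = t - w := by
    rw [H w mw t mt aw at', abs_of_neg (by linarith)]; ring
  have d2 : dist (c t) (c v) = v - t := by
    rw [H t mt v mv at' av, abs_of_neg (by linarith)]; ring
  have d3 : dist (c w) (c v) = v - w := by
    rw [H w mw v mv aw av, abs_of_neg (by linarith)]; ring
  have d4 : dist (c a) (c w) = w - a := by
    have h3 := h.dist_le w mw
    have h4 := dist_triangle (c a) (c w) (c t)
    linarith
  refine ⟨v, ?_, htv, (min_le_right _ _).trans (min_le_left _ _)⟩
  have := G (c w) (c v) (by rw [dist_comm, d1]; linarith) (by rw [d2]; linarith)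
    (by rw [← dist_ne_zero, d1]; linarith) (by rw [d4, d1, h2]; ring) (by rw [d1, d2, d3]; ring)
  simp only [mem_ofPred_eq]
  rw [← this, h2, d2]; ring

/-- In the plane, one can glue geodesics along a segment. -/
lemma dist_add_dist_eq_of_overlap {p m₁ m q : ℂ} (h : m₁ ≠ m)
    (h1 : dist p m₁ + dist m₁ m = dist p m) (h2 : dist m₁ m + dist m q = dist m₁ q) :
    dist p m + dist m q = dist p q := by
  rw [dist_add_dist_eq_iff] at *
  exact h1.trans_expand_right h2 h

/-- A local geodesic in the plane is a segment of straight line. -/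
lemma IsLocalGeodesicOn.exists_eq_line {c : ℝ → ℂ} {a b : ℝ} (hab : a < b)
    (h : IsLocalGeodesicOn c (Icc a b)) :
    ∃ v : ℂ, ‖v‖ = 1 ∧ ∀ t ∈ Icc a b, c t = c a + ((t - a : ℝ) : ℂ) * v := by
  have key : ∀ s ∈ Icc a b, ∀ t ∈ Icc s b, dist (c s) (c t) = t - s := by
    intro s hs
    refine (h.mono (Icc_subset_Icc_left hs.1)).dist_eq_of_glue fun t _ _ =>
      ⟨1, one_pos, fun m₁ q _ _ hne h1 h2 => dist_add_dist_eq_of_overlap hne h1 h2⟩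
  have ma : a ∈ Icc a b := ⟨le_rfl, hab.le⟩
  have mb : b ∈ Icc a b := ⟨hab.le, le_rfl⟩
  have hba : 0 < b - a := by linarith
  have hab' := key a ma b mb
  have hc : ((b - a : ℝ) : ℂ) ≠ 0 := by exact_mod_cast hba.ne'
  refine ⟨(c b - c a) / ((b - a : ℝ) : ℂ), ?_, fun t ht => ?_⟩
  · rw [norm_div, ← dist_eq_norm, dist_comm, hab', Complex.norm_real, Real.norm_eq_abs,
      abs_of_pos hba, div_self hba.ne']
  · have := eq_lineMap_of_dist_eq_mul_of_dist_eq_mul (x := c a) (y := c t) (z := c b)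
      (r := (t - a) / (b - a)) (by rw [key a ma t ht, hab']; field_simp)
      (by rw [key t ht b ⟨ht.2, le_rfl⟩, hab']; field_simp; ring)
    rw [this, AffineMap.lineMap_apply]
    simp only [vsub_eq_sub, vadd_eq_add, Complex.real_smul]
    push_cast
    field_simp
    ring

end LocalGeodesics

/-! ### Flat charts along a leaf -/

section FlatCharts

open HalfTranslationSurface

variable {S E : Type*} [MetricSpace S] [MetricSpace E] {M : HalfTranslationSurface S} {p : E → S}

/-- A flat chart around `g t`, modelled on a disc or on a half disc, in which the geodesic `g` is
the real axis. -/
structure IsFlatChart (M : HalfTranslationSurface S) (g : ℝ → S) (t : ℝ) (Ψ : ℂ → S) (R : ℝ)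
    (D : Set ℂ) : Prop where
  pos : 0 < R
  domain : D = univ ∨ D = {z | 0 ≤ z.im}
  iso : ∀ z ∈ D, ‖z‖ < R → ∀ w ∈ D, ‖w‖ < R → dist (Ψ z) (Ψ w) = dist z w
  surj : ∀ q, dist (g t) q < R → ∃ z ∈ D, ‖z‖ < R ∧ Ψ z = q
  axis : ∀ u : ℝ, |u| < R → Ψ u = g (t + u)
  regular : ∀ z ∈ D, ‖z‖ < R → Ψ z ∉ M.sing
  interior : D = univ → ∀ z, ‖z‖ < R → Ψ z ∉ M.bdry

/-- Rotating by -τ brings the half disc of a regular boundary point onto the upper half plane. -/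
lemma im_nonneg_of_mem_link {y : S} (hb : y ∈ M.bdry) (hs : y ∉ M.sing) {θ ρ : ℝ} (hρ : 0 ≤ ρ)
    (hθ : θ ∈ M.link y) : 0 ≤ (polarPt ρ θ * Complex.exp (-(M.τ y : ℂ) * Complex.I)).im := by
  have hk : M.k y = 1 := by
    by_contra hk; exact hs (Or.inr ⟨hb, hk⟩)
  have h := hθ hb
  rw [hk] at h
  have e : polarPt ρ θ * Complex.exp (-(M.τ y : ℂ) * Complex.I) = polarPt ρ (θ - M.τ y) := by
    rw [polarPt, polarPt, mul_assoc, ← Complex.exp_add]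
    congr 2; push_cast; ring
  rw [e, polarPt, Complex.im_ofReal_mul, Complex.exp_ofReal_mul_I_im]
  refine mul_nonneg hρ (Real.sin_nonneg_of_nonneg_of_le_pi (by linarith [h.1]) ?_)
  have := h.2; push_cast at this; linarith

/-- At a regular boundary point the coordinates fill only a half plane. If a full disc embedded,
both w and -w would be sent into this half plane, hence into its boundary line, for w = 1 and w = i
alike; a line does not contain two orthogonal vectors. -/
lemma notMem_bdry_of_isometric {F : ℂ → S} {z₀ : ℂ} {r : ℝ} (hr : 0 < r)
    (hF : ∀ z ∈ Metric.ball z₀ r, ∀ w ∈ Metric.ball z₀ r, dist (F z) (F w) = dist z w)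
    (hs : F z₀ ∉ M.sing) : F z₀ ∉ M.bdry := by
  intro hb
  have hW : ∀ᶠ r' : ℝ in 𝓝[>] 0, z₀ + r' ∈ Metric.ball z₀ r ∧
      z₀ + r' * Complex.I ∈ Metric.ball z₀ r := by
    filter_upwards [Ioo_mem_nhdsGT hr] with u hu
    simp [abs_of_pos hu.1, hu.2]
  obtain ⟨A, hA, hA'⟩ := exists_isometry_hasCoord (M := M) hs rfl (Metric.mem_ball_self hr) hF hW
  set y := F z₀
  set m := Complex.exp (-(M.τ y : ℂ) * Complex.I) with hm
  have hmn : ‖m‖ = 1 := by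
    rw [hm, ← Complex.ofReal_neg, Complex.norm_exp_ofReal_mul_I]
  set s := min (r / 2) (M.rad y / 2) with hs'
  have hR := M.rad_pos y
  have s0 : 0 < s := by positivity
  have im0 : ∀ w : ℂ, ‖w‖ = 1 → (A (s * w) * m).im = 0 := by
    intro w hw
    have key : ∀ w : ℂ, ‖w‖ = 1 → 0 ≤ (A (s * w) * m).im := by
      intro w hw
      have hn : ‖(s : ℂ) * w‖ = s := by simp [hw, abs_of_pos s0]
      have := hA' (z₀ + s * w) (by
        rw [Metric.mem_ball, dist_eq_norm, add_sub_cancel_left, hn]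
        exact lt_of_le_of_lt (min_le_left _ _) (by linarith)) (by
        rw [dist_eq_norm, add_sub_cancel_left, hn]
        exact lt_of_le_of_lt (min_le_right _ _) (by linarith))
      rw [add_sub_cancel_left] at this
      obtain ⟨-, θ, hθ, e, -⟩ := this
      rw [e]
      exact im_nonneg_of_mem_link hb hs (norm_nonneg _) hθ
    have h1 := key w hw
    have h2 := key (-w) (by rwa [norm_neg])
    rw [mul_neg, map_neg, neg_mul, Complex.neg_im] at h2
    linarith
  have h1 := im0 1 (by simp)
  have h2 := im0 Complex.I (by simp)
  have n1 : ‖A (s * 1) * m‖ = s := by rw [norm_mul, hA, hmn]; simp [abs_of_pos s0]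
  have n2 : ‖A (s * Complex.I) * m‖ = s := by rw [norm_mul, hA, hmn]; simp [abs_of_pos s0]
  have n3 : ‖A (s * 1) * m - A (s * Complex.I) * m‖ ^ 2 = 2 * s ^ 2 := by
    rw [← sub_mul, ← map_sub, norm_mul, hA, hmn, mul_one, ← mul_sub, norm_mul, mul_pow,
      Complex.sq_norm (1 - Complex.I), Complex.normSq_apply]
    simp [abs_of_pos s0]; ring
  set a := A (s * 1) * m
  set b := A (s * Complex.I) * m
  have n1' := Complex.sq_norm a
  have n2' := Complex.sq_norm b
  rw [n1, Complex.normSq_apply, h1] at n1'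
  rw [n2, Complex.normSq_apply, h2] at n2'
  rw [Complex.sq_norm, Complex.normSq_apply, Complex.sub_re, Complex.sub_im, h1, h2] at n3
  have h3 : a.re * b.re = 0 := by nlinarith
  rcases mul_eq_zero.1 h3 with h | h
  · rw [h] at n1'; nlinarith [pow_pos s0 2]
  · rw [h] at n2'; nlinarith [pow_pos s0 2]

/-- Criterion used in all the cases of `exists_isFlatChart`: F reads in the polar chart at `g t` as
a planar isometry B fixing 0, which turns the chart so that the leaf becomes the real axis. -/
lemma IsFlatChart.of_coord {g : ℝ → S} {t : ℝ} (hs : g t ∉ M.sing) {ε : ℝ} (hε : 0 < ε)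
    (hεR : ε ≤ M.rad (g t)) {D : Set ℂ} (hD : D = univ ∨ D = {z | 0 ≤ z.im}) {B : ℂ → ℂ}
    {F : ℂ → S} (hB : ∀ z w, dist (B z) (B w) = dist z w) (hB0 : ∀ z, ‖B z‖ = ‖z‖)
    (hF : ∀ z ∈ D, ‖z‖ < ε → M.HasCoord (g t) (F z) (B z))
    (hsurj : ∀ q ζ, M.HasCoord (g t) q ζ → ∃ z ∈ D, B z = ζ)
    (hax : ∀ u : ℝ, |u| < ε → F u = g (t + u)) : IsFlatChart M g t F ε D := by
  have iso : ∀ z ∈ D, ‖z‖ < ε → ∀ w ∈ D, ‖w‖ < ε → dist (F z) (F w) = dist z w :=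
    fun z hz hz' w hw hw' => by rw [(hF z hz hz').dist_eq hs (hF w hw hw'), hB]
  have hreg : ∀ z ∈ D, ‖z‖ < ε → F z ∉ M.sing := by
    intro z hz hz'
    by_cases he : F z = g t
    · rwa [he]
    · exact notMem_sing_of_dist_lt (by rw [← (hF z hz hz').norm_eq, hB0]; linarith) he
  refine ⟨hε, hD, iso, fun q hq => ?_, hax, hreg, fun hu z hz => ?_⟩
  · obtain ⟨ζ, hζ⟩ := exists_hasCoord (M := M) (hq.trans_le hεR)
    obtain ⟨z, hz, rfl⟩ := hsurj q ζ hζ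
    have hn := hζ.norm_eq
    rw [hB0] at hn
    refine ⟨z, hz, by rwa [hn], ?_⟩
    rw [← dist_eq_zero, (hF z hz (by rwa [hn])).dist_eq hs hζ, dist_self]
  · refine notMem_bdry_of_isometric (r := ε - ‖z‖) (by linarith) (fun a ha b hb => ?_)
      (hreg z (hu ▸ mem_univ z) hz)
    have key : ∀ a ∈ Metric.ball z (ε - ‖z‖), ‖a‖ < ε := by
      intro a ha
      rw [Metric.mem_ball, dist_eq_norm] at ha
      have := norm_add_le (a - z) z
      rw [sub_add_cancel] at this
      linarith
    exact iso a (hu ▸ mem_univ a) (key a ha) b (hu ▸ mem_univ b) (key b hb)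

lemma dist_mul_exp (θ : ℝ) (z w : ℂ) :
    dist (z * Complex.exp (θ * Complex.I)) (w * Complex.exp (θ * Complex.I)) = dist z w := by
  rw [dist_eq_norm, ← sub_mul, norm_mul, Complex.norm_exp_ofReal_mul_I, mul_one, dist_eq_norm]

lemma mul_exp_eq_polarPt (θ : ℝ) (z : ℂ) :
    z * Complex.exp (θ * Complex.I) = polarPt ‖z‖ (θ + Complex.arg z) := by
  conv_lhs => rw [← Complex.norm_mul_exp_arg_mul_I z]
  rw [polarPt, mul_assoc, ← Complex.exp_add]
  congr 2; push_cast; ring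

lemma exists_angle_mul_exp (θ : ℝ) (ζ : ℂ) :
    ∃ z : ℂ, z * Complex.exp (θ * Complex.I) = ζ ∧ z = ζ * Complex.exp (-(θ : ℂ) * Complex.I) := by
  refine ⟨_, ?_, rfl⟩
  rw [mul_assoc, ← Complex.exp_add]; simp

/-- Every regular point of a local geodesic has a flat chart in which the geodesic is the real
axis. -/
lemma exists_isFlatChart (g : ℝ → S) (hg : IsLocalGeodesicOn g univ) {t : ℝ} (hs : g t ∉ M.sing) :
    ∃ Ψ R D, IsFlatChart M g t Ψ R D := by
  have hpi := Real.pi_pos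
  obtain ⟨ε, hε, hR, θp, hθp, θm, hθm, hθ, h1, h2, -⟩ := exists_directions (M := M) g hg t
  have hpolar : ∀ F : ℂ → S, (F 0 = g t) → (∀ u : ℝ, 0 < u → u < ε → F u = M.pol (g t) u θp) →
      (∀ u : ℝ, 0 < u → u < ε → F (-u : ℝ) = M.pol (g t) u θm) →
      ∀ u : ℝ, |u| < ε → F u = g (t + u) := by
    intro F h0 hp hm u hu
    rcases lt_trichotomy u 0 with h | rfl | h
    · rw [abs_of_neg h] at hu
      have := hm (-u) (by linarith) hu
      rw [neg_neg] at this
      rw [this, ← h2 (-u) ⟨by linarith, hu⟩, sub_neg_eq_add]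
    · rw [Complex.ofReal_zero, h0, add_zero]
    · rw [abs_of_pos h] at hu
      rw [hp u h hu, h1 u ⟨h.le, hu⟩]
  by_cases hb : g t ∈ M.bdry
  · have hk : M.k (g t) = 1 := by
      by_contra hk; exact hs (Or.inr ⟨hb, hk⟩)
    have a1 := hθp hb
    have a2 := hθm hb
    rw [hk] at a1 a2
    push_cast at a1 a2
    have hθ' : Real.pi ≤ |θp - θm| := by simpa [ldist, linkDist, hb] using hθ
    have hl : ∀ a : ℝ, 0 ≤ a → a ≤ Real.pi → M.τ (g t) + a ∈ M.link (g t) := by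
      intro a ha ha' _; rw [hk]; push_cast; constructor <;> linarith
    have hsu : ∀ q ζ, M.HasCoord (g t) q ζ →
        0 ≤ (ζ * Complex.exp (-(M.τ (g t) : ℂ) * Complex.I)).im := by
      rintro q ζ ⟨-, θ, hθ, e, -⟩
      rw [e]; exact im_nonneg_of_mem_link hb hs (norm_nonneg _) hθ
    -- Along the boundary the leaf leaves in the direction τ or in the direction τ + π. In the
    -- second case a rotation would send the surface to the lower half plane, so the chart is
    -- composed with the reflection z ↦ -conj z, which keeps the upper one.
    rcases le_abs'.1 hθ' with hle | hle
    · have e1 : θp = M.τ (g t) := by linarith [a1.1, a1.2, a2.1, a2.2]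
      have e2 : θm = M.τ (g t) + Real.pi := by linarith [a1.1, a1.2, a2.1, a2.2]
      refine ⟨fun z => M.pol (g t) ‖z‖ (M.τ (g t) + Complex.arg z), ε, {z | 0 ≤ z.im},
        IsFlatChart.of_coord hs hε hR (Or.inr rfl)
          (dist_mul_exp (M.τ (g t))) (fun z => by
            rw [norm_mul, Complex.norm_exp_ofReal_mul_I, mul_one]) ?_ ?_ ?_⟩
      · intro z hz hz'
        refine ⟨?_, M.τ (g t) + Complex.arg z, hl _ (Complex.arg_nonneg_iff.2 hz)
          (Complex.arg_le_pi z), ?_, ?_⟩ <;>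
          rw [norm_mul, Complex.norm_exp_ofReal_mul_I, mul_one]
        · linarith
        · exact mul_exp_eq_polarPt _ _
      · intro q ζ h
        obtain ⟨z, h1, h2⟩ := exists_angle_mul_exp (M.τ (g t)) ζ
        exact ⟨z, by rw [mem_ofPred_eq, h2]; exact hsu q ζ h, h1⟩
      · refine hpolar
          (fun z => M.pol (g t) ‖z‖ (M.τ (g t) + Complex.arg z))
          ?_ ?_ ?_
        · simp only [norm_zero, Complex.arg_zero]
          exact M.pol_zero _ _ (hl 0 le_rfl hpi.le)
        · intro u hu _
          simp only [Complex.norm_real, Real.norm_eq_abs, abs_of_pos hu,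
            Complex.arg_ofReal_of_nonneg hu.le, add_zero, e1]
        · intro u hu _
          simp only [Complex.norm_real, Real.norm_eq_abs, abs_neg, abs_of_pos hu,
            Complex.arg_ofReal_of_neg (neg_lt_zero.2 hu), e2]
    · have e1 : θm = M.τ (g t) := by linarith [a1.1, a1.2, a2.1, a2.2]
      have e2 : θp = M.τ (g t) + Real.pi := by linarith [a1.1, a1.2, a2.1, a2.2]
      have hcj : ∀ z w : ℂ, dist (-(starRingEnd ℂ) z) (-(starRingEnd ℂ) w) = dist z w := by
        intro z w
        rw [dist_neg_neg, dist_eq_norm, ← map_sub, RCLike.norm_conj, dist_eq_norm]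
      refine ⟨fun z => M.pol (g t) ‖z‖ (M.τ (g t) + Complex.arg (-(starRingEnd ℂ) z)), ε,
        {z | 0 ≤ z.im}, IsFlatChart.of_coord hs hε hR (Or.inr rfl)
          (B := fun z => -(starRingEnd ℂ) z * Complex.exp ((M.τ (g t) : ℝ) * Complex.I))
          (fun z w => by rw [dist_mul_exp, hcj]) (fun z => by
            rw [norm_mul, Complex.norm_exp_ofReal_mul_I, mul_one, norm_neg, RCLike.norm_conj])
          ?_ ?_ ?_⟩
      · intro z hz hz'
        refine ⟨?_, M.τ (g t) + Complex.arg (-(starRingEnd ℂ) z),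
          hl _ (Complex.arg_nonneg_iff.2 (by simpa using hz)) (Complex.arg_le_pi _), ?_, ?_⟩ <;>
          rw [norm_mul, Complex.norm_exp_ofReal_mul_I, mul_one]
        · rw [norm_neg, RCLike.norm_conj]; linarith
        · exact mul_exp_eq_polarPt _ _
        · rw [norm_neg, RCLike.norm_conj]
      · intro q ζ h
        obtain ⟨z, h1, h2⟩ := exists_angle_mul_exp (M.τ (g t)) ζ
        have h3 := hsu q ζ h
        rw [← h2] at h3
        exact ⟨-(starRingEnd ℂ) z, by simpa using h3, by simpa using h1⟩
      · refine hpolar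
          (fun z => M.pol (g t) ‖z‖ (M.τ (g t) + Complex.arg (-(starRingEnd ℂ) z)))
          ?_ ?_ ?_
        · simp only [norm_zero, map_zero, neg_zero, Complex.arg_zero]
          exact M.pol_zero _ _ (hl 0 le_rfl hpi.le)
        · intro u hu _
          simp only [Complex.norm_real, Real.norm_eq_abs, abs_of_pos hu, Complex.conj_ofReal,
            ← Complex.ofReal_neg, Complex.arg_ofReal_of_neg (neg_lt_zero.2 hu), e2]
        · intro u hu _
          simp only [Complex.norm_real, Real.norm_eq_abs, abs_neg, abs_of_pos hu,
            Complex.conj_ofReal, ← Complex.ofReal_neg, neg_neg,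
            Complex.arg_ofReal_of_nonneg hu.le, add_zero, e1]
  · have hk : M.k (g t) = 2 := by
      by_contra hk; exact hs (Or.inl ⟨hb, hk⟩)
    have hl : ∀ a, a ∈ M.link (g t) := fun a h => absurd h hb
    refine ⟨fun z => M.pol (g t) ‖z‖ (θp + Complex.arg z), ε, univ,
        IsFlatChart.of_coord hs hε hR (Or.inl rfl)
          (dist_mul_exp θp) (fun z => by
            rw [norm_mul, Complex.norm_exp_ofReal_mul_I, mul_one]) ?_ ?_ ?_⟩
    · intro z hz hz'
      refine ⟨?_, θp + Complex.arg z, hl _, ?_, ?_⟩ <;>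
        rw [norm_mul, Complex.norm_exp_ofReal_mul_I, mul_one]
      · linarith
      · exact mul_exp_eq_polarPt _ _
    · intro q ζ h
      obtain ⟨z, h1, h2⟩ := exists_angle_mul_exp θp ζ
      exact ⟨z, mem_univ _, h1⟩
    · refine hpolar
          (fun z => M.pol (g t) ‖z‖ (θp + Complex.arg z))
          ?_ ?_ ?_
      · simp only [norm_zero, Complex.arg_zero]
        exact M.pol_zero _ _ (hl _)
      · intro u hu _
        simp only [Complex.norm_real, Real.norm_eq_abs, abs_of_pos hu,
          Complex.arg_ofReal_of_nonneg hu.le, add_zero]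
      · intro u hu hu'
        simp only [Complex.norm_real, Real.norm_eq_abs, abs_neg, abs_of_pos hu,
          Complex.arg_ofReal_of_neg (neg_lt_zero.2 hu)]
        -- The backward direction is only known up to a multiple of 2π, whereas `Complex.arg` gives
        -- exactly π on the negative axis.
        obtain ⟨n, hn⟩ := exists_int_of_pi_le_ldist hb hk hθ
        refine pol_eq_of_ldist hu.le (by linarith) (hl _) (hl _) ?_
        rw [hn]; exact ldist_add_int_mul hb hk _ _

/-- In a flat chart along a leaf, the leaves are segments of straight lines, almost parallel to
the real axis near the centre. -/
lemma IsFlatChart.exists_line (hp : IsIsometricUniversalCover p) (Λ : FlatLamination M p)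
    {g h : LocalGeodesic S} (hg : g.cls ∈ Λ.leaves) (hh : h.cls ∈ Λ.leaves) {t t' : ℝ} {Ψ : ℂ → S}
    {R : ℝ} {D : Set ℂ} (hΨ : IsFlatChart M g t Ψ R D) {w : ℂ} (hw : w ∈ D) (hwR : ‖w‖ ≤ R / 4)
    (he : h t' = Ψ w) : ∃ v : ℂ, ‖v‖ = 1 ∧ |v.im| * (R / 2) ≤ |w.im| ∧
      ∀ u : ℝ, |u| ≤ R / 2 → w + u * v ∈ D ∧ ‖w + u * v‖ < R ∧ h (t' + u) = Ψ (w + u * v) := by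
  have hR := hΨ.pos
  have h0D : (0 : ℂ) ∈ D := by rcases hΨ.domain with h | h <;> rw [h] <;> simp
  have hΨ0 : Ψ 0 = g t := by simpa using hΨ.axis 0 (by simpa using hR)
  have hball : ∀ u : ℝ, |u| ≤ R / 2 → dist (g t) (h (t' + u)) < R := by
    intro u hu
    have h1 : dist (g t) (h t') = ‖w‖ := by
      rw [he, ← hΨ0, hΨ.iso 0 h0D (by simpa using hR) w hw (by linarith), dist_zero_left]
    have h2 := h.dist_le t' (t' + u)
    rw [sub_add_cancel_left, abs_neg] at h2
    have := dist_triangle (g t) (h t') (h (t' + u))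
    linarith
  have hex : ∀ u : ℝ, ∃ z, |u| ≤ R / 2 → z ∈ D ∧ ‖z‖ < R ∧ Ψ z = h (t' + u) := by
    intro u
    by_cases hu : |u| ≤ R / 2
    · obtain ⟨z, hz⟩ := hΨ.surj _ (hball u hu)
      exact ⟨z, fun _ => hz⟩
    · exact ⟨0, fun h => absurd h hu⟩
  choose ζ hζ using hex
  have hI : ∀ u ∈ Icc (-(R / 2)) (R / 2), |u| ≤ R / 2 := fun u hu => abs_le.2 hu
  have hloc : IsLocalGeodesicOn ζ (Icc (-(R / 2)) (R / 2)) := by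
    intro s hs
    obtain ⟨ε, hε, H⟩ := h.2 (t' + s) (mem_univ _)
    refine ⟨ε, hε, fun a ha b hb hsa hsb => ?_⟩
    obtain ⟨a1, a2, a3⟩ := hζ a (hI a ha)
    obtain ⟨b1, b2, b3⟩ := hζ b (hI b hb)
    rw [← hΨ.iso _ a1 a2 _ b1 b2, a3, b3]
    have := H (t' + a) (mem_univ _) (t' + b) (mem_univ _) (by simpa using hsa) (by simpa using hsb)
    simpa using this
  obtain ⟨v, hv, hline⟩ := hloc.exists_eq_line (by linarith)
  have hζ0 : ζ 0 = w := by
    obtain ⟨a1, a2, a3⟩ := hζ 0 (by simp; linarith)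
    rw [← dist_eq_zero, ← hΨ.iso _ a1 a2 w hw (by linarith), a3, add_zero, he, dist_self]
  have hlin : ∀ u : ℝ, |u| ≤ R / 2 → ζ u = w + u * v := by
    intro u hu
    have h1 := hline u (abs_le.1 hu)
    have h2 := hline 0 ⟨by linarith, by linarith⟩
    rw [hζ0] at h2
    rw [h1, h2]; push_cast; ring
  have hall : ∀ u : ℝ, |u| ≤ R / 2 →
      w + u * v ∈ D ∧ ‖w + u * v‖ < R ∧ h (t' + u) = Ψ (w + u * v) := by
    intro u hu
    obtain ⟨a1, a2, a3⟩ := hζ u hu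
    rw [hlin u hu] at a1 a2 a3
    exact ⟨a1, a2, a3.symm⟩
  refine ⟨v, hv, ?_, hall⟩
  rcases hΨ.domain with hD | hD
  -- A steeper line would meet the real axis, which is g, inside the chart. There `parallel` makes
  -- the germ of h run along g, so the line would be horizontal.
  · by_contra hcon
    push Not at hcon
    have hv0 : v.im ≠ 0 := by
      intro h0; rw [h0, abs_zero, zero_mul] at hcon
      exact absurd (abs_nonneg w.im) (not_le.2 hcon)
    set u₀ := -w.im / v.im with hu₀
    have hu : |u₀| < R / 2 := by
      rw [hu₀, abs_div, abs_neg, div_lt_iff₀ (abs_pos.2 hv0)]; linarith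
    obtain ⟨-, c2, c3⟩ := hall u₀ hu.le
    have hreal : w + u₀ * v = ((w + u₀ * v).re : ℝ) := by
      apply Complex.ext
      · simp
      · simp [hu₀, hv0]
    set x₀ := (w + u₀ * v).re
    rw [hreal] at c2 c3
    have hx₀ : |x₀| < R := by rwa [Complex.norm_real, Real.norm_eq_abs] at c2
    have hgx : g (t + x₀) = h (t' + u₀) := by rw [c3]; exact (hΨ.axis x₀ hx₀).symm
    obtain ⟨ε, hε, hpar⟩ := Λ.parallel hp hg hh hgx
      (by rw [hgx, c3]; exact hΨ.interior hD _ c2)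
      (by rw [hgx, c3]; exact hΨ.regular _ (hD ▸ mem_univ _) c2)
    set u := min (ε / 2) (min (R / 2 - |u₀|) ((R - |x₀|) / 2)) with hu'
    have u0 : 0 < u := by
      have : 0 < R / 2 - |u₀| := by linarith
      have : 0 < R - |x₀| := by linarith
      positivity
    have ue : u < ε := lt_of_le_of_lt (min_le_left _ _) (by linarith)
    have u1 : u ≤ R / 2 - |u₀| := (min_le_right _ _).trans (min_le_left _ _)
    have u2 : u < R - |x₀| :=
      lt_of_le_of_lt ((min_le_right _ _).trans (min_le_right _ _)) (by linarith)
    obtain ⟨-, d2, d3⟩ := hall (u₀ + u) (by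
      have := abs_add_le u₀ u; rw [abs_of_pos u0] at this; linarith)
    have e : w + ((u₀ + u : ℝ) : ℂ) * v = x₀ + u * v := by rw [← hreal]; push_cast; ring
    rw [e] at d2 d3
    have fin : ∀ s : ℝ, |s| = u → h (t' + u₀ + u) = g (t + x₀ + s) → v.im = 0 := by
      intro s hsu hgs
      have hxs : |x₀ + s| < R := by have := abs_add_le x₀ s; linarith
      have h3 := hΨ.axis _ hxs
      rw [← add_assoc, ← hgs, add_assoc t', d3] at h3
      rw [← dist_eq_zero, hΨ.iso _ (hD ▸ mem_univ _) (by
        rwa [Complex.norm_real, Real.norm_eq_abs]) _ (hD ▸ mem_univ _) d2, dist_eq_zero] at h3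
      have := congrArg Complex.im h3
      simp at this
      rcases this with h | h
      · exact absurd h u0.ne'
      · exact h
    rcases hpar with H | H
    · exact hv0 (fin u (abs_of_pos u0) (H u ⟨u0.le, ue⟩))
    · exact hv0 (fin (-u) (by rw [abs_neg, abs_of_pos u0])
        (by rw [← sub_eq_add_neg]; exact H u ⟨u0.le, ue⟩))
  -- In a half disc the boundary does the work: the line stays in the upper half plane for all |u| ≤
  -- R/2, in both directions.
  · obtain ⟨h1, -, -⟩ := hall (R / 2) (by rw [abs_of_pos (by linarith)])
    obtain ⟨h2, -, -⟩ := hall (-(R / 2)) (by rw [abs_neg, abs_of_pos (by linarith)])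
    rw [hD] at h1 h2 hw
    simp only [mem_ofPred_eq, Complex.add_im, Complex.im_ofReal_mul] at h1 h2 hw
    rw [abs_of_nonneg hw]
    rcases abs_cases v.im with ⟨e, -⟩ | ⟨e, -⟩ <;> rw [e] <;> linarith

end FlatCharts

/-! ### Straight segments as arcs, and their transversality -/

section FlatMaps

open HalfTranslationSurface

variable {S E : Type*} [MetricSpace S] [MetricSpace E] {M : HalfTranslationSurface S} {p : E → S}

/-- An isometric map from a disc or a half disc to the regular part of the surface. -/
structure IsFlatMap (M : HalfTranslationSurface S) (F : ℂ → S) (R : ℝ) (D : Set ℂ) : Prop where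
  domain : D = univ ∨ D = {z | 0 ≤ z.im}
  iso : ∀ z ∈ D, ‖z‖ < R → ∀ w ∈ D, ‖w‖ < R → dist (F z) (F w) = dist z w
  regular : ∀ z ∈ D, ‖z‖ < R → F z ∉ M.sing

lemma IsFlatChart.isFlatMap {g : ℝ → S} {t R : ℝ} {Ψ : ℂ → S} {D : Set ℂ}
    (h : IsFlatChart M g t Ψ R D) : IsFlatMap M Ψ R D := ⟨h.domain, h.iso, h.regular⟩

variable {F : ℂ → S} {R : ℝ} {D : Set ℂ}

lemma IsFlatMap.convex (h : IsFlatMap M F R D) : Convex ℝ (D ∩ Metric.ball 0 R) := by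
  refine Convex.inter ?_ (convex_ball _ _)
  rcases h.domain with e | e <;> rw [e]
  · exact convex_univ
  · exact convex_halfSpace_im_ge 0

lemma IsFlatMap.continuousOn (h : IsFlatMap M F R D) : ContinuousOn F (D ∩ Metric.ball 0 R) := by
  intro z hz
  rw [Metric.continuousWithinAt_iff]
  refine fun ε hε => ⟨ε, hε, fun w hw hzw => ?_⟩
  rwa [h.iso w hw.1 (by simpa using hw.2) z hz.1 (by simpa using hz.2)]

lemma IsFlatMap.injOn (h : IsFlatMap M F R D) : InjOn F (D ∩ Metric.ball 0 R) := by
  intro z hz w hw e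
  rw [← dist_eq_zero, ← h.iso z hz.1 (by simpa using hz.2) w hw.1 (by simpa using hw.2), e,
    dist_self]

lemma IsFlatMap.line_mem (h : IsFlatMap M F R D) {z₀ d : ℂ} (h0 : z₀ ∈ D ∩ Metric.ball 0 R)
    (h1 : z₀ + d ∈ D ∩ Metric.ball 0 R) {s : ℝ} (hs : s ∈ Icc (0 : ℝ) 1) :
    z₀ + s * d ∈ D ∩ Metric.ball 0 R := by
  have := h.convex.add_smul_sub_mem h0 h1 hs
  simpa using this

/-- Segments of straight line are arcs. -/
lemma IsFlatMap.exists_arc (h : IsFlatMap M F R D) {z₀ d : ℂ} (hd : d ≠ 0)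
    (h0 : z₀ ∈ D ∩ Metric.ball 0 R) (h1 : z₀ + d ∈ D ∩ Metric.ball 0 R) :
    ∃ α : Arc M, (∀ s ∈ Icc (0 : ℝ) 1, α.ext s = F (z₀ + s * d)) ∧ IsC1On M α.ext 0 1 ∧
      α.image = (fun s : ℝ => F (z₀ + s * d)) '' Icc 0 1 := by
  have hmem : ∀ s ∈ Icc (0 : ℝ) 1, z₀ + s * d ∈ D ∩ Metric.ball 0 R :=
    fun s hs => h.line_mem h0 h1 hs
  have hreg : ∀ s ∈ Icc (0 : ℝ) 1, F (z₀ + s * d) ∉ M.sing := fun s hs =>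
    h.regular _ (hmem s hs).1 (by simpa using (hmem s hs).2)
  have hinj : InjOn (fun s : ℝ => F (z₀ + s * d)) (Icc 0 1) := by
    intro s hs s' hs' e
    have := h.injOn (hmem s hs) (hmem s' hs') e
    simpa [hd] using this
  have hcont : ContinuousOn (fun s : ℝ => F (z₀ + s * d)) (Icc 0 1) :=
    h.continuousOn.comp (by fun_prop) hmem
  have hdiff : ∀ s : ℝ, HasDerivAt (fun s : ℝ => z₀ + s * d) d s := by
    intro s
    have := ((Complex.ofRealCLM.hasDerivAt (x := s)).mul_const d).const_add z₀
    simpa using this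
  have hC : IsC1On M (fun s : ℝ => F (z₀ + s * d)) 0 1 := by
    refine ⟨fun s hs => hreg s (Ioo_subset_Icc_self hs), fun s hs => ?_⟩
    refine exists_c1_coord (c := fun s : ℝ => F (z₀ + s * d)) (F := F) (W := D ∩ Metric.ball 0 R) (Z := fun s : ℝ => z₀ + s * d) (Z' := d) hs
      (hreg s hs) (hmem s hs) rfl (fun z hz w hw => h.iso z hz.1 (by simpa using hz.2) w hw.1
        (by simpa using hw.2)) ?_ ?_ (hdiff s).hasDerivWithinAt hd ?_
    · have hball : ∀ c : ℂ, ∀ᶠ r : ℝ in 𝓝[>] 0, z₀ + s * d + r * c ∈ Metric.ball 0 R := by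
        intro c
        have hc : Continuous fun r : ℝ => z₀ + s * d + r * c := by fun_prop
        have : ∀ᶠ r : ℝ in 𝓝 0, z₀ + s * d + r * c ∈ Metric.ball 0 R :=
          hc.continuousAt.eventually_mem (Metric.isOpen_ball.mem_nhds (by
            simpa using (hmem s hs).2))
        exact nhdsWithin_le_nhds this
      filter_upwards [hball 1, hball Complex.I, self_mem_nhdsWithin] with r h1 h2 h3
      rw [mul_one] at h1
      refine ⟨⟨?_, h1⟩, ⟨?_, h2⟩⟩
      · rcases h.domain with e | e
        · rw [e]; exact mem_univ _
        · have := (hmem s hs).1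
          rw [e] at this ⊢
          simpa using this
      · rcases h.domain with e | e
        · rw [e]; exact mem_univ _
        · have := (hmem s hs).1
          rw [e] at this ⊢
          have h3' : (0 : ℝ) < r := h3
          simp only [mem_ofPred_eq, Complex.add_im, Complex.im_ofReal_mul, Complex.I_im] at this ⊢
          linarith
    · have : ContDiff ℝ 1 (fun s : ℝ => z₀ + s * d) := by
        have := Complex.ofRealCLM.contDiff (n := 1)
        exact contDiff_const.add (this.mul contDiff_const)
      exact this.contDiffWithinAt
    · filter_upwards [self_mem_nhdsWithin] with s' hs'
      exact ⟨hmem s' hs', rfl⟩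
  refine ⟨mkArc _ hcont hinj hC, fun s hs => mkArc_ext hs, hC.congr fun s hs => mkArc_ext hs,
    mkArc_image⟩

lemma Arc.ext_eq_of_mem (α : Arc M) {s : ℝ} (hs : s ∈ Icc (0 : ℝ) 1) :
    α.ext s = α.toMap ⟨s, hs⟩ := by
  rw [Arc.ext, IccExtend_of_mem _ _ hs]

lemma Arc.exists_ext_of_mem_image {α : Arc M} {q : S} (h : q ∈ α.image) :
    ∃ s ∈ Icc (0 : ℝ) 1, α.ext s = q := by
  obtain ⟨s, rfl⟩ := h
  exact ⟨s, s.2, α.ext_eq_of_mem s.2⟩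

lemma Arc.transverseTo_of_c1 {α : Arc M} (hC : IsC1On M α.ext 0 1) {g : ℝ → S} {I : Set ℝ}
    (h : ∀ s ∈ Icc (0 : ℝ) 1, ∀ t ∈ I, g t = α.ext s → ¬ α.TangentAt s g I t) :
    α.TransverseTo g I := fun s hs t ht e =>
  ⟨h s hs t ht e, fun hs' hr => absurd ⟨0, 1, le_rfl, hs'.1, hs'.2, le_rfl, hC⟩ hr⟩

lemma LocalGeodesic.exists_isometric (g : LocalGeodesic S) (t : ℝ) : ∃ ε > 0, ∀ u u',
    |u - t| < ε → |u' - t| < ε → dist (g u) (g u') = |u - u'| := by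
  obtain ⟨ε, hε, H⟩ := g.2 t (mem_univ _)
  exact ⟨ε, hε, fun u u' => H u (mem_univ _) u' (mem_univ _)⟩

/-- Short segments which are transverse to a leaf are transverse to all the leaves. -/
lemma IsFlatChart.transverseToLeaves (hp : IsIsometricUniversalCover p) (Λ : FlatLamination M p)
    {g : LocalGeodesic S} (hg : g.cls ∈ Λ.leaves) {t : ℝ} {Ψ : ℂ → S}
    (hΨ : IsFlatChart M g t Ψ R D) {e : ℂ} (he : ‖e‖ = 1) (he' : e.im ≠ 0) {α : Arc M}
    (hC : IsC1On M α.ext 0 1)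
    (him : ∀ q ∈ α.image, ∃ s : ℝ, |s| ≤ R / 4 ∧ (s * e : ℂ) ∈ D ∧ q = Ψ (s * e)) :
    α.TransverseToLeaves Λ.leaves := by
  intro h hh
  have hR := hΨ.pos
  refine Arc.transverseTo_of_c1 hC fun s hs t' _ e' htan => ?_
  obtain ⟨ε, hε, H⟩ := h.exists_isometric t'
  obtain ⟨σ, -, υ, hυ, -, hd, hδ⟩ := htan.eventually_dist_le e' hε H
  have hn : ∀ s : ℝ, ‖(s * e : ℂ)‖ = |s| := fun s => by simp [he]
  have hn' : ∀ s : ℝ, |s| ≤ R / 4 → ‖(s * e : ℂ)‖ < R := fun s hs => by rw [hn]; linarith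
  obtain ⟨a, ha, haD, hy⟩ := him _ (α.ext_mem_image s)
  obtain ⟨v, hv, hvim, hline⟩ := hΨ.exists_line hp Λ hg hh haD (by rwa [hn]) (e'.trans hy)
  -- The point is at height at most (R/4)|e.im|, while the slope is controlled over a length R/2;
  -- hence the factor 1/2, which separates the leaf from the arc.
  have hvim' : |v.im| ≤ |e.im| / 2 := by
    rw [Complex.im_ofReal_mul, abs_mul] at hvim
    have : |a| * |e.im| ≤ R / 4 * |e.im| := by gcongr
    nlinarith
  have hpos : 0 < |e.im| := abs_pos.2 he'
  have hev := hd.eventually self_mem_nhdsWithin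
  -- Tangency would keep a point of the arc within |e.im|/4 times its displacement from the leaf,
  -- whereas heights on the arc and on the leaf separate at rate at least |e.im|/2.
  obtain ⟨u, hu1, hu2⟩ := ((hδ (|e.im| / 4) (by positivity)).and hev).exists
  obtain ⟨b, hb, hbD, hq⟩ := him _ (α.ext_mem_image (s + σ * u))
  set q := α.ext (s + σ * u)
  have hdist : dist (α.ext s) q = |b - a| := by
    rw [hy, hq, hΨ.iso _ haD (hn' a ha) _ hbD (hn' b hb), dist_comm, dist_eq_norm, ← sub_mul,
      ← Complex.ofReal_sub, hn]
  rw [hdist] at hu1 hu2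
  have hυ1 : |υ| = 1 := by rcases hυ with rfl | rfl <;> simp
  have hba : |υ * (|b - a|)| ≤ R / 2 := by
    rw [abs_mul, hυ1, one_mul, abs_abs]
    have := abs_sub b a
    linarith
  obtain ⟨l1, l2, l3⟩ := hline _ hba
  rw [l3, hq, hΨ.iso _ hbD (hn' b hb) _ l1 l2, dist_eq_norm] at hu1
  have h1 := Complex.abs_im_le_norm ((b * e : ℂ) - (a * e + ((υ * |b - a| : ℝ) : ℂ) * v))
  simp only [Complex.sub_im, Complex.add_im, Complex.im_ofReal_mul] at h1
  have h2 : |b - a| * |e.im| - |b - a| * |v.im| ≤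
      |b * e.im - (a * e.im + υ * |b - a| * v.im)| := by
    have := abs_sub_abs_le_abs_sub ((b - a) * e.im) (υ * |b - a| * v.im)
    rw [abs_mul, abs_mul, abs_mul υ, hυ1, one_mul, abs_abs] at this
    have e1 : b * e.im - (a * e.im + υ * |b - a| * v.im) =
        (b - a) * e.im - υ * |b - a| * v.im := by ring
    rw [e1]; exact this
  have hpos' : 0 < |b - a| := hu2
  nlinarith [mul_le_mul_of_nonneg_left hvim' hpos'.le, mul_pos hpos' hpos]

/-- A curve which leaves a geodesic with a transverse half tangent is not tangent to it. -/
lemma Arc.not_tangentAt_zero {α : Arc M} {g : ℝ → S} {I : Set ℝ} {t : ℝ} (hst : g t = α.ext 0)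
    {ε : ℝ} (hε : 0 < ε) (hg : ∀ u u', |u - t| < ε → |u' - t| < ε → dist (g u) (g u') = |u - u'|)
    {W : Set ℂ} {Z : ℝ → ℂ} {d z₀ : ℂ} {c : ℝ}
    (hF : ∀ z ∈ W, ∀ w ∈ W, dist (F z) (F w) = dist z w)
    (hα : ∀ᶠ s in 𝓝[>] (0 : ℝ), Z s ∈ W ∧ α.ext s = F (Z s)) (h0 : z₀ ∈ W) (hz₀ : α.ext 0 = F z₀)
    (hgF : ∀ᶠ u in 𝓝 (0 : ℝ), z₀ + (c * u : ℝ) ∈ W ∧ g (t + u) = F (z₀ + (c * u : ℝ)))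
    (hZ : HasDerivWithinAt Z d (Ici 0) 0) (hZ0 : Z 0 = z₀) (hd : d.im ≠ 0) :
    ¬ α.TangentAt 0 g I t := by
  intro htan
  obtain ⟨σ, hσ, υ, hυ, -, hdist, hδ⟩ := htan.eventually_dist_le hst hε hg
  -- At the end point 0 only the forward half-tangent exists: `Arc.ext` is constant before 0, and a
  -- constant germ has no direction.
  have hσ1 : σ = 1 := by
    rcases hσ with h | h
    · exact h
    · exfalso
      obtain ⟨u, hu, hu'⟩ := ((hdist.eventually self_mem_nhdsWithin).and
        self_mem_nhdsWithin).exists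
      have hu0 : (0 : ℝ) < u := hu'
      have e : α.ext (0 + σ * u) = α.ext 0 := by
        rw [show σ = -1 from h]
        simp only [Arc.ext]
        rw [IccExtend_of_le_left _ _ (by linarith), IccExtend_of_le_left _ _ le_rfl]
      rw [e, dist_self] at hu
      exact lt_irrefl _ hu
  subst hσ1
  simp only [zero_add, one_mul] at hdist hδ
  have hslope : Tendsto (fun u : ℝ => u⁻¹ • (Z u - z₀)) (𝓝[>] 0) (𝓝 d) := by
    have := hasDerivWithinAt_iff_tendsto_slope.1 hZ
    rw [Ici_sdiff_left] at this
    refine this.congr fun u => ?_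
    rw [slope_def_module, hZ0, sub_zero]
  -- The geodesic is horizontal in the coordinate, so tangency bounds the height of Z u above z₀ by
  -- δ ‖Z u - z₀‖. Dividing by u and passing to the limit gives the bound for d, and δ is arbitrary.
  have key : ∀ δ > 0, |d.im| ≤ δ * ‖d‖ := by
    intro δ hδ0
    have t1 : Tendsto (fun u : ℝ => |(u⁻¹ • (Z u - z₀)).im|) (𝓝[>] 0) (𝓝 |d.im|) :=
      ((Complex.continuous_im.tendsto _).comp hslope).abs
    have t2 : Tendsto (fun u : ℝ => δ * ‖u⁻¹ • (Z u - z₀)‖) (𝓝[>] 0) (𝓝 (δ * ‖d‖)) :=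
      hslope.norm.const_mul _
    refine le_of_tendsto_of_tendsto t1 t2 ?_
    have hυd : Tendsto (fun u => υ * dist (α.ext 0) (α.ext u)) (𝓝[>] 0) (𝓝 0) := by
      have := (hdist.mono_right nhdsWithin_le_nhds).const_mul υ
      simpa using this
    filter_upwards [hα, hδ δ hδ0, hυd.eventually hgF, self_mem_nhdsWithin] with u h1 h2 h3 h4
    have h4' : (0 : ℝ) < u := h4
    have e : dist (α.ext 0) (α.ext u) = ‖Z u - z₀‖ := by
      rw [hz₀, h1.2, hF _ h0 _ h1.1, dist_comm, dist_eq_norm]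
    have h7 := hF _ h1.1 _ h3.1
    rw [← h1.2] at h7
    rw [h3.2, h7, e, dist_eq_norm] at h2
    have h5 := (Complex.abs_im_le_norm _).trans h2
    rw [Complex.sub_im, Complex.add_im, Complex.ofReal_im, add_zero, ← Complex.sub_im] at h5
    rw [Complex.smul_im, smul_eq_mul, abs_mul, norm_smul, Real.norm_eq_abs]
    have h6 : 0 ≤ |u⁻¹| := abs_nonneg _
    nlinarith [mul_le_mul_of_nonneg_left h5 h6]
  have h1 := key (|d.im| / (2 * (‖d‖ + 1))) (by positivity)
  have h2 : 0 < |d.im| := abs_pos.2 hd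
  have h3 : |d.im| / (2 * (‖d‖ + 1)) * ‖d‖ ≤ |d.im| / 2 := by
    rw [div_mul_eq_mul_div, div_le_div_iff₀ (by positivity) (by positivity)]
    nlinarith [norm_nonneg d]
  linarith

end FlatMaps

/-! ### Holonomy of a single leaf -/

section Holonomy

open HalfTranslationSurface

variable {S : Type*} [MetricSpace S] {M : HalfTranslationSurface S} {L : Set (GeodesicClass S)}

/-- Makes points closed, hence Borel, so that the invariance properties can be applied to atoms. -/
instance LocalGeodesic.instT2Space {X : Type*} [MetricSpace X] : T2Space (LocalGeodesic X) :=
  inferInstanceAs (T2Space {g : C(ℝ, X) // IsLocalGeodesicOn g univ})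

lemma LocalGeodesic.ext {X : Type*} [MetricSpace X] {g h : LocalGeodesic X} (e : ∀ t, g t = h t) :
    g = h := Subtype.ext (ContinuousMap.ext e)

lemma LocalGeodesic.shift_apply (g : LocalGeodesic S) (a t : ℝ) : g.shift a t = g (t + a) := rfl

lemma LocalGeodesic.shift_shift (g : LocalGeodesic S) (a b : ℝ) :
    (g.shift a).shift b = g.shift (b + a) :=
  LocalGeodesic.ext fun t => by simp only [shift_apply, add_assoc]

/-- The restriction property on a singleton. Since α' is transverse to all the leaves, γ belongs to
G(α') as soon as its origin is on α'. -/
lemma TransverseMeasure.atom_restrict (μ : TransverseMeasure M L) {α α' : Arc M}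
    (h : α.TransverseToLeaves L) (h' : α'.TransverseToLeaves L) (hs : α'.image ⊆ α.image)
    {γ : LocalGeodesic S} (hγ : γ.cls ∈ L) (h0 : γ 0 ∈ α'.image) :
    μ.μ α {x | x.1 = γ} = μ.μ α' {x | x.1 = γ} := by
  have := μ.restrict α α' h h' hs {γ} (measurableSet_singleton γ)
  rw [show {x : α'.geodesics | x.1 = γ} = {x | x.1 ∈ ({γ} : Set (LocalGeodesic S))} from rfl,
    ← this]
  congr 1
  ext x
  simp only [mem_ofPred_eq, mem_singleton_iff]
  refine ⟨fun e => ⟨?_, e⟩, fun e => e.2⟩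
  rw [e]; exact ⟨h' γ hγ, h0⟩

/-- The holonomy of a single leaf along a homotopy of arcs preserves its mass. -/
lemma TransverseMeasure.atom_eq_of_homotopy (μ : TransverseMeasure M L) {γ : LocalGeodesic S}
    (hγ : γ.cls ∈ L) {α₁ α₂ : Arc M} (h₁ : α₁.TransverseToLeaves L)
    (h₂ : α₂.TransverseToLeaves L) (hdisj : Disjoint α₁.image α₂.image) {T : ℝ}
    (hT : IsLeast {t | 0 < t ∧ γ t ∈ α₂.image} T) (K : ℝ × ℝ → S)
    (hK : ContinuousOn K (Icc 0 1 ×ˢ Icc 0 1))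
    (hβ : ∀ τ ∈ Icc (0 : ℝ) 1, ∃ β : Arc M, (∀ s ∈ Icc (0 : ℝ) 1, β.ext s = K (s, τ)) ∧
      β.TransverseTo γ (Icc 0 T))
    (hK0 : ∀ s ∈ Icc (0 : ℝ) 1, K (s, 0) = α₁.ext s)
    (hK1 : ∀ s ∈ Icc (0 : ℝ) 1, K (s, 1) = α₂.ext s)
    (hax : ∀ τ ∈ Icc (0 : ℝ) 1, K (0, τ) = γ (τ * T))
    (hint : ∀ s ∈ Icc (0 : ℝ) 1, ∀ τ ∈ Ioo (0 : ℝ) 1,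
      K (s, τ) ∉ α₁.image ∧ K (s, τ) ∉ α₂.image) :
    μ.μ α₁ {x | x.1 = γ} = μ.μ α₂ {x | x.1 = γ.shift T} := by
  have hT0 : 0 < T := hT.1.1
  have m0 : (0 : ℝ) ∈ Icc (0 : ℝ) 1 := ⟨le_rfl, zero_le_one⟩
  have hγ0 : γ 0 ∈ α₁.image := by
    have := hax 0 m0
    rw [zero_mul, hK0 0 m0] at this
    rw [← this]; exact α₁.ext_mem_image 0
  -- With F₁ a single point the homeomorphism is trivial, and only one curve of the homotopy has to
  -- follow a leaf: here it is the edge s = 0.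
  have hol : IsHolonomy L α₁ α₂ {γ} {γ.shift T} (fun _ => T) := by
    refine ⟨?_, ?_, hdisj, ?_, ?_, by simp, ?_, ?_⟩
    · rintro _ rfl; exact ⟨h₁ _ hγ, hγ0⟩
    · rintro _ rfl; exact hγ
    · rintro _ rfl; exact h₂ _ hγ
    · rintro _ rfl; exact hT
    · exact ⟨Homeomorph.homeomorphOfUnique _ _, fun g => by
        have h2 := ((Homeomorph.homeomorphOfUnique
          ({γ} : Set (LocalGeodesic S)) ({γ.shift T} : Set (LocalGeodesic S))) g).2
        rw [mem_singleton_iff] at h2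
        rw [h2, mem_singleton_iff.1 g.2]⟩
    · refine ⟨⟨fun x => K (x.1, x.2), ?_⟩, fun s => ?_, fun s => ?_, fun τ => ?_, ?_,
        fun s τ h0 h1 => ?_⟩
      · exact hK.comp_continuous (by fun_prop) fun x => ⟨x.1.2, x.2.2⟩
      · change K (s, ((0 : unitInterval) : ℝ)) = _
        rw [Icc.coe_zero, hK0 s s.2, α₁.ext_eq_of_mem s.2]
      · change K (s, ((1 : unitInterval) : ℝ)) = _
        rw [Icc.coe_one, hK1 s s.2, α₂.ext_eq_of_mem s.2]
      · obtain ⟨β, hβ1, hβ2⟩ := hβ τ τ.2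
        refine ⟨β, fun s => ?_, ?_⟩
        · change _ = K (s, τ)
          rw [← hβ1 s s.2, β.ext_eq_of_mem s.2]
        · rintro _ rfl; exact hβ2
      · rintro _ rfl
        refine ⟨0, fun τ => τ * T, by fun_prop, fun a b hab => ?_, by simp, by simp,
          fun τ => hax τ τ.2⟩
        exact mul_lt_mul_of_pos_right hab hT0
      · exact hint s s.2 τ ⟨h0, h1⟩
  have hm : MeasurableSet {g : α₁.geodesics | g.1 ∈ ({γ} : Set (LocalGeodesic S))} :=
    measurable_subtype_coe (measurableSet_singleton γ)
  have := μ.holonomy_inv α₁ α₂ h₁ h₂ _ _ _ hm hol univ MeasurableSet.univ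
  simpa using this

/-- Mass is preserved along a geodesic in a flat half disc. -/
lemma IsFlatMap.atom_eq (μ : TransverseMeasure M L) {γ : LocalGeodesic S} (hγ : γ.cls ∈ L)
    {F : ℂ → S} {R t : ℝ} (hF : IsFlatMap M F R {z | 0 ≤ z.im})
    (hax : ∀ u : ℝ, |u| < R → F u = γ (t + u)) {a b : ℝ} (hab : a < b) (ha : |a| < R)
    (hb : |b| < R) {e₁ e₂ : ℂ} (h₁ : ‖e₁‖ = 1) (h₂ : ‖e₂‖ = 1) (i₁ : 0 < e₁.im) (i₂ : 0 < e₂.im) :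
    ∃ σ₀ > (0 : ℝ), ∀ σ ∈ Ioo (0 : ℝ) σ₀, ∀ α₁ α₂ : Arc M, α₁.TransverseToLeaves L →
      α₂.TransverseToLeaves L →
      (∀ s ∈ Icc (0 : ℝ) 1, α₁.ext s = F (a + s * (σ * e₁))) →
      (∀ s ∈ Icc (0 : ℝ) 1, α₂.ext s = F (b + s * (σ * e₂))) →
      μ.μ α₁ {x | x.1 = γ.shift (t + a)} = μ.μ α₂ {x | x.1 = γ.shift (t + b)} := by
  have hba : 0 < b - a := by linarith
  -- The first two bounds keep the segments in the half disc. The last two make them shorter than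
  -- the distances from each foot to the line supporting the other segment when directions coincide,
  -- which is what `n1` and `n2` use.
  refine ⟨min (min (R - |a|) (R - |b|)) (min ((b - a) * e₁.im) ((b - a) * e₂.im)), ?_, ?_⟩
  · have h1 : 0 < R - |a| := by linarith
    have h2 : 0 < R - |b| := by linarith
    positivity
  rintro σ ⟨hσ, hσ'⟩ α₁ α₂ t₁ t₂ x₁ x₂
  simp only [lt_min_iff] at hσ'
  obtain ⟨⟨s1, s2⟩, s3, s4⟩ := hσ'
  -- The homotopy interpolates linearly the foot from a to b and the direction from e₁ to e₂. The
  -- imaginary part stays positive, so each intermediate segment leaves the axis transversally.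
  set x : ℝ → ℝ := fun τ => a + τ * (b - a) with hx
  set e : ℝ → ℂ := fun τ => (1 - τ : ℝ) * e₁ + (τ : ℝ) * e₂ with he
  set Z : ℝ × ℝ → ℂ := fun y => (x y.2 : ℂ) + y.1 * (σ * e y.2) with hZ
  have hen : ∀ τ ∈ Icc (0 : ℝ) 1, ‖e τ‖ ≤ 1 := by
    intro τ hτ
    refine (norm_add_le _ _).trans ?_
    rw [norm_mul, norm_mul, h₁, h₂, Complex.norm_real, Complex.norm_real, Real.norm_eq_abs,
      Real.norm_eq_abs, abs_of_nonneg hτ.1, abs_of_nonneg (by linarith [hτ.2])]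
    linarith
  have hei : ∀ τ ∈ Icc (0 : ℝ) 1, 0 < (e τ).im := by
    intro τ hτ
    simp only [he, Complex.add_im, Complex.im_ofReal_mul]
    rcases hτ.1.eq_or_lt with h | h
    · rw [← h]; simpa using i₁
    · have := mul_pos h i₂
      have : 0 ≤ (1 - τ) * e₁.im := mul_nonneg (by linarith [hτ.2]) i₁.le
      linarith
  have hxR : ∀ τ ∈ Icc (0 : ℝ) 1, |x τ| + σ < R := by
    intro τ hτ
    have : x τ = (1 - τ) * a + τ * b := by simp only [hx]; ring
    rw [this]
    have h1 := abs_add_le ((1 - τ) * a) (τ * b)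
    have h0 : |1 - τ| = 1 - τ := abs_of_nonneg (by linarith [hτ.2])
    rw [abs_mul, abs_mul, abs_of_nonneg hτ.1, h0] at h1
    have h2 : (1 - τ) * |a| ≤ (1 - τ) * (R - σ) :=
      mul_le_mul_of_nonneg_left (by linarith) (by linarith [hτ.2])
    have h3 : τ * |b| ≤ τ * (R - σ) := mul_le_mul_of_nonneg_left (by linarith) hτ.1
    rcases hτ.1.eq_or_lt with h | h
    · rw [← h]; simp; linarith
    · have h3 : τ * |b| < τ * (R - σ) := mul_lt_mul_of_pos_left (by linarith) h
      linarith
  have hZm : ∀ s ∈ Icc (0 : ℝ) 1, ∀ τ ∈ Icc (0 : ℝ) 1,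
      Z (s, τ) ∈ {z : ℂ | 0 ≤ z.im} ∩ Metric.ball 0 R := by
    intro s hs τ hτ
    constructor
    · simp only [hZ, mem_ofPred_eq, Complex.add_im, Complex.ofReal_im, Complex.im_ofReal_mul,
        zero_add]
      exact mul_nonneg hs.1 (mul_nonneg hσ.le (hei τ hτ).le)
    · rw [mem_ball_zero_iff]
      refine (norm_add_le _ _).trans_lt ?_
      rw [norm_mul, norm_mul, Complex.norm_real, Complex.norm_real, Complex.norm_real,
        Real.norm_eq_abs, Real.norm_eq_abs, Real.norm_eq_abs, abs_of_nonneg hs.1, abs_of_pos hσ]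
      have h1 : s * (σ * ‖e τ‖) ≤ 1 * (σ * 1) := by
        gcongr
        · exact hs.2
        · exact hen τ hτ
      have := hxR τ hτ
      linarith
  have m0 : (0 : ℝ) ∈ Icc (0 : ℝ) 1 := ⟨le_rfl, zero_le_one⟩
  have m1 : (1 : ℝ) ∈ Icc (0 : ℝ) 1 := ⟨zero_le_one, le_rfl⟩
  have hc : Continuous Z := by
    simp only [hZ, hx, he]; fun_prop
  have x0 : x 0 = a := by simp [hx]
  have x1 : x 1 = b := by simp [hx]
  have e0 : e 0 = e₁ := by simp [he]
  have e1 : e 1 = e₂ := by simp [he]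
  have hα₁ : ∀ s ∈ Icc (0 : ℝ) 1, α₁.ext s = F (Z (s, 0)) := fun s hs => by
    rw [x₁ s hs]; simp only [hZ, x0, e0]
  have hα₂ : ∀ s ∈ Icc (0 : ℝ) 1, α₂.ext s = F (Z (s, 1)) := fun s hs => by
    rw [x₂ s hs]; simp only [hZ, x1, e1]
  have hre : ∀ s τ, (Z (s, τ)).re = x τ + s * (σ * (e τ).re) := by
    intro s τ; simp [hZ]
  have him : ∀ s τ, (Z (s, τ)).im = s * (σ * (e τ).im) := by
    intro s τ; simp [hZ]
  have cross : ∀ c d : ℂ, ‖c‖ = 1 → ‖d‖ = 1 → c.re * d.im - c.im * d.re ≤ 1 := by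
    intro c d hc hd
    have h1 := Complex.sq_norm c
    have h2 := Complex.sq_norm d
    rw [hc, Complex.normSq_apply] at h1
    rw [hd, Complex.normSq_apply] at h2
    nlinarith [sq_nonneg (c.re - d.im), sq_nonneg (c.im + d.re)]
  have ere : ∀ τ, (e τ).re = (1 - τ) * e₁.re + τ * e₂.re := by intro τ; simp [he]
  have eim : ∀ τ, (e τ).im = (1 - τ) * e₁.im + τ * e₂.im := by intro τ; simp [he]
  -- Projecting on the normal to e₁ eliminates s'. What remains is τ times a quantity at least (b -
  -- a) e₁.im - σ > 0, because the determinant of two unit vectors is at most 1.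
  have n1 : ∀ s ∈ Icc (0 : ℝ) 1, ∀ s' ∈ Icc (0 : ℝ) 1, ∀ τ ∈ Ioc (0 : ℝ) 1,
      Z (s, τ) ≠ Z (s', 0) := by
    intro s hs s' hs' τ hτ h
    have r := congrArg Complex.re h
    have i := congrArg Complex.im h
    rw [hre, hre, x0, e0, ere] at r
    rw [him, him, e0, eim] at i
    have key : τ * ((b - a) * e₁.im + s * σ * (e₂.re * e₁.im - e₂.im * e₁.re)) = 0 := by
      simp only [hx] at r
      linear_combination e₁.im * r - e₁.re * i
    have h3 := cross e₁ e₂ h₁ h₂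
    have h4 : s * σ * (e₁.re * e₂.im - e₁.im * e₂.re) ≤ s * σ * 1 :=
      mul_le_mul_of_nonneg_left h3 (mul_nonneg hs.1 hσ.le)
    have h5 : s * σ ≤ σ := by nlinarith [hs.2]
    rcases mul_eq_zero.1 key with h6 | h6
    · exact hτ.1.ne' h6
    · nlinarith
  have n2 : ∀ s ∈ Icc (0 : ℝ) 1, ∀ s' ∈ Icc (0 : ℝ) 1, ∀ τ ∈ Ico (0 : ℝ) 1,
      Z (s, τ) ≠ Z (s', 1) := by
    intro s hs s' hs' τ hτ h
    have r := congrArg Complex.re h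
    have i := congrArg Complex.im h
    rw [hre, hre, x1, e1, ere] at r
    rw [him, him, e1, eim] at i
    have key : (1 - τ) * ((b - a) * e₂.im - s * σ * (e₁.re * e₂.im - e₁.im * e₂.re)) = 0 := by
      simp only [hx] at r
      linear_combination - e₂.im * r + e₂.re * i
    have h3 := cross e₁ e₂ h₁ h₂
    have h4 : s * σ * (e₁.re * e₂.im - e₁.im * e₂.re) ≤ s * σ * 1 :=
      mul_le_mul_of_nonneg_left h3 (mul_nonneg hs.1 hσ.le)
    have h5 : s * σ ≤ σ := by nlinarith [hs.2]
    rcases mul_eq_zero.1 key with h6 | h6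
    · linarith [hτ.2]
    · nlinarith
  have hinj := hF.injOn
  have f1 : ∀ s ∈ Icc (0 : ℝ) 1, ∀ τ ∈ Ioc (0 : ℝ) 1, F (Z (s, τ)) ∉ α₁.image := by
    intro s hs τ hτ h
    obtain ⟨s', hs', h'⟩ := Arc.exists_ext_of_mem_image h
    rw [hα₁ s' hs'] at h'
    exact n1 s hs s' hs' τ hτ
      (hinj (hZm s hs τ ⟨hτ.1.le, hτ.2⟩) (hZm s' hs' 0 m0) h'.symm)
  have f2 : ∀ s ∈ Icc (0 : ℝ) 1, ∀ τ ∈ Ico (0 : ℝ) 1, F (Z (s, τ)) ∉ α₂.image := by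
    intro s hs τ hτ h
    obtain ⟨s', hs', h'⟩ := Arc.exists_ext_of_mem_image h
    rw [hα₂ s' hs'] at h'
    exact n2 s hs s' hs' τ hτ
      (hinj (hZm s hs τ ⟨hτ.1, hτ.2.le⟩) (hZm s' hs' 1 m1) h'.symm)
  set γ' := γ.shift (t + a) with hγ'
  have hZ0 : ∀ τ, Z (0, τ) = (x τ : ℝ) := by intro τ; simp [hZ]
  have hγF : ∀ τ ∈ Icc (0 : ℝ) 1, γ' (τ * (b - a)) = F (Z (0, τ)) := by
    intro τ hτ
    rw [hZ0, hax _ (by linarith [hxR τ hτ]), hγ', LocalGeodesic.shift_apply]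
    congr 1; simp only [hx]; ring
  have hγu : ∀ u ∈ Icc 0 (b - a), ∃ τ ∈ Icc (0 : ℝ) 1, u = τ * (b - a) := by
    intro u hu
    exact ⟨u / (b - a), ⟨by have := hu.1; positivity, by rw [div_le_one hba]; exact hu.2⟩,
      by field_simp⟩
  have hres : γ.shift (t + b) = γ'.shift (b - a) := by
    rw [hγ', LocalGeodesic.shift_shift]; congr 1; ring
  rw [hres]
  refine μ.atom_eq_of_homotopy (by rwa [hγ', LocalGeodesic.cls_shift]) t₁ t₂ ?_ ⟨⟨hba, ?_⟩, ?_⟩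
    (F ∘ Z) ?_ ?_ (fun s hs => (hα₁ s hs).symm) (fun s hs => (hα₂ s hs).symm) ?_ ?_
  · rw [Set.disjoint_left]
    intro q h1 h2
    obtain ⟨s, hs, rfl⟩ := Arc.exists_ext_of_mem_image h2
    rw [hα₂ s hs] at h1
    exact f1 s hs 1 ⟨one_pos, le_rfl⟩ h1
  · have := hγF 1 m1
    rw [one_mul] at this
    rw [this, ← hα₂ 0 m0]; exact α₂.ext_mem_image 0
  · rintro u ⟨hu, hu'⟩
    by_contra hlt
    push Not at hlt
    obtain ⟨τ, hτ, rfl⟩ := hγu u ⟨hu.le, hlt.le⟩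
    have hτ1 : τ < 1 := by
      by_contra h; push Not at h; nlinarith
    rw [hγF τ hτ] at hu'
    exact f2 0 m0 τ ⟨hτ.1, hτ1⟩ hu'
  · exact hF.continuousOn.comp hc.continuousOn fun y hy => hZm y.1 hy.1 y.2 hy.2
  · intro τ hτ
    have hd : (σ * e τ : ℂ) ≠ 0 := by
      intro h
      have := congrArg Complex.im h
      rw [Complex.im_ofReal_mul, Complex.zero_im] at this
      exact (mul_pos hσ (hei τ hτ)).ne' this
    have hm0 := hZm 0 m0 τ hτ
    have hm1 := hZm 1 m1 τ hτ
    rw [hZ0] at hm0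
    obtain ⟨β, hβ, hβC, -⟩ := hF.exists_arc (z₀ := (x τ : ℝ)) (d := σ * e τ) hd hm0
      (by simpa [hZ] using hm1)
    refine ⟨β, fun s hs => by rw [hβ s hs]; simp [hZ], ?_⟩
    refine Arc.transverseTo_of_c1 hβC fun s hs u hu heq => ?_
    obtain ⟨τ', hτ', rfl⟩ := hγu u hu
    rw [hγF τ' hτ', hβ s hs] at heq
    have heq' := hinj (hZm 0 m0 τ' hτ') (hZm s hs τ hτ) heq
    have hs0 : s = 0 := by
      have := congrArg Complex.im heq'
      rw [him, him, zero_mul] at this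
      rcases mul_eq_zero.1 this.symm with h | h
      · exact h
      · exact absurd h (mul_pos hσ (hei τ hτ)).ne'
    subst hs0
    have hxx : x τ' = x τ := by
      have := congrArg Complex.re heq'
      rw [hre, hre] at this; simpa using this
    obtain ⟨ε, hε, Hε⟩ := γ'.exists_isometric (τ' * (b - a))
    have hval : γ' (τ' * (b - a)) = β.ext 0 := by rw [hγF τ' hτ', hβ 0 m0, heq]
    refine Arc.not_tangentAt_zero (F := F) (W := {z : ℂ | 0 ≤ z.im} ∩ Metric.ball 0 R)
      (Z := fun s : ℝ => (x τ : ℝ) + s * (σ * e τ)) (d := σ * e τ) (z₀ := (x τ : ℝ)) (c := 1)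
      hval hε Hε (fun z hz w hw => hF.iso z hz.1 (by simpa using hz.2) w hw.1
        (by simpa using hw.2)) ?_ hm0 ?_ ?_ ?_ (by simp) ?_
    · filter_upwards [Ioo_mem_nhdsGT one_pos] with s hs
      exact ⟨hZm s ⟨hs.1.le, hs.2.le⟩ τ hτ, hβ s ⟨hs.1.le, hs.2.le⟩⟩
    · rw [hβ 0 m0]; simp
    · have : ∀ᶠ u : ℝ in 𝓝 0, |x τ + u| < R := by
        have hcont : Continuous fun u : ℝ => |x τ + u| := by fun_prop
        exact hcont.continuousAt.eventually_lt continuousAt_const (by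
          simp; linarith [hxR τ hτ])
      filter_upwards [this] with u hu
      rw [one_mul, ← Complex.ofReal_add]
      refine ⟨⟨by simp, by rwa [mem_ball_zero_iff, Complex.norm_real, Real.norm_eq_abs]⟩, ?_⟩
      rw [hax _ hu, hγ', LocalGeodesic.shift_apply, ← hxx]
      congr 1; simp only [hx]; ring
    · have := (((Complex.ofRealCLM.hasDerivAt (x := (0 : ℝ))).mul_const
        (σ * e τ : ℂ)).const_add ((x τ : ℝ) : ℂ)).hasDerivWithinAt (s := Ici 0)
      simpa using this
    · rw [Complex.im_ofReal_mul]; exact (mul_pos hσ (hei τ hτ)).ne'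
  · intro τ hτ; exact (hγF τ hτ).symm
  · intro s hs τ hτ
    exact ⟨f1 s hs τ ⟨hτ.1, hτ.2.le⟩, f2 s hs τ ⟨hτ.1.le, hτ.2⟩⟩

end Holonomy

/-! ### The mass of a leaf at a regular point -/

section Mass

open HalfTranslationSurface

variable {S E : Type*} [MetricSpace S] [MetricSpace E] {M : HalfTranslationSurface S} {p : E → S}
  {L : Set (GeodesicClass S)}

/-- A geodesic segment `c` of length `σ` which leaves the geodesic `g` at the time `t`. -/
structure IsTransverseSegment (g : ℝ → S) (t : ℝ) (c : ℝ → S) (σ : ℝ) : Prop where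
  pos : 0 < σ
  zero : c 0 = g t
  iso : ∀ s ∈ Icc 0 σ, ∀ s' ∈ Icc 0 σ, dist (c s) (c s') = |s - s'|
  ne : ∀ s ∈ Ioc 0 σ, c s ≠ g (t + s) ∧ c s ≠ g (t - s)

lemma IsTransverseSegment.mono {g : ℝ → S} {t : ℝ} {c : ℝ → S} {σ σ' : ℝ}
    (h : IsTransverseSegment g t c σ) (h0 : 0 < σ') (hle : σ' ≤ σ) :
    IsTransverseSegment g t c σ' :=
  ⟨h0, h.zero, fun s hs s' hs' => h.iso s ⟨hs.1, hs.2.trans hle⟩ s' ⟨hs'.1, hs'.2.trans hle⟩,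
    fun s hs => h.ne s ⟨hs.1, hs.2.trans hle⟩⟩

/-- The transverse measure gives the mass `m` to the leaf `g` with origin at the time `t`, on all
the transverse arcs which contain a geodesic segment which starts from `g t`. -/
def HasMass (μ : TransverseMeasure M L) (g : LocalGeodesic S) (t : ℝ) (m : ENNReal) : Prop :=
  ∀ α : Arc M, α.TransverseToLeaves L → ∀ (c : ℝ → S) (σ : ℝ), IsTransverseSegment g t c σ →
    c '' Icc 0 σ ⊆ α.image → μ.μ α {x | x.1 = g.shift t} = m

/-- A geodesic segment is straight in the chart. The condition `ne` is exactly what prevents it from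
lying along the real axis, that is, along g. -/
lemma IsFlatChart.exists_segment {g : ℝ → S} {t : ℝ} {Ψ : ℂ → S} {R : ℝ} {D : Set ℂ}
    (hΨ : IsFlatChart M g t Ψ R D) {c : ℝ → S} {σ : ℝ} (hc : IsTransverseSegment g t c σ) :
    ∃ e : ℂ, ‖e‖ = 1 ∧ e.im ≠ 0 ∧ ∃ σ' > 0, σ' ≤ σ ∧ σ' ≤ R / 4 ∧
      ∀ s ∈ Icc 0 σ', (s * e : ℂ) ∈ D ∧ c s = Ψ (s * e) := by
  have hR := hΨ.pos
  set σ' := min σ (R / 4) with hσ'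
  have h0 : 0 < σ' := lt_min hc.pos (by positivity)
  have hle : σ' ≤ σ := min_le_left _ _
  have hleR : σ' ≤ R / 4 := min_le_right _ _
  have hc' := hc.mono h0 hle
  have hex : ∀ s : ℝ, ∃ z, s ∈ Icc 0 σ' → z ∈ D ∧ ‖z‖ < R ∧ Ψ z = c s := by
    intro s
    by_cases hs : s ∈ Icc 0 σ'
    · obtain ⟨z, hz⟩ := hΨ.surj (c s) (by
        rw [← hc.zero, hc'.iso 0 ⟨le_rfl, h0.le⟩ s hs, zero_sub, abs_neg, abs_of_nonneg hs.1]
        linarith [hs.2])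
      exact ⟨z, fun _ => hz⟩
    · exact ⟨0, fun h => absurd h hs⟩
  choose ζ hζ using hex
  have hloc : IsLocalGeodesicOn ζ (Icc 0 σ') := by
    refine fun s _ => ⟨1, one_pos, fun a ha b hb _ _ => ?_⟩
    obtain ⟨a1, a2, a3⟩ := hζ a ha
    obtain ⟨b1, b2, b3⟩ := hζ b hb
    rw [← hΨ.iso _ a1 a2 _ b1 b2, a3, b3, hc'.iso a ha b hb]
  obtain ⟨v, hv, hline⟩ := hloc.exists_eq_line h0
  have h0D : (0 : ℂ) ∈ D := by rcases hΨ.domain with h | h <;> rw [h] <;> simp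
  have hΨ0 : Ψ 0 = g t := by simpa using hΨ.axis 0 (by simpa using hR)
  have hζ0 : ζ 0 = 0 := by
    obtain ⟨a1, a2, a3⟩ := hζ 0 ⟨le_rfl, h0.le⟩
    rw [← dist_eq_zero, ← hΨ.iso _ a1 a2 0 h0D (by simpa using hR), a3, hc.zero, hΨ0, dist_self]
  have key : ∀ s ∈ Icc 0 σ', (s * v : ℂ) ∈ D ∧ c s = Ψ (s * v) := by
    intro s hs
    obtain ⟨a1, a2, a3⟩ := hζ s hs
    rw [hline s hs, hζ0, zero_add, sub_zero] at a1 a3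
    exact ⟨a1, a3.symm⟩
  refine ⟨v, hv, fun him => ?_, σ', h0, hle, hleR, key⟩
  have hmem : σ' ∈ Icc 0 σ' := ⟨h0.le, le_rfl⟩
  have hre : v = (v.re : ℝ) := Complex.ext (by simp) (by simpa using him)
  have hre1 : |v.re| = 1 := by
    rw [hre, Complex.norm_real, Real.norm_eq_abs] at hv; exact hv
  have h1 := (key σ' hmem).2
  rw [hre, ← Complex.ofReal_mul, hΨ.axis _ (by
    rw [abs_mul, hre1, abs_of_pos h0]; linarith)] at h1
  have hne := hc'.ne σ' ⟨h0, le_rfl⟩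
  rcases eq_or_eq_neg_of_abs_eq hre1 with h | h <;> rw [h] at h1
  · rw [mul_one] at h1; exact hne.1 h1
  · rw [mul_neg, mul_one, ← sub_eq_add_neg] at h1; exact hne.2 h1

/-- Short transverse segments are transverse to all the leaves. -/
lemma IsTransverseSegment.exists_transverse (hp : IsIsometricUniversalCover p)
    (Λ : FlatLamination M p) {g : LocalGeodesic S} (hg : g.cls ∈ Λ.leaves) {t : ℝ}
    (hs : g t ∉ M.sing) {c : ℝ → S} {σ : ℝ} (hc : IsTransverseSegment g t c σ) :
    ∃ σ' > 0, σ' ≤ σ ∧ ∀ α : Arc M, IsC1On M α.ext 0 1 → α.image ⊆ c '' Icc 0 σ' →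
      α.TransverseToLeaves Λ.leaves := by
  obtain ⟨Ψ, R, D, hΨ⟩ := exists_isFlatChart (M := M) g g.2 hs
  obtain ⟨e, he, hei, σ', h0, hle, hR, H⟩ := hΨ.exists_segment hc
  refine ⟨σ', h0, hle, fun α hα him => hΨ.transverseToLeaves hp Λ hg he hei hα fun q hq => ?_⟩
  obtain ⟨s, hs, rfl⟩ := him hq
  exact ⟨s, by rw [abs_of_nonneg hs.1]; exact hs.2.trans hR, H s hs⟩

variable {F : ℂ → S} {R t : ℝ} {g : LocalGeodesic S}

lemma add_mul_mem_half {a σ : ℝ} (ha : |a| + σ < R) {e : ℂ} (he : ‖e‖ = 1) (hi : 0 < e.im)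
    {s : ℝ} (hs : s ∈ Icc 0 σ) : (a + s * e : ℂ) ∈ {z : ℂ | 0 ≤ z.im} ∩ Metric.ball 0 R := by
  constructor
  · simp only [mem_ofPred_eq, Complex.add_im, Complex.ofReal_im, Complex.im_ofReal_mul, zero_add]
    exact mul_nonneg hs.1 hi.le
  · rw [mem_ball_zero_iff]
    refine (norm_add_le _ _).trans_lt ?_
    rw [norm_mul, he, Complex.norm_real, Complex.norm_real, Real.norm_eq_abs, Real.norm_eq_abs,
      abs_of_nonneg hs.1]
    linarith [hs.2]

lemma IsFlatMap.isTransverseSegment (hF : IsFlatMap M F R {z | 0 ≤ z.im})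
    (hax : ∀ u : ℝ, |u| < R → F u = g (t + u)) {a σ : ℝ} (hσ : 0 < σ) (ha : |a| + σ < R) {e : ℂ}
    (he : ‖e‖ = 1) (hi : 0 < e.im) :
    IsTransverseSegment g (t + a) (fun s => F (a + s * e)) σ := by
  have hm := fun s hs => add_mul_mem_half ha he hi (s := s) hs
  refine ⟨hσ, ?_, fun s hs s' hs' => ?_, fun s hs => ?_⟩
  · simp only [Complex.ofReal_zero, zero_mul, add_zero]
    exact hax a (by linarith)
  · rw [hF.iso _ (hm s hs).1 (by simpa using (hm s hs).2) _ (hm s' hs').1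
      (by simpa using (hm s' hs').2), dist_eq_norm, add_sub_add_left_eq_sub, ← sub_mul, norm_mul,
      he, mul_one, ← Complex.ofReal_sub, Complex.norm_real, Real.norm_eq_abs]
  · have key : ∀ x : ℝ, |x| < R → F (a + s * e) ≠ g (t + x) := by
      intro x hx h
      rw [← hax x hx] at h
      have := hF.injOn (hm s ⟨hs.1.le, hs.2⟩) ⟨by simp, by
        rwa [mem_ball_zero_iff, Complex.norm_real, Real.norm_eq_abs]⟩ h
      have := congrArg Complex.im this
      simp only [Complex.add_im, Complex.ofReal_im, Complex.im_ofReal_mul, zero_add] at this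
      exact (mul_pos hs.1 hi).ne' this
    have h1 : |s| = s := abs_of_pos hs.1
    constructor
    · rw [add_assoc]; exact key _ ((abs_add_le _ _).trans_lt (by linarith [hs.2]))
    · rw [add_sub_assoc]; exact key _ ((abs_sub _ _).trans_lt (by linarith [hs.2]))

/-- Short segments of straight line issued from the real axis, as transverse arcs. -/
lemma IsFlatMap.exists_transverse_arc (hp : IsIsometricUniversalCover p) (Λ : FlatLamination M p)
    (hg : g.cls ∈ Λ.leaves) (hF : IsFlatMap M F R {z | 0 ≤ z.im})
    (hax : ∀ u : ℝ, |u| < R → F u = g (t + u)) {a : ℝ} (ha : |a| < R) {e : ℂ} (he : ‖e‖ = 1)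
    (hi : 0 < e.im) : ∃ σ₀ > (0 : ℝ), |a| + σ₀ < R ∧ ∀ σ ∈ Ioc (0 : ℝ) σ₀, ∃ α : Arc M,
      α.TransverseToLeaves Λ.leaves ∧ (∀ s ∈ Icc (0 : ℝ) 1, α.ext s = F (a + s * (σ * e))) ∧
      α.image = (fun s : ℝ => F (a + s * e)) '' Icc 0 σ := by
  have h1 : 0 < (R - |a|) / 2 := by linarith
  have hseg := hF.isTransverseSegment (a := a) hax h1 (by linarith) he hi
  have hreg : g (t + a) ∉ M.sing := by
    rw [← hax a ha]
    exact hF.regular _ (by simp) (by rwa [Complex.norm_real, Real.norm_eq_abs])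
  obtain ⟨σ₀, h0, hle, H⟩ := hseg.exists_transverse hp Λ hg hreg
  refine ⟨σ₀, h0, by linarith, fun σ hσ => ?_⟩
  have hd : (σ * e : ℂ) ≠ 0 := by
    rw [← norm_ne_zero_iff, norm_mul, he, mul_one, Complex.norm_real, norm_ne_zero_iff]
    exact hσ.1.ne'
  have hm := fun s hs => add_mul_mem_half (a := a) (σ := σ₀) (R := R) (by linarith) he hi (s := s) hs
  have hm0 := hm 0 ⟨le_rfl, h0.le⟩
  rw [Complex.ofReal_zero, zero_mul, add_zero] at hm0
  obtain ⟨α, x1, x2, x3⟩ := hF.exists_arc hd hm0 (hm σ ⟨hσ.1.le, hσ.2⟩)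
  have him : α.image = (fun s : ℝ => F (a + s * e)) '' Icc 0 σ := by
    rw [x3]
    ext q
    constructor
    · rintro ⟨s, hs, rfl⟩
      refine ⟨s * σ, ⟨mul_nonneg hs.1 hσ.1.le, by nlinarith [hs.2, hσ.1]⟩, ?_⟩
      simp only; congr 1; push_cast; ring
    · rintro ⟨s, hs, rfl⟩
      refine ⟨s / σ, ⟨div_nonneg hs.1 hσ.1.le, (div_le_one hσ.1).2 hs.2⟩, ?_⟩
      have : (σ : ℂ) ≠ 0 := by exact_mod_cast hσ.1.ne'
      simp only; congr 1; push_cast; field_simp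
  refine ⟨α, H α x2 ?_, x1, him⟩
  rw [him]
  exact image_mono (Icc_subset_Icc_right hσ.2)

/-- Two transverse arcs which contain segments issued from two points of the real axis in the same
flat half disc give the same mass to the leaf. -/
lemma IsFlatMap.atom_eq_of_lt (hp : IsIsometricUniversalCover p) (Λ : FlatLamination M p)
    (μ : TransverseMeasure M Λ.leaves)
    (hg : g.cls ∈ Λ.leaves) (hF : IsFlatMap M F R {z | 0 ≤ z.im})
    (hax : ∀ u : ℝ, |u| < R → F u = g (t + u)) {a b : ℝ} (hab : a < b) (ha : |a| < R)
    (hb : |b| < R) {e₁ e₂ : ℂ} (h₁ : ‖e₁‖ = 1) (h₂ : ‖e₂‖ = 1) (i₁ : 0 < e₁.im) (i₂ : 0 < e₂.im)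
    {α₁ α₂ : Arc M} (t₁ : α₁.TransverseToLeaves Λ.leaves) (t₂ : α₂.TransverseToLeaves Λ.leaves)
    {σ₁ σ₂ : ℝ} (hσ₁ : 0 < σ₁) (hσ₂ : 0 < σ₂)
    (c₁ : (fun s : ℝ => F (a + s * e₁)) '' Icc 0 σ₁ ⊆ α₁.image)
    (c₂ : (fun s : ℝ => F (b + s * e₂)) '' Icc 0 σ₂ ⊆ α₂.image) :
    μ.μ α₁ {x | x.1 = g.shift (t + a)} = μ.μ α₂ {x | x.1 = g.shift (t + b)} := by
  obtain ⟨s₁, p₁, q₁, H₁⟩ := hF.exists_transverse_arc hp Λ hg hax ha h₁ i₁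
  obtain ⟨s₂, p₂, q₂, H₂⟩ := hF.exists_transverse_arc hp Λ hg hax hb h₂ i₂
  obtain ⟨s₃, p₃, H₃⟩ := hF.atom_eq μ hg hax hab ha hb h₁ h₂ i₁ i₂
  -- One length short enough for both segments to be transverse, to be contained in the given arcs,
  -- and to be joined by the homotopy; `atom_restrict` reduces the given arcs to them.
  set σ := min (min s₁ s₂) (min (s₃ / 2) (min σ₁ σ₂)) with hσ
  have h0 : 0 < σ := by positivity
  have l1 : σ ≤ s₁ := (min_le_left _ _).trans (min_le_left _ _)
  have l2 : σ ≤ s₂ := (min_le_left _ _).trans (min_le_right _ _)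
  have l3 : σ < s₃ := lt_of_le_of_lt ((min_le_right _ _).trans (min_le_left _ _)) (by linarith)
  have l4 : σ ≤ σ₁ :=
    (min_le_right _ _).trans ((min_le_right _ _).trans (min_le_left _ _))
  have l5 : σ ≤ σ₂ :=
    (min_le_right _ _).trans ((min_le_right _ _).trans (min_le_right _ _))
  obtain ⟨β₁, u₁, v₁, w₁⟩ := H₁ σ ⟨h0, l1⟩
  obtain ⟨β₂, u₂, v₂, w₂⟩ := H₂ σ ⟨h0, l2⟩
  have hsub : ∀ {x : ℝ} {e : ℂ} {β : Arc M}, |x| < R →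
      β.image = (fun s : ℝ => F (x + s * e)) '' Icc 0 σ → (g.shift (t + x)) 0 ∈ β.image := by
    intro x e β hx hβ
    rw [hβ]
    refine ⟨0, ⟨le_rfl, h0.le⟩, ?_⟩
    simp only [Complex.ofReal_zero, zero_mul, add_zero]
    rw [hax x hx, LocalGeodesic.shift_apply, zero_add]
  rw [μ.atom_restrict t₁ u₁ (w₁ ▸ (image_mono (Icc_subset_Icc_right l4)).trans c₁)
    (by rwa [LocalGeodesic.cls_shift]) (hsub ha w₁),
    μ.atom_restrict t₂ u₂ (w₂ ▸ (image_mono (Icc_subset_Icc_right l5)).trans c₂)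
    (by rwa [LocalGeodesic.cls_shift]) (hsub hb w₂)]
  exact H₃ σ ⟨h0, l3⟩ β₁ β₂ u₁ u₂ v₁ v₂

lemma norm_I_im : ‖Complex.I‖ = 1 ∧ 0 < Complex.I.im := by simp

/-- A holonomy needs disjoint arcs and a positive time, so two arcs through the same point are not
compared directly: both are compared with a perpendicular at an earlier point of the axis. -/
lemma IsFlatMap.atom_eq_of_eq (hp : IsIsometricUniversalCover p) (Λ : FlatLamination M p)
    (μ : TransverseMeasure M Λ.leaves)
    (hg : g.cls ∈ Λ.leaves) (hF : IsFlatMap M F R {z | 0 ≤ z.im})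
    (hax : ∀ u : ℝ, |u| < R → F u = g (t + u)) {b : ℝ}
    (hb : |b| < R) {e₁ e₂ : ℂ} (h₁ : ‖e₁‖ = 1) (h₂ : ‖e₂‖ = 1) (i₁ : 0 < e₁.im) (i₂ : 0 < e₂.im)
    {α₁ α₂ : Arc M} (t₁ : α₁.TransverseToLeaves Λ.leaves) (t₂ : α₂.TransverseToLeaves Λ.leaves)
    {σ₁ σ₂ : ℝ} (hσ₁ : 0 < σ₁) (hσ₂ : 0 < σ₂)
    (c₁ : (fun s : ℝ => F (b + s * e₁)) '' Icc 0 σ₁ ⊆ α₁.image)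
    (c₂ : (fun s : ℝ => F (b + s * e₂)) '' Icc 0 σ₂ ⊆ α₂.image) :
    μ.μ α₁ {x | x.1 = g.shift (t + b)} = μ.μ α₂ {x | x.1 = g.shift (t + b)} := by
  have ha : |b - (R - |b|) / 2| < R := by
    refine (abs_sub _ _).trans_lt ?_
    rw [abs_of_pos (show 0 < (R - |b|) / 2 by linarith)]; linarith
  obtain ⟨s₁, p₁, -, H₁⟩ := hF.exists_transverse_arc hp Λ hg hax ha norm_I_im.1 norm_I_im.2
  obtain ⟨β, u, -, w⟩ := H₁ s₁ ⟨p₁, le_rfl⟩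
  have hlt : b - (R - |b|) / 2 < b := by linarith
  rw [← hF.atom_eq_of_lt hp Λ μ hg hax hlt ha hb norm_I_im.1 h₁ norm_I_im.2 i₁ u t₁ p₁ hσ₁
    w.ge c₁, hF.atom_eq_of_lt hp Λ μ hg hax hlt ha hb norm_I_im.1 h₂ norm_I_im.2 i₂ u t₂ p₁ hσ₂
    w.ge c₂]

/-- The upper half of a flat chart. -/
lemma IsFlatChart.upper {D : Set ℂ} (h : IsFlatChart M g t F R D) :
    IsFlatMap M F R {z | 0 ≤ z.im} := by
  have hD : ∀ z : ℂ, 0 ≤ z.im → z ∈ D := by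
    intro z hz; rcases h.domain with e | e <;> rw [e]
    · exact mem_univ _
    · exact hz
  exact ⟨Or.inr rfl, fun z hz hz' w hw hw' => h.iso z (hD z hz) hz' w (hD w hw) hw',
    fun z hz => h.regular z (hD z hz)⟩

/-- The lower half of a flat chart. -/
lemma IsFlatChart.lower (h : IsFlatChart M g t F R univ) :
    IsFlatMap M (fun z => F ((starRingEnd ℂ) z)) R {z | 0 ≤ z.im} := by
  have hn : ∀ z : ℂ, ‖(starRingEnd ℂ) z‖ = ‖z‖ := fun z => RCLike.norm_conj z
  refine ⟨Or.inr rfl, fun z _ hz' w _ hw' => ?_, fun z _ hz' => h.regular _ (mem_univ _)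
    (by rwa [hn])⟩
  rw [h.iso _ (mem_univ _) (by rwa [hn]) _ (mem_univ _) (by rwa [hn]), dist_eq_norm, ← map_sub, hn,
    dist_eq_norm]

/-- `HasMass` quantifies over arcs; at a regular point the perpendicular of a flat chart is an arc
to which both hypotheses apply. -/
lemma HasMass.unique (hp : IsIsometricUniversalCover p) (Λ : FlatLamination M p)
    (μ : TransverseMeasure M Λ.leaves) (hg : g.cls ∈ Λ.leaves) (hs : g t ∉ M.sing)
    {m m' : ENNReal} (h : HasMass μ g t m) (h' : HasMass μ g t m') : m = m' := by
  obtain ⟨Ψ, R, D, hΨ⟩ := exists_isFlatChart (M := M) g g.2 hs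
  obtain ⟨σ, hσ, hR, H⟩ := hΨ.upper.exists_transverse_arc hp Λ hg hΨ.axis (a := 0)
    (by simpa using hΨ.pos) norm_I_im.1 norm_I_im.2
  obtain ⟨β, u, -, w⟩ := H σ ⟨hσ, le_rfl⟩
  have hseg := hΨ.upper.isTransverseSegment hΨ.axis hσ hR norm_I_im.1 norm_I_im.2
  rw [add_zero] at hseg
  rw [← h β u _ _ hseg w.ge, ← h' β u _ _ hseg w.ge]

/-- Each leaf has a well defined mass at each of its regular points. -/
lemma exists_hasMass (hp : IsIsometricUniversalCover p) (Λ : FlatLamination M p)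
    (μ : TransverseMeasure M Λ.leaves) (hg : g.cls ∈ Λ.leaves) (hs : g t ∉ M.sing) :
    ∃ m, HasMass μ g t m := by
  obtain ⟨Ψ, R, D, hΨ⟩ := exists_isFlatChart (M := M) g g.2 hs
  have hR := hΨ.pos
  rcases hΨ.domain with hD | hD
  · subst hD
    -- A perpendicular going through both sides of the leaf. It contains segments leaving on either
    -- side, and so it is a common reference that makes the two sides give the same mass.
    obtain ⟨α, x1, x2, x3⟩ := hΨ.isFlatMap.exists_arc (z₀ := -((R / 4 : ℝ) * Complex.I))
      (d := (R / 2 : ℝ) * Complex.I) (by simp [hR.ne']) ⟨mem_univ _, by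
        rw [mem_ball_zero_iff, norm_neg, norm_mul, Complex.norm_real, Complex.norm_I, mul_one,
          Real.norm_eq_abs, abs_of_pos (by linarith)]; linarith⟩ ⟨mem_univ _, by
        rw [mem_ball_zero_iff, neg_add_eq_sub, ← sub_mul, ← Complex.ofReal_sub, norm_mul,
          Complex.norm_real, Complex.norm_I, mul_one,
          Real.norm_eq_abs, abs_of_pos (by linarith)]; linarith⟩
    have hcont : ∀ s : ℝ, |s| ≤ R / 4 → Ψ (s * Complex.I) ∈ α.image := by
      intro s hs
      rw [abs_le] at hs
      rw [x3]
      refine ⟨(s + R / 4) / (R / 2), ⟨div_nonneg (by linarith) (by linarith),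
        (div_le_one (by linarith)).2 (by linarith)⟩, ?_⟩
      have : (R : ℂ) ≠ 0 := by exact_mod_cast hR.ne'
      simp only; congr 1; push_cast; field_simp; ring
    have htr : α.TransverseToLeaves Λ.leaves := by
      refine hΨ.transverseToLeaves hp Λ hg norm_I_im.1 norm_I_im.2.ne' x2 fun q hq => ?_
      rw [x3] at hq
      obtain ⟨s, hs, rfl⟩ := hq
      refine ⟨-(R / 4) + s * (R / 2), ?_, mem_univ _, ?_⟩
      · rw [abs_le]; constructor <;> nlinarith [hs.1, hs.2]
      · simp only; congr 1; push_cast; ring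
    refine ⟨μ.μ α {x | x.1 = g.shift t}, fun β hβ c σ hc hsub => ?_⟩
    obtain ⟨e, he, hei, σ', h0, hle, hR', H⟩ := hΨ.exists_segment hc
    -- A segment leaving on the lower side is treated in the conjugate chart.
    rcases lt_or_gt_of_ne hei with hi | hi
    · have := hΨ.lower.atom_eq_of_eq (t := t) hp Λ μ hg (b := 0) (fun u hu => by
        simp only [Complex.conj_ofReal]; exact hΨ.axis u hu) (by simpa using hR)
        (e₁ := (starRingEnd ℂ) e) (e₂ := Complex.I) (by rw [RCLike.norm_conj, he])
        norm_I_im.1 (by simpa using hi) norm_I_im.2 hβ htr h0 (σ₂ := R / 4) (by linarith) ?_ ?_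
      · simpa using this
      · rintro _ ⟨s, hs, rfl⟩
        simp only [Complex.ofReal_zero, zero_add, map_mul, Complex.conj_ofReal, Complex.conj_conj]
        rw [← (H s hs).2]
        exact hsub ⟨s, ⟨hs.1, hs.2.trans hle⟩, rfl⟩
      · rintro _ ⟨s, hs, rfl⟩
        simp only [Complex.ofReal_zero, zero_add, map_mul, Complex.conj_ofReal, Complex.conj_I]
        have := hcont (-s) (by rw [abs_neg, abs_of_nonneg hs.1]; exact hs.2)
        simpa using this
    · have := hΨ.upper.atom_eq_of_eq (t := t) hp Λ μ hg (b := 0) hΨ.axis (by simpa using hR)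
        he norm_I_im.1 hi norm_I_im.2 hβ htr h0 (σ₂ := R / 4) (by linarith) ?_ ?_
      · simpa using this
      · rintro _ ⟨s, hs, rfl⟩
        simp only [Complex.ofReal_zero, zero_add]
        rw [← (H s hs).2]
        exact hsub ⟨s, ⟨hs.1, hs.2.trans hle⟩, rfl⟩
      · rintro _ ⟨s, hs, rfl⟩
        simp only [Complex.ofReal_zero, zero_add]
        exact hcont s (by rw [abs_of_nonneg hs.1]; exact hs.2)
  · obtain ⟨σ₀, hσ₀, -, H₀⟩ := hΨ.upper.exists_transverse_arc hp Λ hg hΨ.axis (a := 0)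
      (by simpa using hR) norm_I_im.1 norm_I_im.2
    obtain ⟨α, u, -, w⟩ := H₀ σ₀ ⟨hσ₀, le_rfl⟩
    refine ⟨μ.μ α {x | x.1 = g.shift t}, fun β hβ c σ hc hsub => ?_⟩
    obtain ⟨e, he, hei, σ', h0, hle, hR', H⟩ := hΨ.exists_segment hc
    -- In a half disc there is only one side.
    have hi : 0 < e.im := by
      have := (H σ' ⟨h0.le, le_rfl⟩).1
      rw [hD, mem_ofPred_eq, Complex.im_ofReal_mul] at this
      exact lt_of_le_of_ne (nonneg_of_mul_nonneg_right this h0) hei.symm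
    have := hΨ.upper.atom_eq_of_eq (t := t) hp Λ μ hg (b := 0) hΨ.axis (by simpa using hR)
      he norm_I_im.1 hi norm_I_im.2 hβ u h0 hσ₀ ?_ w.ge
    · simpa using this
    · rintro _ ⟨s, hs, rfl⟩
      simp only [Complex.ofReal_zero, zero_add]
      rw [← (H s hs).2]
      exact hsub ⟨s, ⟨hs.1, hs.2.trans hle⟩, rfl⟩

/-- The mass of a leaf is constant near a regular point. -/
lemma IsFlatChart.mass_eq (hp : IsIsometricUniversalCover p) (Λ : FlatLamination M p)
    (μ : TransverseMeasure M Λ.leaves) (hg : g.cls ∈ Λ.leaves) {D : Set ℂ}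
    (hF : IsFlatChart M g t F R D) {a b : ℝ} (ha : |a| < R) (hb : |b| < R) {m m' : ENNReal}
    (h : HasMass μ g (t + a) m) (h' : HasMass μ g (t + b) m') : m = m' := by
  wlog hab : a ≤ b
  · exact (this hp Λ μ hg hF hb ha h' h (le_of_not_ge hab)).symm
  have hreg : g (t + a) ∉ M.sing := by
    rw [← hF.axis a ha]
    exact hF.upper.regular _ (by simp) (by rwa [Complex.norm_real, Real.norm_eq_abs])
  rcases hab.eq_or_lt with rfl | hab
  · exact h.unique hp Λ μ hg hreg h'
  obtain ⟨σ₁, p₁, r₁, H₁⟩ := hF.upper.exists_transverse_arc hp Λ hg hF.axis ha norm_I_im.1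
    norm_I_im.2
  obtain ⟨σ₂, p₂, r₂, H₂⟩ := hF.upper.exists_transverse_arc hp Λ hg hF.axis hb norm_I_im.1
    norm_I_im.2
  obtain ⟨β₁, u₁, -, w₁⟩ := H₁ σ₁ ⟨p₁, le_rfl⟩
  obtain ⟨β₂, u₂, -, w₂⟩ := H₂ σ₂ ⟨p₂, le_rfl⟩
  rw [← h β₁ u₁ _ _ (hF.upper.isTransverseSegment hF.axis p₁ r₁ norm_I_im.1 norm_I_im.2) w₁.ge,
    ← h' β₂ u₂ _ _ (hF.upper.isTransverseSegment hF.axis p₂ r₂ norm_I_im.1 norm_I_im.2) w₂.ge]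
  exact hF.upper.atom_eq_of_lt hp Λ μ hg hF.axis hab ha hb norm_I_im.1 norm_I_im.1 norm_I_im.2
    norm_I_im.2 u₁ u₂ p₁ p₂ w₁.ge w₂.ge

end Mass

/-! ### Sectors bounded by a leaf at an arbitrary point -/

section Sectors

open HalfTranslationSurface

variable {S E : Type*} [MetricSpace S] [MetricSpace E] {M : HalfTranslationSurface S} {p : E → S}

/-- Polar coordinates `P` on a Euclidean sector of angle `φ ≥ π` and centre `x`. -/
structure IsSector (M : HalfTranslationSurface S) (x : S) (P : ℝ → ℝ → S) (R φ : ℝ) : Prop where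
  pos : 0 < R
  le_rad : R ≤ M.rad x
  pi_le : Real.pi ≤ φ
  zero : ∀ ω ∈ Icc 0 φ, P 0 ω = x
  iso : ∀ ρ ∈ Ico 0 R, ∀ ρ' ∈ Ico 0 R, ∀ ω ∈ Icc 0 φ, ∀ ω' ∈ Icc 0 φ,
    dist (P ρ ω) (P ρ' ω') = coneDist ρ ρ' |ω - ω'|

variable {x : S} {P : ℝ → ℝ → S} {R φ : ℝ}

/-- Exchanges the two sides of the sector, hence the past and the future of the geodesic which
bounds it. -/
lemma IsSector.reverse (h : IsSector M x P R φ) : IsSector M x (fun ρ ω => P ρ (φ - ω)) R φ := by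
  have hm : ∀ ω ∈ Icc 0 φ, φ - ω ∈ Icc 0 φ := fun ω hω => ⟨by linarith [hω.2], by linarith [hω.1]⟩
  refine ⟨h.pos, h.le_rad, h.pi_le, fun ω hω => h.zero _ (hm ω hω), fun ρ hρ ρ' hρ' ω hω ω' hω' => ?_⟩
  rw [h.iso ρ hρ ρ' hρ' _ (hm ω hω) _ (hm ω' hω'), sub_sub_sub_cancel_left, abs_sub_comm]

lemma IsSector.dist_center (h : IsSector M x P R φ) {ρ ω : ℝ} (hρ : ρ ∈ Ico 0 R)
    (hω : ω ∈ Icc 0 φ) : dist x (P ρ ω) = ρ := by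
  rw [← h.zero ω hω, h.iso 0 ⟨le_rfl, h.pos⟩ ρ hρ ω hω ω hω, coneDist_zero_left hρ.1]

lemma IsSector.radius_eq (h : IsSector M x P R φ) {ρ ρ' ω ω' : ℝ} (hρ : ρ ∈ Ico 0 R)
    (hρ' : ρ' ∈ Ico 0 R) (hω : ω ∈ Icc 0 φ) (hω' : ω' ∈ Icc 0 φ) (e : P ρ ω = P ρ' ω') :
    ρ = ρ' := by
  rw [← h.dist_center hρ hω, e, h.dist_center hρ' hω']

lemma IsSector.angle_eq (h : IsSector M x P R φ) {ρ ρ' ω ω' : ℝ} (h0 : 0 < ρ) (hρ : ρ ∈ Ico 0 R)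
    (hρ' : ρ' ∈ Ico 0 R) (hω : ω ∈ Icc 0 φ) (hω' : ω' ∈ Icc 0 φ) (e : P ρ ω = P ρ' ω') :
    ω = ω' := by
  obtain rfl := h.radius_eq hρ hρ' hω hω' e
  have h1 := h.iso ρ hρ ρ hρ ω hω ω' hω'
  rw [e, dist_self] at h1
  have := eq_zero_of_coneDist h0 h0 (abs_nonneg _) (h1.symm.trans (by simp))
  linarith [abs_eq_zero.1 this]

lemma IsSector.notMem_sing (h : IsSector M x P R φ) {ρ ω : ℝ} (h0 : 0 < ρ) (hρ : ρ < R)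
    (hω : ω ∈ Icc 0 φ) : P ρ ω ∉ M.sing := by
  have hd := h.dist_center ⟨h0.le, hρ⟩ hω
  refine notMem_sing_of_dist_lt (x := x) (by rw [hd]; exact hρ.trans_le h.le_rad) fun e => ?_
  rw [e, dist_self] at hd
  exact h0.ne hd

lemma polarPt_norm_arg (z : ℂ) : polarPt ‖z‖ (Complex.arg z) = z :=
  Complex.norm_mul_exp_arg_mul_I z

/-- Sectors of angle at most `π` are isometric to planar sectors. -/
lemma IsSector.dist_eq (h : IsSector M x P R φ) {ω₀ : ℝ} {z w : ℂ} (hz : ‖z‖ < R) (hw : ‖w‖ < R)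
    (hz' : ω₀ + Complex.arg z ∈ Icc 0 φ) (hw' : ω₀ + Complex.arg w ∈ Icc 0 φ)
    (hzw : |Complex.arg z - Complex.arg w| ≤ Real.pi) :
    dist (P ‖z‖ (ω₀ + Complex.arg z)) (P ‖w‖ (ω₀ + Complex.arg w)) = dist z w := by
  rw [h.iso _ ⟨norm_nonneg _, hz⟩ _ ⟨norm_nonneg _, hw⟩ _ hz' _ hw', add_sub_add_left_eq_sub,
    coneDist_abs_sub hzw, polarPt_norm_arg, polarPt_norm_arg, dist_eq_norm]

/-- Cone distances do not see angles beyond π, and angles at most π are read correctly by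
`linkDist_eq_abs`. So the only thing to check is that angles at least π in the sector are not
shortened by going around the outside. -/
lemma IsSector.of_angle {θ φ υ : ℝ} (hR : 0 < R) (hRx : R ≤ M.rad x) (hφ : Real.pi ≤ φ)
    (hυ : |υ| = 1) (hl : ∀ ω ∈ Icc 0 φ, θ + υ * ω ∈ M.link x)
    (hd : ∀ ω ∈ Icc 0 φ, ∀ ω' ∈ Icc 0 φ, Real.pi ≤ |ω - ω'| →
      Real.pi ≤ M.ldist x (θ + υ * ω) (θ + υ * ω')) :
    IsSector M x (fun ρ ω => M.pol x ρ (θ + υ * ω)) R φ := by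
  refine ⟨hR, hRx, hφ, fun ω hω => M.pol_zero x _ (hl ω hω), fun ρ hρ ρ' hρ' ω hω ω' hω' => ?_⟩
  rw [dist_pol_pol hρ.1 (hρ.2.trans_le hRx) hρ'.1 (hρ'.2.trans_le hRx) (hl ω hω) (hl ω' hω')]
  have e : |θ + υ * ω - (θ + υ * ω')| = |ω - ω'| := by
    rw [add_sub_add_left_eq_sub, ← mul_sub, abs_mul, hυ, one_mul]
  rcases le_total Real.pi |ω - ω'| with hle | hle
  · rw [coneDist_of_pi_le hρ.1 hρ'.1 (hd ω hω ω' hω' hle), coneDist_of_pi_le hρ.1 hρ'.1 hle]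
  · rw [ldist, linkDist_eq_abs (M.two_le_k x) (by rw [e]; exact hle), e]

/-- A local geodesic bounds, near each of its points, a sector of angle at least `π`. -/
lemma exists_isSector (g : ℝ → S) (hg : IsLocalGeodesicOn g univ) (t : ℝ) :
    ∃ P R φ, IsSector M (g t) P R φ ∧ (∀ u ∈ Ico 0 R, g (t + u) = P u 0) ∧
      (∀ u ∈ Ico 0 R, g (t - u) = P u φ) ∧
      (∀ s s', |s - t| < R → |s' - t| < R → dist (g s) (g s') = |s - s'|) := by
  have hpi := Real.pi_pos
  obtain ⟨ε, hε, hR, θp, hθp, θm, hθm, hθ, h1, h2, h3⟩ := exists_directions (M := M) g hg t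
  set y := g t
  by_cases hb : y ∈ M.bdry
  · have hθ' : Real.pi ≤ |θp - θm| := by simpa [ldist, linkDist, hb] using hθ
    have hp := hθp hb
    have hm := hθm hb
    have key : ∀ υ : ℝ, |υ| = 1 → θp + υ * |θp - θm| = θm → IsSector M y
        (fun ρ ω => M.pol y ρ (θp + υ * ω)) ε |θp - θm| := by
      intro υ hυ e
      refine IsSector.of_angle hε hR hθ' hυ (fun ω hω _ => ?_) fun ω hω ω' hω' hle => ?_
      · rcases eq_or_eq_neg_of_abs_eq hυ with h | h <;> rw [h] at e ⊢ <;>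
          constructor <;> linarith [hp.1, hp.2, hm.1, hm.2, hω.1, hω.2]
      · simp only [ldist, linkDist, hb, if_true]
        rwa [add_sub_add_left_eq_sub, ← mul_sub, abs_mul, hυ, one_mul]
    rcases le_total θp θm with h | h
    · have e : θp + 1 * |θp - θm| = θm := by rw [abs_sub_comm, abs_of_nonneg (by linarith)]; ring
      exact ⟨_, _, _, key 1 (by simp) e, fun u hu => by rw [h1 u hu, mul_zero, add_zero],
        fun u hu => by rw [h2 u hu, e], h3⟩
    · have e : θp + -1 * |θp - θm| = θm := by rw [abs_of_nonneg (by linarith)]; ring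
      exact ⟨_, _, _, key (-1) (by simp) e, fun u hu => by rw [h1 u hu, mul_zero, add_zero],
        fun u hu => by rw [h2 u hu, e], h3⟩
  · set C := (M.k y : ℝ) * Real.pi with hC
    have hC0 : 0 < C := by
      have : (2 : ℝ) ≤ M.k y := by exact_mod_cast M.two_le_k y hb
      positivity
    -- The angle from the forward to the backward direction in the positive sense. The complementary
    -- angle C - φ is also at least π, which is why the outside offers no shortcut.
    set φ := toIcoMod hC0 0 (θm - θp) with hφ
    obtain ⟨f1, f2⟩ := toIcoMod_mem_Ico hC0 0 (θm - θp)
    rw [← hφ, zero_add] at f2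
    rw [← hφ] at f1
    have f3 : φ = θm - θp - toIcoDiv hC0 0 (θm - θp) * C := by
      rw [hφ, toIcoMod]; simp
    have f4 : ((φ : ℝ) : AddCircle C) = ((θm - θp : ℝ) : AddCircle C) := by
      rw [f3, AddCircle.coe_sub, sub_eq_self, AddCircle.coe_eq_zero_iff]
      exact ⟨toIcoDiv hC0 0 (θm - θp), by simp⟩
    have f5 : Real.pi ≤ ‖((φ : ℝ) : AddCircle C)‖ := by
      rw [f4, ← norm_neg, ← AddCircle.coe_neg, neg_sub]
      simpa [ldist, linkDist, hb] using hθ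
    have f6 : Real.pi ≤ φ ∧ φ ≤ C - Real.pi := by
      have a1 := linkDist_le_abs (y ∈ M.bdry) (M.k y) φ 0
      have a2 := linkDist_le_abs (y ∈ M.bdry) (M.k y) φ C
      simp only [linkDist, hb, if_false, sub_zero] at a1 a2
      rw [AddCircle.coe_sub, AddCircle.coe_period, sub_zero] at a2
      rw [abs_of_nonneg f1] at a1
      rw [abs_sub_comm, abs_of_nonneg (by linarith)] at a2
      exact ⟨f5.trans a1, by linarith [f5.trans a2]⟩
    refine ⟨fun ρ ω => M.pol y ρ (θp + 1 * ω), ε, φ, IsSector.of_angle hε hR f6.1 (by simp)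
      (fun _ _ h => absurd h hb) fun ω hω ω' hω' hle => ?_, fun u hu => ?_, fun u hu => ?_, h3⟩
    · have key : ∀ a ∈ Icc 0 φ, ∀ b ∈ Icc 0 φ, Real.pi ≤ a - b →
          Real.pi ≤ M.ldist y (θp + 1 * a) (θp + 1 * b) := by
        intro a ha b hb' hab
        simp only [ldist, linkDist, hb, if_false]
        refine le_norm_addCircle hC0.le (by linarith) (by linarith [ha.2, hb'.1, f6.2])
      rcases le_total ω' ω with h | h
      · exact key ω hω ω' hω' (by rwa [abs_of_nonneg (by linarith)] at hle)
      · rw [ldist, linkDist_comm]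
        exact key ω' hω' ω hω (by rwa [abs_sub_comm, abs_of_nonneg (by linarith)] at hle)
    · rw [h1 u hu]; simp
    · rw [h2 u hu]
      refine pol_eq_of_ldist hu.1 (hu.2.trans_le hR) hθm (fun h => absurd h hb) ?_
      simp only [ldist, linkDist, hb, if_false, one_mul]
      rw [norm_eq_zero, AddCircle.coe_eq_zero_iff]
      exact ⟨toIcoDiv hC0 0 (θm - θp), by rw [zsmul_eq_mul, ← hC]; linarith [f3]⟩

end Sectors

/-! ### The arcs which sweep a sector -/

section SectorArcs

open HalfTranslationSurface

variable {S E : Type*} [MetricSpace S] [MetricSpace E] {M : HalfTranslationSurface S} {p : E → S}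
  {x : S} {P : ℝ → ℝ → S} {R φ : ℝ}

/-- A piece of a geodesic which is the union of the sides of a sector does not meet the interior of
the sector. -/
lemma IsSector.notMem_axis (h : IsSector M x P R φ) {g : ℝ → S} {t₀ υ : ℝ} (hυ : υ = 1 ∨ υ = -1)
    (hp : ∀ u ∈ Ico 0 R, g (t₀ + υ * u) = P u 0) (hm : ∀ u ∈ Ico 0 R, g (t₀ - υ * u) = P u φ)
    {ρ ω u : ℝ} (hρ0 : 0 < ρ) (hρ : ρ < R) (hω : ω ∈ Ioo 0 φ) (hu : |u - t₀| < R) :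
    g u ≠ P ρ ω := by
  intro e
  have hφ : (0 : ℝ) ≤ φ := hω.1.le.trans hω.2.le
  have key : ∀ r ∈ Ico 0 R, ∀ a ∈ Icc 0 φ, P ρ ω = P r a → ω = a := fun r hr a ha e' =>
    h.angle_eq hρ0 ⟨hρ0.le, hρ⟩ hr (Ioo_subset_Icc_self hω) ha e'
  have hυ' : υ * υ = 1 := by rcases hυ with rfl | rfl <;> norm_num
  have hυ1 : |υ| = 1 := by rcases hυ with rfl | rfl <;> norm_num
  rcases le_total 0 (υ * (u - t₀)) with h0 | h0
  · have hmem : υ * (u - t₀) ∈ Ico 0 R := ⟨h0, by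
      rw [← abs_of_nonneg h0, abs_mul, hυ1, one_mul]; exact hu⟩
    have h1 := hp _ hmem
    rw [show t₀ + υ * (υ * (u - t₀)) = u by linear_combination (u - t₀) * hυ'] at h1
    exact hω.1.ne' (key _ hmem 0 ⟨le_rfl, hφ⟩ (e.symm.trans h1))
  · have hmem : -(υ * (u - t₀)) ∈ Ico 0 R := ⟨by linarith, by
      rw [← abs_of_nonpos h0, abs_mul, hυ1, one_mul]; exact hu⟩
    have h1 := hm _ hmem
    rw [show t₀ - υ * -(υ * (u - t₀)) = u by linear_combination (u - t₀) * hυ'] at h1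
    exact hω.2.ne (key _ hmem φ ⟨hφ, le_rfl⟩ (e.symm.trans h1))

lemma norm_add_mul_I_sq (t y : ℝ) : ‖(t + y * Complex.I : ℂ)‖ ^ 2 = t ^ 2 + y ^ 2 := by
  rw [Complex.sq_norm, Complex.normSq_add_mul_I]

/-- The arcs which sweep a sector. -/
lemma IsSector.exists_arc (h : IsSector M x P R φ) {g : ℝ → S} {t₀ υ : ℝ} (hυ : υ = 1 ∨ υ = -1)
    (hg : ∀ s s', |s - t₀| < R → |s' - t₀| < R → dist (g s) (g s') = |s - s'|)
    (hp : ∀ u ∈ Ico 0 R, g (t₀ + υ * u) = P u 0) (hm : ∀ u ∈ Ico 0 R, g (t₀ - υ * u) = P u φ)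
    {I : Set ℝ} (hI : ∀ u ∈ I, |u - t₀| < R) {t σ l : ℝ} (ht : 0 < t) (hσ : 0 < σ)
    (htσ : t + σ < R) (hl : 0 < l) (hlφ : l * Real.pi ≤ φ) :
    ∃ β : Arc M, (∀ s ∈ Icc (0 : ℝ) 1, β.ext s =
      P ‖(t + (s * σ : ℝ) * Complex.I : ℂ)‖ (l * Complex.arg (t + (s * σ : ℝ) * Complex.I))) ∧
      β.TransverseTo g I := by
  have hpi := Real.pi_pos
  -- A vertical segment based on the real axis of a half plane, whose polar angle is then multiplied
  -- by l. As arg < π/2 and lπ ≤ φ, the image stays in the first half of the sector.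
  set w : ℝ → ℂ := fun s => t + (s * σ : ℝ) * Complex.I with hw
  have wre : ∀ s, (w s).re = t := fun s => by simp [hw]
  have wim : ∀ s, (w s).im = s * σ := fun s => by simp [hw]
  have wsq : ∀ s, ‖w s‖ ^ 2 = t ^ 2 + (s * σ) ^ 2 := fun s => norm_add_mul_I_sq t (s * σ)
  have w0 : w 0 = t := by simp [hw]
  have wpos : ∀ s, 0 < ‖w s‖ := fun s => by
    rw [norm_pos_iff]; intro e
    have := congrArg Complex.re e
    rw [wre, Complex.zero_re] at this; exact ht.ne' this
  have wne : ∀ s, w s ≠ 0 := fun s => norm_pos_iff.1 (wpos s)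
  have wlt : ∀ s ∈ Icc (0 : ℝ) 1, ‖w s‖ < R := by
    intro s hs
    refine (norm_add_le _ _).trans_lt ?_
    rw [norm_mul, Complex.norm_I, Complex.norm_real, Complex.norm_real, Real.norm_eq_abs,
      Real.norm_eq_abs, abs_of_pos ht, abs_of_nonneg (mul_nonneg hs.1 hσ.le)]
    nlinarith [hs.2]
  have wmem : ∀ s ∈ Icc (0 : ℝ) 1, ‖w s‖ ∈ Ico 0 R := fun s hs => ⟨norm_nonneg _, wlt s hs⟩
  have winj : ∀ s ∈ Icc (0 : ℝ) 1, ∀ s' ∈ Icc (0 : ℝ) 1, ‖w s‖ = ‖w s'‖ → s = s' := by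
    intro s hs s' hs' e
    have h1 := wsq s
    rw [e, wsq] at h1
    have h2 : (s' * σ) ^ 2 = (s * σ) ^ 2 := by linarith
    have h3 := (sq_eq_sq₀ (mul_nonneg hs'.1 hσ.le) (mul_nonneg hs.1 hσ.le)).1 h2
    exact (mul_right_cancel₀ hσ.ne' h3).symm
  have wslit : ∀ s, w s ∈ Complex.slitPlane := fun s => Or.inl (by rw [wre]; exact ht)
  have warg : ∀ s ∈ Icc (0 : ℝ) 1, l * (w s).arg ∈ Ico 0 (φ / 2) := by
    intro s hs
    have h1 : 0 ≤ (w s).arg := Complex.arg_nonneg_iff.2 (by rw [wim]; exact mul_nonneg hs.1 hσ.le)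
    have h2 := (abs_lt.1 (Complex.abs_arg_lt_pi_div_two_iff.2
      (Or.inl (by rw [wre]; exact ht : 0 < (w s).re)))).2
    exact ⟨mul_nonneg hl.le h1, by nlinarith⟩
  have hφ : 0 < φ := hpi.trans_le h.pi_le
  have wω : ∀ s ∈ Icc (0 : ℝ) 1, l * (w s).arg ∈ Icc 0 φ := fun s hs =>
    ⟨(warg s hs).1, by linarith [(warg s hs).2]⟩
  set c : ℝ → S := fun s => P ‖w s‖ (l * (w s).arg) with hc
  have hinj : InjOn c (Icc 0 1) := fun s hs s' hs' e =>
    winj s hs s' hs' (h.radius_eq (wmem s hs) (wmem s' hs') (wω s hs) (wω s' hs') e)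
  have hreg : ∀ s ∈ Icc (0 : ℝ) 1, c s ∉ M.sing := fun s hs =>
    h.notMem_sing (wpos s) (wlt s hs) (wω s hs)
  -- the local coordinate at the parameter `s₀`
  set ω₀ : ℝ → ℝ := fun s => l * (w s).arg with hω₀
  set W : ℝ → Set ℂ := fun s₀ => {z | 0 < z.re ∧ ‖z‖ < R ∧ ω₀ s₀ + z.arg ∈ Icc 0 φ} with hW
  set F : ℝ → ℂ → S := fun s₀ z => P ‖z‖ (ω₀ s₀ + z.arg) with hF
  -- The curve read in the planar sector centred on its own angle at s₀: the modulus of w is kept,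
  -- its argument is multiplied by l and shifted. Writing this with `Complex.log` makes it visibly
  -- C¹, with logarithmic derivative `d`.
  set Z : ℝ → ℝ → ℂ := fun s₀ s => Complex.exp ((Complex.log (w s)).re +
    (l * (Complex.log (w s)).im - ω₀ s₀ : ℝ) * Complex.I) with hZ
  have hFW : ∀ s₀, ∀ z ∈ W s₀, ∀ w ∈ W s₀, dist (F s₀ z) (F s₀ w) = dist z w := by
    intro s₀ z hz z' hz'
    refine h.dist_eq hz.2.1 hz'.2.1 hz.2.2 hz'.2.2 ?_
    have h1 := abs_lt.1 (Complex.abs_arg_lt_pi_div_two_iff.2 (Or.inl hz.1))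
    have h2 := abs_lt.1 (Complex.abs_arg_lt_pi_div_two_iff.2 (Or.inl hz'.1))
    rw [abs_le]; constructor <;> linarith [h1.1, h1.2, h2.1, h2.2]
  have Znorm : ∀ s₀ s, ‖Z s₀ s‖ = ‖w s‖ := by
    intro s₀ s
    simp only [hZ]
    rw [Complex.norm_exp]
    simp [Real.exp_log (wpos s), Complex.log_re]
  have wderiv : ∀ s, HasDerivAt w (σ * Complex.I) s := by
    intro s
    have h1 : HasDerivAt (fun s : ℝ => ((s * σ : ℝ) : ℂ)) (σ : ℂ) s := by
      simpa using ((hasDerivAt_id s).mul_const σ).ofReal_comp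
    exact (h1.mul_const Complex.I).const_add (t : ℂ)
  have wcont : ContDiff ℝ 1 w := by
    have h1 : ContDiff ℝ 1 (fun s : ℝ => ((s * σ : ℝ) : ℂ)) :=
      Complex.ofRealCLM.contDiff.comp (contDiff_id.mul contDiff_const)
    exact contDiff_const.add (h1.mul contDiff_const)
  have lderiv : ∀ s, HasDerivAt (fun s => Complex.log (w s)) (σ * Complex.I / w s) s := fun s =>
    (wderiv s).clog_real (wslit s)
  have lcont : ∀ s, ContDiffAt ℝ 1 (fun s => Complex.log (w s)) s := fun s =>
    ((Complex.contDiffAt_log (wslit s)).restrict_scalars ℝ).comp s wcont.contDiffAt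
  have Zcont : ∀ s₀ s, ContDiffAt ℝ 1 (Z s₀) s := by
    intro s₀ s
    have h1 : ContDiffAt ℝ 1 (fun s => ((Complex.log (w s)).re : ℂ)) s :=
      (Complex.ofRealCLM.contDiff.comp Complex.reCLM.contDiff).contDiffAt.comp s (lcont s)
    have h2 : ContDiffAt ℝ 1 (fun s => (Complex.log (w s)).im) s :=
      Complex.imCLM.contDiff.contDiffAt.comp s (lcont s)
    have h3 : ContDiffAt ℝ 1 (fun s => ((l * (Complex.log (w s)).im - ω₀ s₀ : ℝ) : ℂ)) s :=
      Complex.ofRealCLM.contDiff.contDiffAt.comp s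
        ((contDiffAt_const.mul h2).sub contDiffAt_const)
    exact (h1.add (h3.mul contDiffAt_const)).cexp
  set d : ℝ → ℂ := fun s => ((σ * Complex.I / w s).re : ℝ) +
    (l * (σ * Complex.I / w s).im : ℝ) * Complex.I with hd
  have Zderiv : ∀ s₀ s, HasDerivAt (Z s₀) (Z s₀ s * d s) s := by
    intro s₀ s
    have h1 : HasDerivAt (fun s => ((Complex.log (w s)).re : ℂ))
        ((σ * Complex.I / w s).re : ℝ) s := by
      exact (Complex.ofRealCLM.comp Complex.reCLM).hasFDerivAt.comp_hasDerivAt s (lderiv s)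
    have h2 : HasDerivAt (fun s => (Complex.log (w s)).im) (σ * Complex.I / w s).im s :=
      Complex.imCLM.hasFDerivAt.comp_hasDerivAt s (lderiv s)
    have h3 : HasDerivAt (fun s => ((l * (Complex.log (w s)).im - ω₀ s₀ : ℝ) : ℂ))
        ((l * (σ * Complex.I / w s).im : ℝ) : ℂ) s :=
      ((h2.const_mul l).sub_const _).ofReal_comp
    exact (h1.add (h3.mul_const Complex.I)).cexp
  have dim : ∀ s, 0 < (d s).im := by
    intro s
    simp only [hd, Complex.add_im, Complex.ofReal_im, zero_add, Complex.im_ofReal_mul,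
      Complex.I_im, mul_one]
    refine mul_pos hl ?_
    rw [Complex.div_im]
    have h1 : 0 < Complex.normSq (w s) := Complex.normSq_pos.2 (wne s)
    simp only [Complex.re_ofReal_mul, Complex.im_ofReal_mul, Complex.I_re, Complex.I_im, wre]
    have : 0 < σ * t / Complex.normSq (w s) := by positivity
    simpa using this
  have Zne : ∀ s₀ s, Z s₀ s * d s ≠ 0 := by
    intro s₀ s
    refine mul_ne_zero (Complex.exp_ne_zero _) fun e => ?_
    have := dim s
    rw [e, Complex.zero_im] at this
    exact lt_irrefl _ this
  have Zmem : ∀ s₀ ∈ Icc (0 : ℝ) 1, ∀ᶠ s in 𝓝 s₀, s ∈ Icc (0 : ℝ) 1 →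
      Z s₀ s ∈ W s₀ ∧ c s = F s₀ (Z s₀ s) := by
    intro s₀ hs₀
    have hcont : ContinuousAt (fun s => |l * (Complex.log (w s)).im - ω₀ s₀|) s₀ := by
      have h2 : ContinuousAt (fun s => (Complex.log (w s)).im) s₀ :=
        Complex.continuous_im.continuousAt.comp (lcont s₀).continuousAt
      exact ((continuousAt_const.mul h2).sub continuousAt_const).abs
    have hev : ∀ᶠ s in 𝓝 s₀, |l * (Complex.log (w s)).im - ω₀ s₀| < Real.pi / 2 :=
      hcont.eventually_lt continuousAt_const (by
        simp only [hω₀, Complex.log_im, sub_self, abs_zero]; linarith)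
    filter_upwards [hev] with s hs hs'
    rw [abs_lt] at hs
    have harg : (Z s₀ s).arg = l * (w s).arg - ω₀ s₀ := by
      rw [← Complex.log_im]
      simp only [hZ]
      rw [Complex.log_exp]
      · simp [Complex.log_im]
      · simp only [Complex.add_im, Complex.ofReal_im, Complex.im_ofReal_mul, Complex.I_im]
        linarith
      · simp only [Complex.add_im, Complex.ofReal_im, Complex.im_ofReal_mul, Complex.I_im]
        linarith
    have hsum : ω₀ s₀ + (Z s₀ s).arg = l * (w s).arg := by rw [harg]; ring
    have hre : 0 < (Z s₀ s).re := by
      have h1 : |(Z s₀ s).arg| < Real.pi / 2 := by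
        rw [harg, ← Complex.log_im, abs_lt]; exact hs
      rcases Complex.abs_arg_lt_pi_div_two_iff.1 h1 with h2 | h2
      · exact h2
      · exact absurd h2 (Complex.exp_ne_zero _)
    refine ⟨⟨hre, by rw [Znorm]; exact wlt s hs', by rw [hsum]; exact wω s hs'⟩, ?_⟩
    simp only [hF, hc]
    rw [hsum, Znorm]
  have Zself : ∀ s, Z s s = (‖w s‖ : ℝ) := by
    intro s
    simp only [hZ, hω₀]
    rw [Complex.log_im, sub_self, Complex.ofReal_zero, zero_mul, add_zero, Complex.log_re,
      ← Complex.ofReal_exp, Real.exp_log (wpos s)]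
  have hC : IsC1On M c 0 1 := by
    refine ⟨fun s hs => hreg s (Ioo_subset_Icc_self hs), fun s hs => ?_⟩
    obtain ⟨m1, m2⟩ := (Zmem s hs).self_of_nhds hs
    refine exists_c1_coord (c := c) (F := F s) (W := W s) (Z := Z s) (Z' := Z s s * d s) hs
      (hreg s hs) m1 m2.symm (hFW s) ?_ (Zcont s s).contDiffWithinAt
      (Zderiv s s).hasDerivWithinAt (Zne s s) ?_
    · have hpos := wpos s
      have e1 : ∀ᶠ r : ℝ in 𝓝[>] 0, ‖w s‖ + r < R := by
        have : ∀ᶠ r : ℝ in 𝓝 0, ‖w s‖ + r < R :=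
          (continuous_const.add continuous_id).continuousAt.eventually_lt continuousAt_const
            (by simpa using wlt s hs)
        exact nhdsWithin_le_nhds this
      have e2 : ∀ᶠ r : ℝ in 𝓝[>] 0, Complex.arg ((‖w s‖ : ℝ) + r * Complex.I) < φ / 2 := by
        have hcont : ContinuousAt (fun r : ℝ => Complex.arg ((‖w s‖ : ℝ) + r * Complex.I)) 0 := by
          refine ContinuousAt.comp (g := Complex.arg) (Complex.continuousAt_arg ?_) (by fun_prop)
          left; simpa using wne s
        have : ∀ᶠ r : ℝ in 𝓝 0, Complex.arg ((‖w s‖ : ℝ) + r * Complex.I) < φ / 2 :=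
          hcont.eventually_lt continuousAt_const (by
            simp only [Complex.ofReal_zero, zero_mul, add_zero]
            rw [Complex.arg_ofReal_of_nonneg hpos.le]; linarith)
        exact nhdsWithin_le_nhds this
      filter_upwards [e1, e2, self_mem_nhdsWithin] with r h1 h2 h3
      have h3' : (0 : ℝ) < r := h3
      have hω := warg s hs
      rw [Zself]
      refine ⟨⟨by simp; linarith, ?_, ?_⟩, ⟨by simpa using wne s, ?_, ?_⟩⟩
      · rw [← Complex.ofReal_add, Complex.norm_real, Real.norm_eq_abs, abs_of_pos (by linarith)]
        exact h1
      · rw [← Complex.ofReal_add, Complex.arg_ofReal_of_nonneg (by linarith), add_zero]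
        exact wω s hs
      · refine (norm_add_le _ _).trans_lt ?_
        rw [norm_mul, Complex.norm_real, Complex.norm_real, Complex.norm_I, Real.norm_eq_abs,
          Real.norm_eq_abs, abs_of_pos hpos, abs_of_pos h3', mul_one]
        exact h1
      · have h4 : 0 ≤ Complex.arg ((‖w s‖ : ℝ) + r * Complex.I) :=
          Complex.arg_nonneg_iff.2 (by simpa using h3'.le)
        exact ⟨add_nonneg hω.1 h4, by simp only [hω₀]; linarith [hω.2]⟩
    · filter_upwards [self_mem_nhdsWithin, nhdsWithin_le_nhds (Zmem s hs)] with s' h1 h2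
      exact h2 h1
  have hcont : ContinuousOn c (Icc 0 1) := by
    intro s hs
    obtain ⟨m1, m2⟩ := (Zmem s hs).self_of_nhds hs
    have hZc := (Zcont s s).continuousAt
    rw [ContinuousWithinAt, Metric.tendsto_nhds]
    intro ε hε
    filter_upwards [self_mem_nhdsWithin, nhdsWithin_le_nhds (Zmem s hs),
      nhdsWithin_le_nhds (Metric.tendsto_nhds.1 hZc ε hε)] with s' h1 h2 h3
    obtain ⟨n1, n2⟩ := h2 h1
    rw [m2, n2, hFW s _ n1 _ m1]
    exact h3
  have hβ := fun s hs => mkArc_ext (hc := hcont) (hinj := hinj) (hC := hC) (s := s) hs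
  have m0 : (0 : ℝ) ∈ Icc (0 : ℝ) 1 := ⟨le_rfl, zero_le_one⟩
  refine ⟨mkArc c hcont hinj hC, hβ, mkArc_transverseTo fun s hs u hu e => ?_⟩
  -- For s > 0 the polar angle is strictly between 0 and φ, so the arc can meet g only at its foot.
  have hs0 : s = 0 := by
    by_contra hne
    have hspos : 0 < s := lt_of_le_of_ne hs.1 (Ne.symm hne)
    refine h.notMem_axis hυ hp hm (wpos s) (wlt s hs) ⟨?_, ?_⟩ (hI u hu) e
    · refine mul_pos hl (lt_of_le_of_ne (Complex.arg_nonneg_iff.2 ?_) fun e' => ?_)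
      · rw [wim]; exact mul_nonneg hs.1 hσ.le
      · have := (Complex.arg_eq_zero_iff.1 e'.symm).2
        rw [wim] at this
        exact (mul_pos hspos hσ).ne' this
    · linarith [(warg s hs).2]
  subst hs0
  have hυ1 : |υ| = 1 := by rcases hυ with rfl | rfl <;> norm_num
  have ht' : t < R := by linarith
  have hc0 : c 0 = P t 0 := by
    simp only [hc, w0]
    rw [Complex.norm_real, Real.norm_eq_abs, abs_of_pos ht, Complex.arg_ofReal_of_nonneg ht.le,
      mul_zero]
  have hu' : u = t₀ + υ * t := by
    rw [hc0, ← hp t ⟨ht.le, ht'⟩] at e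
    have := hg u (t₀ + υ * t) (hI u hu) (by
      rw [add_sub_cancel_left, abs_mul, hυ1, one_mul, abs_of_pos ht]; exact ht')
    rw [e, dist_self] at this
    linarith [abs_eq_zero.1 this.symm]
  have hval : g u = (mkArc c hcont hinj hC).ext 0 := by rw [hβ 0 m0, e]
  have hω0 : ω₀ 0 = 0 := by
    simp only [hω₀, w0]; rw [Complex.arg_ofReal_of_nonneg ht.le, mul_zero]
  have hn0 : ‖w 0‖ = t := by rw [w0, Complex.norm_real, Real.norm_eq_abs, abs_of_pos ht]
  obtain ⟨q1, q2⟩ := (Zmem 0 m0).self_of_nhds m0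
  rw [Zself, hn0] at q1 q2
  refine Arc.not_tangentAt_zero (F := F 0) (W := W 0) (Z := Z 0) (d := Z 0 0 * d 0)
    (z₀ := (t : ℝ)) (c := υ) (ε := R - t) hval (by linarith) ?_ (hFW 0) ?_ q1 ?_ ?_
    (Zderiv 0 0).hasDerivWithinAt (by rw [Zself, hn0]) ?_
  · have hle : ∀ v, |v - u| < R - t → |v - t₀| < R := by
      intro v hv
      have h1 : |u - t₀| = t := by
        rw [hu', add_sub_cancel_left, abs_mul, hυ1, one_mul, abs_of_pos ht]
      have := abs_sub_le v u t₀
      linarith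
    exact fun v v' hv hv' => hg v v' (hle v hv) (hle v' hv')
  · have h1 : ∀ᶠ s in 𝓝[>] (0 : ℝ), s ∈ Ioo (0 : ℝ) 1 := Ioo_mem_nhdsGT one_pos
    filter_upwards [h1, nhdsWithin_le_nhds (Zmem 0 m0)] with s h2 h3
    have h4 : s ∈ Icc (0 : ℝ) 1 := Ioo_subset_Icc_self h2
    rw [hβ s h4]
    exact h3 h4
  · rw [hβ 0 m0, q2]
  · have hev : ∀ᶠ v : ℝ in 𝓝 0, t + υ * v ∈ Ioo 0 R := by
      have hcont : Continuous fun v : ℝ => t + υ * v := by fun_prop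
      exact hcont.continuousAt.eventually_mem (isOpen_Ioo.mem_nhds (by
        simp only [mul_zero, add_zero]; exact ⟨ht, ht'⟩))
    filter_upwards [hev] with v hv
    rw [← Complex.ofReal_add]
    refine ⟨⟨by rw [Complex.ofReal_re]; exact hv.1, ?_, ?_⟩, ?_⟩
    · rw [Complex.norm_real, Real.norm_eq_abs, abs_of_pos hv.1]; exact hv.2
    · rw [Complex.arg_ofReal_of_nonneg hv.1.le, hω0, add_zero]; exact ⟨le_rfl, hφ.le⟩
    · have hυ' : υ * υ = 1 := by rcases hυ with rfl | rfl <;> norm_num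
      simp only [hF]
      rw [Complex.arg_ofReal_of_nonneg hv.1.le, hω0, add_zero, Complex.norm_real,
        Real.norm_eq_abs, abs_of_pos hv.1, ← hp _ ⟨hv.1.le, hv.2⟩, hu']
      congr 1; linear_combination (-v) * hυ'
  · rw [Zself, Complex.im_ofReal_mul]
    exact (mul_pos (wpos 0) (dim 0)).ne'

/-- The bisector of a sector, as an arc. -/
lemma IsSector.exists_arc_zero (h : IsSector M x P R φ) {g : ℝ → S} {t₀ : ℝ}
    (hg : ∀ s s', |s - t₀| < R → |s' - t₀| < R → dist (g s) (g s') = |s - s'|)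
    (hp : ∀ u ∈ Ico 0 R, g (t₀ + u) = P u 0) (hm : ∀ u ∈ Ico 0 R, g (t₀ - u) = P u φ)
    {I : Set ℝ} (hI : ∀ u ∈ I, |u - t₀| < R) {σ : ℝ} (hσ : 0 < σ) (hσR : σ < R) :
    ∃ β : Arc M, (∀ s ∈ Icc (0 : ℝ) 1, β.ext s = P (s * σ) (φ / 2)) ∧ β.TransverseTo g I := by
  have hpi := Real.pi_pos
  have hφ : 0 < φ := hpi.trans_le h.pi_le
  have hmid : φ / 2 ∈ Icc 0 φ := ⟨by linarith, by linarith⟩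
  have hmem : ∀ s ∈ Icc (0 : ℝ) 1, s * σ ∈ Ico 0 R := fun s hs =>
    ⟨mul_nonneg hs.1 hσ.le, by nlinarith [hs.2]⟩
  set c : ℝ → S := fun s => P (s * σ) (φ / 2) with hc
  have hdist : ∀ s ∈ Icc (0 : ℝ) 1, ∀ s' ∈ Icc (0 : ℝ) 1, dist (c s) (c s') = |s - s'| * σ := by
    intro s hs s' hs'
    simp only [hc]
    rw [h.iso _ (hmem s hs) _ (hmem s' hs') _ hmid _ hmid, sub_self, abs_zero, coneDist_zero_right,
      ← sub_mul, abs_mul, abs_of_pos hσ]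
  have hinj : InjOn c (Icc 0 1) := by
    intro s hs s' hs' e
    have := hdist s hs s' hs'
    rw [e, dist_self, eq_comm, mul_eq_zero, or_iff_left hσ.ne', abs_eq_zero] at this
    linarith
  have hcont : ContinuousOn c (Icc 0 1) := by
    intro s hs
    rw [Metric.continuousWithinAt_iff]
    refine fun ε hε => ⟨ε / σ, by positivity, fun s' hs' hlt => ?_⟩
    rw [hdist s' hs' s hs, ← lt_div_iff₀ hσ]
    exact hlt
  have hx : c 0 = x := by simp only [hc, zero_mul]; exact h.zero _ hmid
  have m0 : (0 : ℝ) ∈ Icc (0 : ℝ) 1 := ⟨le_rfl, zero_le_one⟩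
  have hC : IsC1On M c 0 1 := by
    refine ⟨fun s hs => h.notMem_sing (mul_pos hs.1 hσ) (hmem s (Ioo_subset_Icc_self hs)).2 hmid,
      fun s hs => ?_⟩
    -- At s = 0 the arc may start from a singularity, and the coordinate is the polar chart at x, in
    -- which a radius is a straight line. Transversality asks for no topological crossing there,
    -- since this is an end point of the arc.
    rcases hs.1.eq_or_lt with hs0 | hs0
    · subst hs0
      obtain ⟨θ, hθ, H⟩ := exists_angle_of_isometric_ray (M := M) (x := x)
        (c := fun r => c (r / σ)) hσ (by simpa using hx) (fun r hr r' hr' => by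
          have key : ∀ r ∈ Ico 0 σ, r / σ ∈ Icc (0 : ℝ) 1 := fun r hr =>
            ⟨div_nonneg hr.1 hσ.le, (div_le_one hσ).2 hr.2.le⟩
          rw [hdist _ (key r hr) _ (key r' hr'), ← sub_div, abs_div, abs_of_pos hσ]
          field_simp)
      refine ⟨fun s => polarPt (s * σ) θ, ?_, ?_, ?_⟩
      · have : ContDiff ℝ 1 fun s : ℝ => polarPt (s * σ) θ := by
          have h1 : ContDiff ℝ 1 (fun s : ℝ => ((s * σ : ℝ) : ℂ)) :=
            Complex.ofRealCLM.contDiff.comp (contDiff_id.mul contDiff_const)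
          exact h1.mul contDiff_const
        exact this.contDiffWithinAt
      · have h1 : HasDerivAt (fun s : ℝ => ((s * σ : ℝ) : ℂ)) (σ : ℂ) 0 := by
          simpa using ((hasDerivAt_id (0 : ℝ)).mul_const σ).ofReal_comp
        have h2 : HasDerivAt (fun s : ℝ => polarPt (s * σ) θ)
          (σ * Complex.exp ((θ : ℂ) * Complex.I)) 0 := h1.mul_const _
        rw [h2.hasDerivWithinAt.derivWithin (uniqueDiffOn_Icc zero_lt_one 0 hs)]
        exact mul_ne_zero (by exact_mod_cast hσ.ne') (Complex.exp_ne_zero _)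
      · have hlt : ∀ᶠ s in 𝓝[Icc (0 : ℝ) 1] 0, s < 1 := by
          exact nhdsWithin_le_nhds (Iio_mem_nhds one_pos)
        filter_upwards [self_mem_nhdsWithin, hlt] with s h1 h2
        have h3 : 0 ≤ s * σ := mul_nonneg h1.1 hσ.le
        have h4 : s * σ < σ := by nlinarith
        have hn : ‖polarPt (s * σ) θ‖ = s * σ := by rw [norm_polarPt, abs_of_nonneg h3]
        have h5 : s * σ < M.rad x := h4.trans (hσR.trans_le h.le_rad)
        rw [hx]
        refine ⟨by rwa [hn], θ, hθ, by rw [hn], ?_⟩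
        rw [hn, ← H (s * σ) ⟨h3, h4⟩ h5, mul_div_cancel_right₀ _ hσ.ne']
    · have hsσ : 0 < s * σ := mul_pos hs0 hσ
      set W : Set ℂ := {z | 0 < z.re ∧ ‖z‖ < R ∧ φ / 2 + z.arg ∈ Icc 0 φ} with hW
      have hreal : ∀ r : ℝ, 0 < r → r < R → (r : ℂ) ∈ W := by
        intro r h0 h1
        refine ⟨by simpa using h0, ?_, ?_⟩
        · rwa [Complex.norm_real, Real.norm_eq_abs, abs_of_pos h0]
        · rwa [Complex.arg_ofReal_of_nonneg h0.le, add_zero]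
      have hval : ∀ r : ℝ, 0 < r → P ‖(r : ℂ)‖ (φ / 2 + (r : ℂ).arg) = P r (φ / 2) := by
        intro r h0
        rw [Complex.norm_real, Real.norm_eq_abs, abs_of_pos h0,
          Complex.arg_ofReal_of_nonneg h0.le, add_zero]
      refine exists_c1_coord (c := c) (F := fun z => P ‖z‖ (φ / 2 + z.arg)) (W := W)
        (Z := fun s => ((s * σ : ℝ) : ℂ)) (Z' := σ) hs
        (h.notMem_sing hsσ (hmem s hs).2 hmid) (hreal _ hsσ (hmem s hs).2) (hval _ hsσ)
        ?_ ?_ ?_ ?_ (by exact_mod_cast hσ.ne') ?_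
      · intro z hz z' hz'
        refine h.dist_eq hz.2.1 hz'.2.1 hz.2.2 hz'.2.2 ?_
        have h1 := abs_lt.1 (Complex.abs_arg_lt_pi_div_two_iff.2 (Or.inl hz.1))
        have h2 := abs_lt.1 (Complex.abs_arg_lt_pi_div_two_iff.2 (Or.inl hz'.1))
        rw [abs_le]; constructor <;> linarith [h1.1, h1.2, h2.1, h2.2]
      · have e1 : ∀ᶠ r : ℝ in 𝓝[>] 0, r < R - s * σ :=
          nhdsWithin_le_nhds (Iio_mem_nhds (by linarith [(hmem s hs).2]))
        filter_upwards [e1, self_mem_nhdsWithin] with r h1 h3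
        have h3' : (0 : ℝ) < r := h3
        refine ⟨?_, ?_, ?_, ?_⟩
        · rw [← Complex.ofReal_add]
          exact hreal _ (by linarith) (by linarith)
        · simpa using hsσ
        · refine (norm_add_le _ _).trans_lt ?_
          rw [norm_mul, Complex.norm_real, Complex.norm_real, Complex.norm_I, Real.norm_eq_abs,
            Real.norm_eq_abs, abs_of_pos hsσ, abs_of_pos h3', mul_one]
          linarith
        · have h4 : 0 ≤ Complex.arg ((s * σ : ℝ) + r * Complex.I) :=
            Complex.arg_nonneg_iff.2 (by simpa using h3'.le)
          have h5 := (abs_lt.1 (Complex.abs_arg_lt_pi_div_two_iff.2 (Or.inl (by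
            simpa using hsσ : 0 < ((s * σ : ℝ) + r * Complex.I : ℂ).re)))).2
          exact ⟨by linarith, by linarith [h.pi_le]⟩
      · exact (Complex.ofRealCLM.contDiff.comp
          (contDiff_id.mul contDiff_const)).contDiffWithinAt
      · exact (by simpa using ((hasDerivAt_id s).mul_const σ).ofReal_comp :
          HasDerivAt (fun s : ℝ => ((s * σ : ℝ) : ℂ)) (σ : ℂ) s).hasDerivWithinAt
      · filter_upwards [self_mem_nhdsWithin, nhdsWithin_le_nhds (Ioi_mem_nhds hs0)] with s' h1 h2
        have h3 : 0 < s' * σ := mul_pos h2 hσ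
        exact ⟨hreal _ h3 (hmem s' h1).2, (hval _ h3).symm⟩
  have hβ := fun s hs => mkArc_ext (hc := hcont) (hinj := hinj) (hC := hC) (s := s) hs
  refine ⟨mkArc c hcont hinj hC, hβ, mkArc_transverseTo fun s hs u hu e htan => ?_⟩
  have hs0 : s = 0 := by
    by_contra hne
    have hspos : 0 < s := lt_of_le_of_ne hs.1 (Ne.symm hne)
    refine h.notMem_axis (υ := 1) (Or.inl rfl) (by simpa using hp) (by simpa using hm)
      (mul_pos hspos hσ) (hmem s hs).2 ⟨by linarith, by linarith⟩ (hI u hu) e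
  subst hs0
  have hR := h.pos
  have hgx : g t₀ = x := by
    have := hp 0 ⟨le_rfl, hR⟩
    rw [add_zero, h.zero 0 ⟨le_rfl, hφ.le⟩] at this; exact this
  have hu' : u = t₀ := by
    rw [hx, ← hgx] at e
    have := hg u t₀ (hI u hu) (by simpa using hR)
    rw [e, dist_self] at this
    linarith [abs_eq_zero.1 this.symm]
  subst hu'
  obtain ⟨ς, hς, υ, hυ, -, hd, hδ⟩ := htan.eventually_dist_le (by rw [hβ 0 m0, e]) hR hg
  have hev := hd.eventually (Ioo_mem_nhdsGT hR)
  obtain ⟨v, ⟨hv1, hv2⟩⟩ := ((hδ 1 one_pos).and hev).exists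
  obtain ⟨s, hs, hs'⟩ := Arc.exists_ext_of_mem_image
    ((mkArc c hcont hinj hC).ext_mem_image (0 + ς * v))
  rw [← hs', hβ s hs, hβ 0 m0, hdist 0 m0 s hs, zero_sub, abs_neg, abs_of_nonneg hs.1] at hv1 hv2
  -- The bisector makes an angle φ/2 ≥ π/2 with both sides of the sector, so at equal radius ρ the
  -- arc and g are at distance at least √2 ρ; tangency would make it at most ρ.
  have key : ∀ a ∈ Icc 0 φ, Real.pi / 2 ≤ |φ / 2 - a| → g (u + υ * (s * σ)) = P (s * σ) a →
      False := by
    intro a ha hle hga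
    rw [hga] at hv1
    simp only [hc] at hv1
    rw [h.iso _ (hmem s hs) _ (hmem s hs) _ hmid _ ha, one_mul] at hv1
    have h1 := coneDist_sq (φ := |φ / 2 - a|) (hmem s hs).1 (hmem s hs).1
    have h2 : Real.cos (min |φ / 2 - a| Real.pi) ≤ 0 :=
      Real.cos_nonpos_of_pi_div_two_le_of_le (le_min hle (by linarith))
        ((min_le_right _ _).trans (by linarith))
    have h3 : 0 ≤ coneDist (s * σ) (s * σ) |φ / 2 - a| := Real.sqrt_nonneg _
    have h4 : 0 < s * σ := hv2.1
    nlinarith [mul_pos h4 h4]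
  have hpi' := h.pi_le
  rcases hυ with rfl | rfl
  · refine key 0 ⟨le_rfl, hφ.le⟩ ?_ (by rw [one_mul]; exact hp _ (hmem s hs))
    rw [sub_zero, abs_of_pos (by linarith)]; linarith
  · refine key φ ⟨hφ.le, le_rfl⟩ ?_ (by rw [neg_one_mul, ← sub_eq_add_neg]; exact hm _ (hmem s hs))
    rw [abs_sub_comm, abs_of_pos (by linarith)]; linarith

end SectorArcs

/-! ### Sweeping past a singularity -/

section SectorSweep

open HalfTranslationSurface

variable {S E : Type*} [MetricSpace S] [MetricSpace E] {M : HalfTranslationSurface S} {p : E → S}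
  {x : S} {P : ℝ → ℝ → S} {R φ : ℝ}

/-- The argument of a point of the upper half plane. -/
noncomputable def upperArg (z : ℂ) : ℝ := Real.arccos (z.re / ‖z‖)

lemma upperArg_eq_arg {z : ℂ} (hz : z ≠ 0) (h : 0 ≤ z.im) : upperArg z = z.arg :=
  (Complex.arg_of_im_nonneg_of_ne_zero h hz).symm

lemma norm_neg_add_mul_I (t y : ℝ) :
    ‖((-t : ℝ) + y * Complex.I : ℂ)‖ = ‖(t + y * Complex.I : ℂ)‖ := by
  rw [← sq_eq_sq₀ (norm_nonneg _) (norm_nonneg _), norm_add_mul_I_sq, norm_add_mul_I_sq, neg_sq]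

lemma upperArg_neg (t y : ℝ) : upperArg ((-t : ℝ) + y * Complex.I) =
    Real.pi - upperArg (t + y * Complex.I) := by
  rw [upperArg, upperArg, norm_neg_add_mul_I, ← Real.arccos_neg]
  congr 1
  simp [neg_div]

lemma upperArg_nonneg (z : ℂ) : 0 ≤ upperArg z := Real.arccos_nonneg _

lemma upperArg_le_half {t y : ℝ} (ht : 0 ≤ t) : upperArg (t + y * Complex.I) ≤ Real.pi / 2 := by
  rw [upperArg, Real.arccos_le_pi_div_two]
  have : 0 ≤ (t + y * Complex.I : ℂ).re := by simpa using ht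
  positivity

/-- The factor by which the angles are expanded at the time `t`. -/
noncomputable def sweepFactor (φ v t : ℝ) : ℝ :=
  φ / Real.pi - (φ / Real.pi - 1) * (|t| / v)

/-- The angle of the arc swept at the time `t`. -/
noncomputable def sweepAngle (φ v t y : ℝ) : ℝ :=
  sweepFactor φ v t * upperArg (t + y * Complex.I) + (φ - Real.pi) * (max (-t) 0 / v)

/-- The factor decreases linearly in |t| from φ/π at t = 0, where the vertical half line becomes the
bisector, to 1 at |t| = v, where the swept arc is a genuine perpendicular to the leaf. The second
bound keeps the sweep inside the sector. -/
lemma sweepFactor_mem {v t : ℝ} (hφ : Real.pi ≤ φ) (hv : 0 < v) (ht : |t| ≤ v) :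
    1 ≤ sweepFactor φ v t ∧ sweepFactor φ v t * Real.pi ≤ φ := by
  have hpi := Real.pi_pos
  have h1 : 1 ≤ φ / Real.pi := (one_le_div hpi).2 hφ
  have h2 : |t| / v ≤ 1 := (div_le_one hv).2 ht
  have h3 : 0 ≤ |t| / v := by positivity
  have h4 : φ / Real.pi * Real.pi = φ := by field_simp
  unfold sweepFactor
  constructor
  · nlinarith
  · rw [sub_mul, h4]
    have : 0 ≤ (φ / Real.pi - 1) * (|t| / v) * Real.pi := by
      have : 0 ≤ φ / Real.pi - 1 := by linarith
      positivity
    linarith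

lemma sweepAngle_of_nonneg {v t y : ℝ} (ht : 0 ≤ t) :
    sweepAngle φ v t y = sweepFactor φ v t * upperArg (t + y * Complex.I) := by
  rw [sweepAngle, max_eq_right (by linarith)]; simp

/-- The correction term for t < 0 is chosen for this symmetry: the sweep before the singularity is
the sweep after it, seen in the reversed sector. -/
lemma sweepAngle_neg (v t y : ℝ) : sweepAngle φ v (-t) y = φ - sweepAngle φ v t y := by
  have hpi := Real.pi_pos
  have h1 : sweepFactor φ v (-t) = sweepFactor φ v t := by rw [sweepFactor, sweepFactor, abs_neg]
  have h2 : max (- -t) 0 + max (-t) 0 = |t| := by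
    rw [neg_neg]
    rcases le_total 0 t with h | h
    · rw [max_eq_left h, max_eq_right (by linarith), abs_of_nonneg h, add_zero]
    · rw [max_eq_right h, max_eq_left (by linarith), abs_of_nonpos h, zero_add]
  have h3 : max (- -t) 0 / v = |t| / v - max (-t) 0 / v := by rw [← h2]; ring
  rw [sweepAngle, upperArg_neg, h1, sweepAngle, h3, sweepFactor]
  field_simp
  ring

lemma sweepAngle_le_half {v t y : ℝ} (hφ : Real.pi ≤ φ) (hv : 0 < v) (ht : |t| ≤ v)
    (ht0 : 0 ≤ t) : sweepAngle φ v t y ∈ Icc 0 (φ / 2) := by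
  obtain ⟨h1, h2⟩ := sweepFactor_mem hφ hv ht
  rw [sweepAngle_of_nonneg ht0]
  have h3 := upperArg_le_half (y := y) ht0
  have h4 := upperArg_nonneg (t + y * Complex.I)
  exact ⟨by positivity, by nlinarith⟩

lemma half_le_sweepAngle {v t y : ℝ} (hφ : Real.pi ≤ φ) (hv : 0 < v) (ht : |t| ≤ v)
    (ht0 : t ≤ 0) : sweepAngle φ v t y ∈ Icc (φ / 2) φ := by
  have h := sweepAngle_le_half (y := y) hφ hv (t := -t) (by rwa [abs_neg]) (by linarith)
  rw [sweepAngle_neg] at h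
  exact ⟨by linarith [h.2], by linarith [h.1]⟩

lemma sweepAngle_mem {v t y : ℝ} (hφ : Real.pi ≤ φ) (hv : 0 < v) (ht : |t| ≤ v) :
    sweepAngle φ v t y ∈ Icc 0 φ := by
  have hpi := Real.pi_pos
  rcases le_total 0 t with h | h
  · have := sweepAngle_le_half (y := y) hφ hv ht h
    exact ⟨this.1, by linarith [this.2]⟩
  · have := half_le_sweepAngle (y := y) hφ hv ht h
    exact ⟨by linarith [this.1], this.2⟩

lemma sweepAngle_self {v y : ℝ} (hv : 0 < v) : sweepAngle φ v v y = upperArg (v + y * Complex.I) := by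
  rw [sweepAngle_of_nonneg hv.le, sweepFactor, abs_of_pos hv, div_self hv.ne']
  ring

/-- An arc swept before the final time is disjoint from the final one. -/
lemma sweepAngle_ne {v t y y' : ℝ} (hφ : Real.pi ≤ φ) (hv : 0 < v) (ht : |t| ≤ v) (htv : t < v)
    (hn : ‖(t + y * Complex.I : ℂ)‖ = ‖(v + y' * Complex.I : ℂ)‖) :
    sweepAngle φ v t y ≠ upperArg (v + y' * Complex.I) := by
  intro e
  have hpi := Real.pi_pos
  have hpos : 0 < ‖(v + y' * Complex.I : ℂ)‖ := by
    rw [norm_pos_iff]; intro h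
    have := congrArg Complex.re h
    simp at this; exact hv.ne' this
  have hre : (v + y' * Complex.I : ℂ).re = v := by simp
  have hre' : (t + y * Complex.I : ℂ).re = t := by simp
  have hlt : upperArg (v + y' * Complex.I) < Real.pi / 2 := by
    rw [upperArg, Real.arccos_lt_pi_div_two, hre]; positivity
  rcases le_or_gt t 0 with h0 | h0
  · have := (half_le_sweepAngle (y := y) hφ hv ht h0).1
    linarith
  · obtain ⟨h1, h2⟩ := sweepFactor_mem hφ hv ht
    have h4 := upperArg_nonneg (t + y * Complex.I)
    -- The factor is at least 1, so the undilated angle is no larger than the final one. At equal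
    -- modulus the angle decreases with the real part, which would give t ≥ v.
    have h5 : upperArg (t + y * Complex.I) ≤ upperArg (v + y' * Complex.I) := by
      rw [← e, sweepAngle_of_nonneg h0.le]; nlinarith
    have habs : ∀ z : ℂ, -1 ≤ z.re / ‖z‖ ∧ z.re / ‖z‖ ≤ 1 := by
      intro z
      rw [← abs_le, abs_div, abs_norm]
      exact div_le_one_of_le₀ (Complex.abs_re_le_norm z) (norm_nonneg _)
    rw [upperArg, upperArg, Real.strictAntiOn_arccos.le_iff_ge (habs _) (habs _),
      hn, hre, hre', div_le_div_iff_of_pos_right hpos] at h5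
    linarith

/-- The arcs which sweep a sector. -/
noncomputable def sectorSweep {S : Type*} (P : ℝ → ℝ → S) (φ v t y : ℝ) : S :=
  P ‖(t + y * Complex.I : ℂ)‖ (sweepAngle φ v t y)

lemma sectorSweep_reverse {S : Type*} (P : ℝ → ℝ → S) (φ v t y : ℝ) :
    sectorSweep (fun ρ ω => P ρ (φ - ω)) φ v t y = sectorSweep P φ v (-t) y := by
  simp only [sectorSweep]
  rw [norm_neg_add_mul_I, sweepAngle_neg]

lemma norm_add_mul_I_lt {t y v r : ℝ} (ht : |t| ≤ v) (hy : |y| < r - v) :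
    ‖(t + y * Complex.I : ℂ)‖ < r := by
  refine (norm_add_le _ _).trans_lt ?_
  rw [norm_mul, Complex.norm_I, Complex.norm_real, Complex.norm_real, Real.norm_eq_abs,
    Real.norm_eq_abs]
  linarith

lemma IsSector.sectorSweep_ne (h : IsSector M x P R φ) {v t y y' : ℝ} (hv : 0 < v) (ht : |t| ≤ v)
    (htv : t < v) (hy : |y| < R - v) (hy' : |y'| < R - v) :
    sectorSweep P φ v t y ≠ sectorSweep P φ v v y' := by
  intro e
  have hpos : 0 < ‖(v + y' * Complex.I : ℂ)‖ := by
    rw [norm_pos_iff]; intro h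
    have := congrArg Complex.re h
    simp at this; exact hv.ne' this
  have m1 : ‖(t + y * Complex.I : ℂ)‖ ∈ Ico 0 R := ⟨norm_nonneg _, norm_add_mul_I_lt ht hy⟩
  have m2 : ‖(v + y' * Complex.I : ℂ)‖ ∈ Ico 0 R :=
    ⟨norm_nonneg _, norm_add_mul_I_lt (abs_of_pos hv).le hy'⟩
  have a1 := sweepAngle_mem (y := y) h.pi_le hv ht
  have a2 := sweepAngle_mem (y := y') h.pi_le hv (abs_of_pos hv).le
  have hr := h.radius_eq m1 m2 a1 a2 e
  have ha := h.angle_eq (by rw [hr]; exact hpos) m1 m2 a1 a2 e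
  rw [sweepAngle_self hv] at ha
  exact sweepAngle_ne h.pi_le hv ht htv hr ha

/-- The angle is discontinuous at the apex, but in `coneDist_le` it is multiplied by the radius,
which is zero there. -/
lemma IsSector.continuousOn_sectorSweep (h : IsSector M x P R φ) {v : ℝ} (hv : 0 < v) :
    ContinuousOn (fun q : ℝ × ℝ => sectorSweep P φ v q.1 q.2)
      {q | |q.1| ≤ v ∧ |q.2| < R - v ∧ 0 ≤ q.2} := by
  rintro ⟨t₀, y₀⟩ ⟨ht₀, hy₀, hy₀'⟩
  set w : ℝ × ℝ → ℂ := fun q => q.1 + q.2 * Complex.I with hw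
  have hwc : Continuous w := by fun_prop
  have hA : Tendsto (fun q : ℝ × ℝ => ‖w (t₀, y₀)‖ * |sweepAngle φ v t₀ y₀ -
      sweepAngle φ v q.1 q.2|) (𝓝 (t₀, y₀)) (𝓝 0) := by
    by_cases h0 : w (t₀, y₀) = 0
    · simp [h0]
    · have hc : ContinuousAt (fun q : ℝ × ℝ => upperArg (w q)) (t₀, y₀) := by
        unfold upperArg
        refine Real.continuous_arccos.continuousAt.comp (ContinuousAt.div ?_ ?_ ?_)
        · exact (Complex.continuous_re.comp hwc).continuousAt
        · exact hwc.norm.continuousAt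
        · exact norm_ne_zero_iff.2 h0
      have hs : ContinuousAt (fun q : ℝ × ℝ => sweepAngle φ v q.1 q.2) (t₀, y₀) := by
        unfold sweepAngle sweepFactor
        have h1 : Continuous fun q : ℝ × ℝ => φ / Real.pi - (φ / Real.pi - 1) * (|q.1| / v) := by
          fun_prop
        have h2 : Continuous fun q : ℝ × ℝ => (φ - Real.pi) * (max (-q.1) 0 / v) := by fun_prop
        exact (h1.continuousAt.mul hc).add h2.continuousAt
      have : ContinuousAt (fun q : ℝ × ℝ => ‖w (t₀, y₀)‖ * |sweepAngle φ v t₀ y₀ -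
          sweepAngle φ v q.1 q.2|) (t₀, y₀) :=
        continuousAt_const.mul (continuousAt_const.sub hs).abs
      simpa [ContinuousAt] using this
  have hB : Tendsto (fun q : ℝ × ℝ => |‖w (t₀, y₀)‖ - ‖w q‖|) (𝓝 (t₀, y₀)) (𝓝 0) := by
    have : Continuous fun q : ℝ × ℝ => |‖w (t₀, y₀)‖ - ‖w q‖| := by fun_prop
    simpa using this.tendsto (t₀, y₀)
  have hsum := (hB.add hA).mono_left (nhdsWithin_le_nhds
    (s := {q : ℝ × ℝ | |q.1| ≤ v ∧ |q.2| < R - v ∧ 0 ≤ q.2}))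
  rw [add_zero] at hsum
  rw [ContinuousWithinAt, tendsto_iff_dist_tendsto_zero]
  refine squeeze_zero' (Eventually.of_forall fun _ => dist_nonneg) ?_ hsum
  filter_upwards [self_mem_nhdsWithin] with q hq
  rw [dist_comm]
  simp only [sectorSweep]
  rw [h.iso _ ⟨norm_nonneg _, norm_add_mul_I_lt ht₀ hy₀⟩ _
    ⟨norm_nonneg _, norm_add_mul_I_lt hq.1 hq.2.1⟩ _ (sweepAngle_mem h.pi_le hv ht₀) _
    (sweepAngle_mem h.pi_le hv hq.1)]
  exact coneDist_le (norm_nonneg _) (norm_nonneg _) (abs_nonneg _)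

lemma sectorSweep_axis {S : Type*} {P : ℝ → ℝ → S} {v t : ℝ} (ht : 0 < t) :
    sectorSweep P φ v t 0 = P t 0 := by
  rw [sectorSweep, sweepAngle_of_nonneg ht.le]
  simp [upperArg, abs_of_pos ht, ht.ne']

/-- The half disc with diameter on the side of a sector. -/
lemma IsSector.isFlatMap (h : IsSector M x P R φ) {v : ℝ} (hv : 0 < v) :
    IsFlatMap M (fun z => P ‖(v + z : ℂ)‖ (0 + Complex.arg (v + z))) (min v (R - v))
      {z | 0 ≤ z.im} := by
  have hpi := Real.pi_pos
  have hn : ∀ z : ℂ, ‖z‖ < min v (R - v) → ‖(v + z : ℂ)‖ < R := by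
    intro z hz
    refine (norm_add_le _ _).trans_lt ?_
    rw [Complex.norm_real, Real.norm_eq_abs, abs_of_pos hv]
    linarith [hz.trans_le (min_le_right _ _)]
  have ha : ∀ z : ℂ, 0 ≤ z.im → 0 ≤ Complex.arg (v + z) := by
    intro z hz; exact Complex.arg_nonneg_iff.2 (by simpa using hz)
  have ha' : ∀ z : ℂ, 0 ≤ z.im → 0 + Complex.arg (v + z) ∈ Icc 0 φ := by
    intro z hz
    rw [zero_add]
    exact ⟨ha z hz, (Complex.arg_le_pi _).trans h.pi_le⟩
  refine ⟨Or.inr rfl, fun z hz hz' w hw hw' => ?_, fun z hz hz' => ?_⟩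
  · rw [h.dist_eq (hn z hz') (hn w hw') (ha' z hz) (ha' w hw), dist_add_left]
    rw [abs_le]
    constructor <;>
      linarith [ha z hz, ha w hw, Complex.arg_le_pi (v + z), Complex.arg_le_pi (v + w)]
  · refine h.notMem_sing ?_ (hn z hz') (ha' z hz)
    rw [norm_pos_iff]
    intro e
    have : z = -(v : ℂ) := by linear_combination e
    rw [this, norm_neg, Complex.norm_real, Real.norm_eq_abs, abs_of_pos hv] at hz'
    exact lt_irrefl _ (hz'.trans_le (min_le_left _ _))

/-- Reflection in the imaginary axis: it keeps the half disc and reverses the sense in which its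
diameter is run. -/
lemma IsFlatMap.reflect {F : ℂ → S} (h : IsFlatMap M F R {z | 0 ≤ z.im}) :
    IsFlatMap M (fun z => F (-(starRingEnd ℂ) z)) R {z | 0 ≤ z.im} := by
  have hn : ∀ z : ℂ, ‖-(starRingEnd ℂ) z‖ = ‖z‖ := fun z => by rw [norm_neg, RCLike.norm_conj]
  have hi : ∀ z : ℂ, 0 ≤ z.im → 0 ≤ (-(starRingEnd ℂ) z).im := fun z hz => by simpa using hz
  refine ⟨Or.inr rfl, fun z hz hz' w hw hw' => ?_, fun z hz hz' =>
    h.regular _ (hi z hz) (by rwa [hn])⟩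
  rw [h.iso _ (hi z hz) (by rwa [hn]) _ (hi w hw) (by rwa [hn]), dist_eq_norm,
    neg_sub_neg, ← map_sub, RCLike.norm_conj, dist_comm, dist_eq_norm]

lemma sectorSweep_end {S : Type*} {P : ℝ → ℝ → S} {v y : ℝ} (hv : 0 < v) (hy : 0 ≤ y) : sectorSweep P φ v v y =
    P ‖(v + y * Complex.I : ℂ)‖ (0 + Complex.arg (v + y * Complex.I)) := by
  rw [sectorSweep, sweepAngle_self hv, zero_add, upperArg_eq_arg]
  · intro e
    have := congrArg Complex.re e
    simp at this; exact hv.ne' this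
  · simpa using hy

/-- The mass of a leaf is the same on the two sides of each of its points. -/
lemma IsSector.mass_eq (hp : IsIsometricUniversalCover p) (Λ : FlatLamination M p)
    (μ : TransverseMeasure M Λ.leaves) {g : LocalGeodesic S} (hg : g.cls ∈ Λ.leaves) {t₀ : ℝ}
    (h : IsSector M x P R φ) (hplus : ∀ u ∈ Ico 0 R, g (t₀ + u) = P u 0)
    (hminus : ∀ u ∈ Ico 0 R, g (t₀ - u) = P u φ)
    (hiso : ∀ s s', |s - t₀| < R → |s' - t₀| < R → dist (g s) (g s') = |s - s'|)
    {v : ℝ} (hv : 0 < v) (hvR : v < R) {m m' : ENNReal} (hm : HasMass μ g (t₀ - v) m)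
    (hm' : HasMass μ g (t₀ + v) m') : m = m' := by
  have hpi := Real.pi_pos
  have hR' : 0 < min v (R - v) := lt_min hv (by linarith)
  have hφ : 0 < φ := hpi.trans_le h.pi_le
  have hF₁ := h.isFlatMap hv
  -- The half disc before the singularity: the reversed sector runs g backwards, and the reflection
  -- restores its orientation.
  have hF₂ := (h.reverse.isFlatMap hv).reflect
  have hax : ∀ u : ℝ, |u| < min v (R - v) → 0 ≤ v + u ∧ v + u < R := by
    intro u hu
    have h1 := abs_lt.1 (hu.trans_le (min_le_left _ _))
    have h2 := abs_lt.1 (hu.trans_le (min_le_right _ _))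
    constructor <;> linarith [h1.1, h1.2, h2.1, h2.2]
  have hax₁ : ∀ u : ℝ, |u| < min v (R - v) →
      P ‖(v + u : ℂ)‖ (0 + Complex.arg (v + u)) = g (t₀ + v + u) := by
    intro u hu
    obtain ⟨h1, h2⟩ := hax u hu
    rw [← Complex.ofReal_add, Complex.norm_real, Real.norm_eq_abs, abs_of_nonneg h1,
      Complex.arg_ofReal_of_nonneg h1, add_zero, add_assoc, hplus _ ⟨h1, h2⟩]
  have hax₂ : ∀ u : ℝ, |u| < min v (R - v) →
      P ‖(v + -(starRingEnd ℂ) u : ℂ)‖ (φ - (0 + Complex.arg (v + -(starRingEnd ℂ) u))) =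
        g (t₀ - v + u) := by
    intro u hu
    obtain ⟨h1, h2⟩ := hax (-u) (by rwa [abs_neg])
    rw [Complex.conj_ofReal, ← Complex.ofReal_neg, ← Complex.ofReal_add, Complex.norm_real,
      Real.norm_eq_abs, abs_of_nonneg h1, Complex.arg_ofReal_of_nonneg h1, add_zero, sub_zero,
      ← hminus _ ⟨h1, h2⟩]
    congr 1; ring
  obtain ⟨σ₁, p₁, r₁, H₁⟩ := hF₁.exists_transverse_arc hp Λ hg hax₁ (a := 0) (by simpa using hR')
    norm_I_im.1 norm_I_im.2
  obtain ⟨σ₂, p₂, r₂, H₂⟩ := hF₂.exists_transverse_arc hp Λ hg hax₂ (a := 0) (by simpa using hR')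
    norm_I_im.1 norm_I_im.2
  -- Both end arcs must have the same length parameter σ, because they are the two ends of one
  -- sweep.
  set σ := min σ₁ σ₂ with hσdef
  have hσ : 0 < σ := lt_min p₁ p₂
  rw [abs_zero, zero_add] at r₁ r₂
  have hσR : σ < R - v := (min_le_left _ _).trans_lt (r₁.trans_le (min_le_right _ _))
  obtain ⟨α₂, T₂, x₂, i₂⟩ := H₁ σ ⟨hσ, min_le_left _ _⟩
  obtain ⟨α₁, T₁, x₁, i₁⟩ := H₂ σ ⟨hσ, min_le_right _ _⟩
  have seg₂ := hF₁.isTransverseSegment (a := 0) hax₁ hσ (by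
    rw [abs_zero, zero_add]; exact (min_le_left _ _).trans_lt r₁) norm_I_im.1 norm_I_im.2
  have seg₁ := hF₂.isTransverseSegment (a := 0) hax₂ hσ (by
    rw [abs_zero, zero_add]; exact (min_le_right _ _).trans_lt r₂) norm_I_im.1 norm_I_im.2
  rw [add_zero] at seg₁ seg₂
  rw [← hm α₁ T₁ _ _ seg₁ i₁.ge, ← hm' α₂ T₂ _ _ seg₂ i₂.ge]
  have hy : ∀ s ∈ Icc (0 : ℝ) 1, 0 ≤ s * σ ∧ |s * σ| < R - v := by
    intro s hs
    have h0 : 0 ≤ s * σ := mul_nonneg hs.1 hσ.le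
    refine ⟨h0, ?_⟩
    rw [abs_of_nonneg h0]; nlinarith [hs.2]
  have hE₂ : ∀ s ∈ Icc (0 : ℝ) 1, α₂.ext s = sectorSweep P φ v v (s * σ) := by
    intro s hs
    rw [x₂ s hs, sectorSweep_end hv (hy s hs).1]
    have e : ((0 : ℝ) : ℂ) + s * (σ * Complex.I) = ((s * σ : ℝ) : ℂ) * Complex.I := by
      push_cast; ring
    rw [e]
  have hE₁ : ∀ s ∈ Icc (0 : ℝ) 1, α₁.ext s = sectorSweep P φ v (-v) (s * σ) := by
    intro s hs
    rw [x₁ s hs, ← sectorSweep_reverse, sectorSweep_end hv (hy s hs).1]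
    have e : -(starRingEnd ℂ) (((0 : ℝ) : ℂ) + s * (σ * Complex.I)) =
        ((s * σ : ℝ) : ℂ) * Complex.I := by
      simp only [map_add, map_mul, Complex.conj_ofReal, Complex.conj_I]; push_cast; ring
    rw [e]
  have htime : ∀ τ ∈ Icc (0 : ℝ) 1, |-v + τ * (2 * v)| ≤ v := by
    intro τ hτ; rw [abs_le]; constructor <;> nlinarith [hτ.1, hτ.2]
  have f2 : ∀ s ∈ Icc (0 : ℝ) 1, ∀ t, |t| ≤ v → t < v →
      sectorSweep P φ v t (s * σ) ∉ α₂.image := by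
    intro s hs t ht htv hmem
    obtain ⟨s', hs', e⟩ := Arc.exists_ext_of_mem_image hmem
    rw [hE₂ s' hs'] at e
    exact h.sectorSweep_ne hv ht htv (hy s hs).2 (hy s' hs').2 e.symm
  have f1 : ∀ s ∈ Icc (0 : ℝ) 1, ∀ t, |t| ≤ v → -v < t →
      sectorSweep P φ v t (s * σ) ∉ α₁.image := by
    intro s hs t ht htv hmem
    obtain ⟨s', hs', e⟩ := Arc.exists_ext_of_mem_image hmem
    rw [hE₁ s' hs', ← sectorSweep_reverse, ← neg_neg t, ← sectorSweep_reverse] at e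
    exact h.reverse.sectorSweep_ne hv (by rwa [abs_neg]) (by linarith) (hy s hs).2 (hy s' hs').2
      e.symm
  set γ := g.shift (t₀ - v) with hγ
  have hγv : ∀ u, γ (v + u) = g (t₀ + u) := fun u => by
    rw [hγ, LocalGeodesic.shift_apply]; congr 1; ring
  have hγp : ∀ u ∈ Ico 0 R, γ (v + 1 * u) = P u 0 := fun u hu => by
    rw [one_mul, hγv, hplus u hu]
  have hγm : ∀ u ∈ Ico 0 R, γ (v - 1 * u) = P u φ := fun u hu => by
    rw [one_mul, sub_eq_add_neg, hγv, ← sub_eq_add_neg, hminus u hu]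
  have hγiso : ∀ s s', |s - v| < R → |s' - v| < R → dist (γ s) (γ s') = |s - s'| := by
    intro s s' hs hs'
    have e1 := hγv (s - v)
    have e2 := hγv (s' - v)
    rw [add_sub_cancel] at e1 e2
    rw [e1, e2, hiso _ _ (by rwa [add_sub_cancel_left]) (by rwa [add_sub_cancel_left])]
    congr 1; ring
  have hgx : ∀ ω ∈ Icc 0 φ, P 0 ω = γ v := by
    intro ω hω
    have := hγp 0 ⟨le_rfl, h.pos⟩
    rw [mul_zero, add_zero] at this
    rw [this, h.zero ω hω, h.zero 0 ⟨le_rfl, hφ.le⟩]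
  have hγax : ∀ t, |t| ≤ v → sectorSweep P φ v t 0 = γ (v + t) := by
    intro t ht
    rcases lt_trichotomy t 0 with h0 | h0 | h0
    · rw [← neg_neg t, ← sectorSweep_reverse, sectorSweep_axis (by linarith), sub_zero,
        ← hγm (-t) ⟨by linarith, by rw [← abs_of_neg h0]; linarith⟩]
      congr 1; ring
    · subst h0
      rw [add_zero, sectorSweep]
      have : ‖(((0 : ℝ) : ℂ) + ((0 : ℝ) : ℂ) * Complex.I)‖ = 0 := by simp
      rw [this]
      exact hgx _ (sweepAngle_mem h.pi_le hv ht)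
    · rw [sectorSweep_axis h0, ← hγp t ⟨h0.le, by rw [← abs_of_pos h0]; linarith⟩, one_mul]
  have m0 : (0 : ℝ) ∈ Icc (0 : ℝ) 1 := ⟨le_rfl, zero_le_one⟩
  have hI : ∀ u ∈ Icc 0 (2 * v), |u - v| < R := by
    intro u hu; rw [abs_lt]; constructor <;> linarith [hu.1, hu.2]
  have hres : g.shift (t₀ + v) = γ.shift (2 * v) := by
    rw [hγ, LocalGeodesic.shift_shift]; congr 1; ring
  rw [hres]
  refine μ.atom_eq_of_homotopy (by rwa [hγ, LocalGeodesic.cls_shift]) T₁ T₂ ?_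
    ⟨⟨by linarith, ?_⟩, ?_⟩ (fun q => sectorSweep P φ v (-v + q.2 * (2 * v)) (q.1 * σ)) ?_ ?_
    (fun s hs => by rw [hE₁ s hs]; simp) (fun s hs => ?_) ?_ ?_
  · rw [Set.disjoint_left]
    intro q h1 h2
    obtain ⟨s, hs, rfl⟩ := Arc.exists_ext_of_mem_image h2
    rw [hE₂ s hs] at h1
    exact f1 s hs v (abs_of_pos hv).le (by linarith) h1
  · have := hγax v (abs_of_pos hv).le
    rw [← two_mul] at this
    rw [← this, ← zero_mul σ, ← hE₂ 0 m0]
    exact α₂.ext_mem_image 0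
  · rintro u ⟨hu, hu'⟩
    by_contra hlt
    push Not at hlt
    have ha : |u - v| ≤ v := by rw [abs_le]; constructor <;> linarith
    have := hγax (u - v) ha
    rw [add_sub_cancel] at this
    rw [← this, ← zero_mul σ] at hu'
    exact f2 0 m0 _ ha (by linarith) hu'
  · refine (h.continuousOn_sectorSweep hv).comp (f := fun q : ℝ × ℝ =>
      (-v + q.2 * (2 * v), q.1 * σ)) (by fun_prop) ?_
    rintro ⟨s, τ⟩ ⟨hs, hτ⟩
    exact ⟨htime τ hτ, (hy s hs).2, (hy s hs).1⟩
  · intro τ hτ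
    have ht := htime τ hτ
    set t := -v + τ * (2 * v)
    obtain ⟨l1, l2⟩ := sweepFactor_mem h.pi_le hv ht
    have hne : ∀ {t s : ℝ}, t ≠ 0 → (t + (s * σ : ℝ) * Complex.I : ℂ) ≠ 0 := by
      intro t s ht e
      have := congrArg Complex.re e
      simp at this; exact ht this
    -- Before the singularity the arc comes from the reversed sector, at the singularity it is the
    -- bisector, and after it comes from the sector itself.
    rcases lt_trichotomy t 0 with h0 | h0 | h0
    · have hl : sweepFactor φ v (-t) = sweepFactor φ v t := by
        rw [sweepFactor, sweepFactor, abs_neg]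
      obtain ⟨β, hβ, hβ'⟩ := h.reverse.exists_arc (g := γ) (t₀ := v) (υ := -1) (Or.inr rfl)
        hγiso (fun u hu => by
          rw [sub_zero, ← hγm u hu, one_mul, neg_one_mul, ← sub_eq_add_neg]) (fun u hu => by
          rw [sub_self, ← hγp u hu, one_mul, neg_one_mul, sub_neg_eq_add]) hI (t := -t)
        (by linarith) hσ (by linarith [abs_of_neg h0]) (by linarith) l2
      refine ⟨β, fun s hs => ?_, hβ'⟩
      have e := sweepAngle_of_nonneg (φ := φ) (v := v) (t := -t) (y := s * σ) (by linarith)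
      rw [upperArg_eq_arg (hne (by linarith)) (by simpa using (hy s hs).1), hl] at e
      change _ = sectorSweep P φ v t (s * σ)
      have e' := sectorSweep_reverse P φ v (-t) (s * σ)
      rw [neg_neg] at e'
      rw [hβ s hs, ← e', sectorSweep, e]
    · obtain ⟨β, hβ, hβ'⟩ := h.exists_arc_zero (g := γ) (t₀ := v) hγiso (by simpa using hγp)
        (by simpa using hγm) hI hσ (by linarith)
      refine ⟨β, fun s hs => ?_, hβ'⟩
      change _ = sectorSweep P φ v t (s * σ)
      rw [hβ s hs, h0, sectorSweep]
      rw [sweepAngle_of_nonneg le_rfl]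
      have e1 : ‖(((0 : ℝ) : ℂ) + ((s * σ : ℝ) : ℂ) * Complex.I)‖ = s * σ := by
        rw [Complex.ofReal_zero, zero_add, norm_mul, Complex.norm_I, mul_one, Complex.norm_real,
          Real.norm_eq_abs, abs_of_nonneg (hy s hs).1]
      rw [e1]
      congr 1
      have e2 : (((0 : ℝ) : ℂ) + ((s * σ : ℝ) : ℂ) * Complex.I).re = 0 := by simp
      rw [upperArg, e2, zero_div, Real.arccos_zero, sweepFactor, abs_zero]
      field_simp
      ring
    · obtain ⟨β, hβ, hβ'⟩ := h.exists_arc (g := γ) (t₀ := v) (υ := 1) (Or.inl rfl) hγiso hγp hγm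
        hI h0 hσ (by linarith [abs_of_pos h0]) (by linarith) l2
      refine ⟨β, fun s hs => ?_, hβ'⟩
      have e := sweepAngle_of_nonneg (φ := φ) (v := v) (t := t) (y := s * σ) h0.le
      rw [upperArg_eq_arg (hne h0.ne') (by simpa using (hy s hs).1)] at e
      change _ = sectorSweep P φ v t (s * σ)
      rw [hβ s hs, sectorSweep, e]
  · rw [hE₂ s hs]
    simp only
    congr 1; ring
  · intro τ hτ
    simp only
    rw [zero_mul, hγax _ (htime τ hτ)]
    congr 1; ring
  · intro s hs τ hτ
    have h1 := htime τ ⟨hτ.1.le, hτ.2.le⟩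
    exact ⟨f1 s hs _ h1 (by nlinarith [hτ.1]), f2 s hs _ h1 (by nlinarith [hτ.2])⟩

end SectorSweep

/-! ### Constancy of the mass along a leaf -/

section ConstantMass

open HalfTranslationSurface

variable {S E : Type*} [MetricSpace S] [MetricSpace E] {M : HalfTranslationSurface S} {p : E → S}
  {g : LocalGeodesic S}

/-- The mass of a leaf is constant on an interval of regular times. -/
lemma hasMass_eq_of_regular (hp : IsIsometricUniversalCover p) (Λ : FlatLamination M p)
    (μ : TransverseMeasure M Λ.leaves) (hg : g.cls ∈ Λ.leaves) {I : Set ℝ} (hI : IsPreconnected I)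
    (hreg : ∀ t ∈ I, g t ∉ M.sing) {a b : ℝ} (ha : a ∈ I) (hb : b ∈ I) {m m' : ENNReal}
    (h : HasMass μ g a m) (h' : HasMass μ g b m') : m = m' := by
  refine hI.induction₂ (fun s t => ∀ m m', HasMass μ g s m → HasMass μ g t m' → m = m') ?_ ?_ ?_
    ha hb m m' h h'
  · intro t ht
    obtain ⟨Ψ, R, D, hΨ⟩ := exists_isFlatChart (M := M) g g.2 (hreg t ht)
    filter_upwards [nhdsWithin_le_nhds (Metric.ball_mem_nhds t hΨ.pos)] with s hs m m' h1 h2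
    rw [Metric.mem_ball, Real.dist_eq] at hs
    exact hΨ.mass_eq hp Λ μ hg (a := 0) (b := s - t) (by simpa using hΨ.pos) hs
      (by simpa using h1) (by simpa using h2)
  · intro s t u _ ht _ h1 h2 m m' h3 h4
    obtain ⟨m₁, hm₁⟩ := exists_hasMass hp Λ μ hg (hreg t ht)
    rw [h1 _ _ h3 hm₁, h2 _ _ hm₁ h4]
  · exact fun s t _ _ h1 m m' h2 h3 => (h1 _ _ h3 h2).symm

/-- The point `g t` may be singular, but a punctured neighbourhood of t is regular. The mass is
constant on each side, and `IsSector.mass_eq` compares the two sides. -/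
lemma exists_eventually_hasMass (hp : IsIsometricUniversalCover p) (Λ : FlatLamination M p)
    (μ : TransverseMeasure M Λ.leaves) (hg : g.cls ∈ Λ.leaves) (t : ℝ) :
    ∃ m, ∀ᶠ s in 𝓝[≠] t, HasMass μ g s m := by
  have hpi := Real.pi_pos
  obtain ⟨P, R, φ, h, h1, h2, h3⟩ := exists_isSector (M := M) g g.2 t
  have hR := h.pos
  have hφ : 0 < φ := hpi.trans_le h.pi_le
  have r1 : ∀ s ∈ Ioo t (t + R), g s ∉ M.sing := by
    intro s hs
    have := h1 (s - t) ⟨by linarith [hs.1], by linarith [hs.2]⟩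
    rw [add_sub_cancel] at this
    rw [this]
    exact h.notMem_sing (by linarith [hs.1]) (by linarith [hs.2]) ⟨le_rfl, hφ.le⟩
  have r2 : ∀ s ∈ Ioo (t - R) t, g s ∉ M.sing := by
    intro s hs
    have := h2 (t - s) ⟨by linarith [hs.2], by linarith [hs.1]⟩
    rw [sub_sub_cancel] at this
    rw [this]
    exact h.notMem_sing (by linarith [hs.2]) (by linarith [hs.1]) ⟨hφ.le, le_rfl⟩
  have m1 : t + R / 2 ∈ Ioo t (t + R) := ⟨by linarith, by linarith⟩
  have m2 : t - R / 2 ∈ Ioo (t - R) t := ⟨by linarith, by linarith⟩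
  obtain ⟨m, hm⟩ := exists_hasMass hp Λ μ hg (r1 _ m1)
  obtain ⟨m', hm'⟩ := exists_hasMass hp Λ μ hg (r2 _ m2)
  have e : m' = m := h.mass_eq hp Λ μ hg h1 h2 h3 (half_pos hR) (by linarith) hm' hm
  subst e
  refine ⟨m', ?_⟩
  filter_upwards [nhdsWithin_le_nhds (Ioo_mem_nhds (show t - R < t by linarith)
    (show t < t + R by linarith)), self_mem_nhdsWithin] with s hs hne
  rcases lt_or_gt_of_ne hne with hlt | hlt
  · have hs' : s ∈ Ioo (t - R) t := ⟨hs.1, hlt⟩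
    obtain ⟨m, hm₀⟩ := exists_hasMass hp Λ μ hg (r2 _ hs')
    rwa [hasMass_eq_of_regular hp Λ μ hg isPreconnected_Ioo r2 m2 hs' hm' hm₀]
  · have hs' : s ∈ Ioo t (t + R) := ⟨hlt, hs.2⟩
    obtain ⟨m, hm₀⟩ := exists_hasMass hp Λ μ hg (r1 _ hs')
    rwa [hasMass_eq_of_regular hp Λ μ hg isPreconnected_Ioo r1 m1 hs' hm hm₀]

/-- The mass of a leaf is the same at all its regular points. -/
lemma exists_forall_hasMass (hp : IsIsometricUniversalCover p) (Λ : FlatLamination M p)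
    (μ : TransverseMeasure M Λ.leaves) (hg : g.cls ∈ Λ.leaves) :
    ∃ m, ∀ t, g t ∉ M.sing → HasMass μ g t m := by
  have hreg : ∀ t : ℝ, ∀ᶠ s in 𝓝[≠] t, g s ∉ M.sing := by
    intro t
    have hpi := Real.pi_pos
    obtain ⟨P, R, φ, h, h1, h2, -⟩ := exists_isSector (M := M) g g.2 t
    have hφ : 0 < φ := hpi.trans_le h.pi_le
    have hR := h.pos
    filter_upwards [nhdsWithin_le_nhds (Ioo_mem_nhds (show t - R < t by linarith)
      (show t < t + R by linarith)), self_mem_nhdsWithin] with s hs hne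
    rcases lt_or_gt_of_ne hne with hlt | hlt
    · have := h2 (t - s) ⟨by linarith, by linarith [hs.1]⟩
      rw [sub_sub_cancel] at this
      rw [this]
      exact h.notMem_sing (by linarith) (by linarith [hs.1]) ⟨hφ.le, le_rfl⟩
    · have := h1 (s - t) ⟨by linarith, by linarith [hs.2]⟩
      rw [add_sub_cancel] at this
      rw [this]
      exact h.notMem_sing (by linarith) (by linarith [hs.2]) ⟨le_rfl, hφ.le⟩
  have huniq : ∀ t m m', (∀ᶠ s in 𝓝[≠] t, HasMass μ g s m) → (∀ᶠ s in 𝓝[≠] t, HasMass μ g s m') →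
      m = m' := by
    intro t m m' h1 h2
    obtain ⟨s, ⟨h3, h4⟩, h5⟩ := ((h1.and h2).and (hreg t)).exists
    exact h3.unique hp Λ μ hg h5 h4
  -- Having the same mass on punctured neighbourhoods is a locally true, symmetric and transitive
  -- relation between times; transitivity uses `huniq`. So it relates all times, the singular ones
  -- included.
  have key : ∀ s t : ℝ, ∃ m, (∀ᶠ u in 𝓝[≠] s, HasMass μ g u m) ∧
      ∀ᶠ u in 𝓝[≠] t, HasMass μ g u m := by
    intro s t
    refine isPreconnected_univ.induction₂ (fun s t => ∃ m, (∀ᶠ u in 𝓝[≠] s, HasMass μ g u m) ∧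
      ∀ᶠ u in 𝓝[≠] t, HasMass μ g u m) ?_ ?_ ?_ (mem_univ s) (mem_univ t)
    · intro s _
      rw [nhdsWithin_univ]
      obtain ⟨m, hm⟩ := exists_eventually_hasMass hp Λ μ hg s
      have hm' := hm
      rw [eventually_nhdsWithin_iff] at hm'
      filter_upwards [hm'.eventually_nhds] with u hu
      refine ⟨m, hm, ?_⟩
      rcases eq_or_ne u s with rfl | hne
      · exact hm
      · refine nhdsWithin_le_nhds ?_
        filter_upwards [hu, isOpen_ne.mem_nhds hne] with w hw hw'
        exact hw hw'
    · rintro s t u - - - ⟨m, h1, h2⟩ ⟨m', h3, h4⟩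
      obtain rfl := huniq t _ _ h2 h3
      exact ⟨m, h1, h4⟩
    · rintro s t - - ⟨m, h1, h2⟩
      exact ⟨m, h2, h1⟩
  obtain ⟨m, hm⟩ := exists_eventually_hasMass hp Λ μ hg 0
  refine ⟨m, fun t ht => ?_⟩
  obtain ⟨m', h1, h2⟩ := key 0 t
  obtain rfl := huniq 0 _ _ hm h1
  obtain ⟨m', hm'⟩ := exists_hasMass hp Λ μ hg ht
  obtain ⟨Ψ, R, D, hΨ⟩ := exists_isFlatChart (M := M) g g.2 ht
  obtain ⟨s, hs1, hs2⟩ := (h2.and (nhdsWithin_le_nhds (Metric.ball_mem_nhds t hΨ.pos))).exists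
  rw [Real.dist_eq] at hs2
  have := hΨ.mass_eq hp Λ μ hg (a := 0) (b := s - t) (by simpa using hΨ.pos) hs2
    (by simpa using hm') (by simpa using hs1)
  rwa [← this]

end ConstantMass

/-! ### Local geodesics in a Euclidean cone -/

section LocalGeodesicsInCones

open HalfTranslationSurface

variable {S : Type*} [MetricSpace S] {M : HalfTranslationSurface S}

/-- Prolongation of the geodesics which do not see the centre of the chart under a flat angle. -/
lemma HalfTranslationSurface.exists_glue {x : S} {ρ₀ ρ θ₀ θ : ℝ} (h₀ : 0 ≤ ρ₀)
    (h₀R : ρ₀ < M.rad x) (h : 0 < ρ) (hR : ρ < M.rad x) (hθ₀ : θ₀ ∈ M.link x) (hθ : θ ∈ M.link x)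
    (hlt : |θ₀ - θ| < Real.pi) : ∃ δ > 0, ∀ m₁ q, dist (M.pol x ρ θ) m₁ < δ →
      dist (M.pol x ρ θ) q < δ → m₁ ≠ M.pol x ρ θ →
      dist (M.pol x ρ₀ θ₀) m₁ + dist m₁ (M.pol x ρ θ) = dist (M.pol x ρ₀ θ₀) (M.pol x ρ θ) →
      dist m₁ (M.pol x ρ θ) + dist (M.pol x ρ θ) q = dist m₁ q →
      dist (M.pol x ρ₀ θ₀) (M.pol x ρ θ) + dist (M.pol x ρ θ) q = dist (M.pol x ρ₀ θ₀) q := by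
  have hpi := Real.pi_pos
  -- This bound on the angles makes all the pairwise angles between the four points at most π, so
  -- that the planar gluing `dist_add_dist_eq_of_overlap` applies.
  obtain ⟨δ, hδ, H⟩ := exists_angle_near h hR hθ (η := min (Real.pi - |θ₀ - θ|) (Real.pi / 2))
    (lt_min (by linarith) (by linarith))
  refine ⟨δ, hδ, fun m₁ q hm₁ hq hne e₁ e₂ => ?_⟩
  obtain ⟨ρ₁, θ₁, a1, a2, a3, a4, rfl⟩ := H m₁ hm₁
  obtain ⟨ρ₂, θ₂, b1, b2, b3, b4, rfl⟩ := H q hq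
  rw [lt_min_iff] at a4 b4
  have c1 : |θ₀ - θ₁| ≤ Real.pi := by
    have := abs_sub_le θ₀ θ θ₁; rw [abs_sub_comm θ θ₁] at this; linarith
  have c2 : |θ₀ - θ₂| ≤ Real.pi := by
    have := abs_sub_le θ₀ θ θ₂; rw [abs_sub_comm θ θ₂] at this; linarith
  have c3 : |θ₁ - θ₂| ≤ Real.pi := by
    have := abs_sub_le θ₁ θ θ₂; rw [abs_sub_comm θ θ₂] at this; linarith
  have c4 : |θ₁ - θ| ≤ Real.pi := by linarith
  have c5 : |θ - θ₂| ≤ Real.pi := by rw [abs_sub_comm]; linarith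
  rw [dist_pol_planar h₀ h₀R a1.le a2 hθ₀ a3 c1, dist_pol_planar a1.le a2 h.le hR a3 hθ c4,
    dist_pol_planar h₀ h₀R h.le hR hθ₀ hθ hlt.le] at e₁
  rw [dist_pol_planar a1.le a2 h.le hR a3 hθ c4, dist_pol_planar h.le hR b1.le b2 hθ b3 c5,
    dist_pol_planar a1.le a2 b1.le b2 a3 b3 c3] at e₂
  rw [dist_pol_planar h₀ h₀R h.le hR hθ₀ hθ hlt.le, dist_pol_planar h.le hR b1.le b2 hθ b3 c5,
    dist_pol_planar h₀ h₀R b1.le b2 hθ₀ b3 c2]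
  simp only [← dist_eq_norm] at *
  refine dist_add_dist_eq_of_overlap (fun e => hne ?_) e₁ e₂
  rw [← dist_eq_zero, dist_pol_planar a1.le a2 h.le hR a3 hθ c4, ← dist_eq_norm, e, dist_self]

lemma IsLocalGeodesicOn.dist_sub_eq {X : Type*} [MetricSpace X] {c : ℝ → X} {a b : ℝ}
    (h : IsLocalGeodesicOn c (Icc a b)) (hab : dist (c a) (c b) = b - a) {s : ℝ}
    (hs : s ∈ Icc a b) : dist (c a) (c s) = s - a ∧ dist (c s) (c b) = b - s := by
  have h1 := h.dist_le s hs
  have h2 := (h.mono (Icc_subset_Icc_left hs.1)).dist_le b ⟨hs.2, le_rfl⟩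
  have h3 := dist_triangle (c a) (c s) (c b)
  constructor <;> linarith

/-- A base angle of an isosceles triangle is acute. -/
lemma angle_lt_of_isosceles {ρ r φ : ℝ} (hρ : 0 ≤ ρ) (hr : 0 < r) (h : coneDist ρ r φ = ρ) :
    φ < Real.pi / 2 := by
  have h1 := coneDist_sq (φ := φ) hρ hr.le
  rw [h] at h1
  by_contra hcon
  push Not at hcon
  have h2 : Real.cos (min φ Real.pi) ≤ 0 :=
    Real.cos_nonpos_of_pi_div_two_le_of_le (le_min hcon (by linarith [Real.pi_pos]))
      ((min_le_right _ _).trans (by linarith [Real.pi_pos]))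
  nlinarith [mul_nonneg hρ hr.le, mul_pos hr hr]

/-- A local geodesic which stays in the ball of a polar chart and does not meet the centre, except
maybe at its end points, is a geodesic. -/
lemma IsLocalGeodesicOn.dist_eq_of_avoid {c : ℝ → S} {a b : ℝ} {x : S}
    (h : IsLocalGeodesicOn c (Icc a b)) (hball : ∀ t ∈ Icc a b, dist x (c t) < M.rad x)
    (hx : c a = x ∨ ∀ t ∈ Ioo a b, c t ≠ x) : ∀ t ∈ Icc a b, dist (c a) (c t) = t - a := by
  have hpi := Real.pi_pos
  refine h.dist_eq_of_glue fun t ht e => ?_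
  have ha : a ∈ Icc a b := ⟨le_rfl, (ht.1.trans ht.2).le⟩
  have hpos : 0 < dist (c a) (c t) := by rw [e]; linarith [ht.1]
  obtain ⟨θ, hθ, hm⟩ := exists_pol (M := M) (hball t (Ioo_subset_Icc_self ht))
  have hρ : 0 < dist x (c t) := by
    rcases hx with hx | hx
    · rwa [← hx]
    · exact dist_pos.2 (hx t ht).symm
  obtain ⟨θ₀, hθ₀, hp, hang⟩ := exists_pol_near (M := M) (hball a ha) θ
  have key : ∀ ρ₀ θ₀, 0 ≤ ρ₀ → ρ₀ < M.rad x → θ₀ ∈ M.link x → c a = M.pol x ρ₀ θ₀ →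
      |θ₀ - θ| < Real.pi → ∃ δ > 0, ∀ m₁ q, dist (c t) m₁ < δ →
      dist (c t) q < δ → m₁ ≠ c t → dist (c a) m₁ + dist m₁ (c t) = dist (c a) (c t) →
      dist m₁ (c t) + dist (c t) q = dist m₁ q →
      dist (c a) (c t) + dist (c t) q = dist (c a) q := by
    intro ρ₀ θ₀ h1 h2 h3 h4 h5
    rw [hm, h4]
    exact exists_glue h1 h2 hρ (hball t (Ioo_subset_Icc_self ht)) h3 hθ h5
  by_cases hax : c a = x
  · exact key 0 θ le_rfl (M.rad_pos x) hθ (by rw [hax, M.pol_zero x θ hθ]) (by simpa using hpi)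
  · refine key _ θ₀ dist_nonneg (hball a ha) hθ₀ hp ?_
    by_contra hcon
    push Not at hcon
    rw [hang] at hcon
    have hR₀ := hball a ha
    have hRt := hball t (Ioo_subset_Icc_self ht)
    have hr : 0 < dist x (c a) := dist_pos.2 (Ne.symm hax)
    have hsum : dist (c a) (c t) = dist x (c a) + dist x (c t) := by
      conv_lhs => rw [hp, hm]
      rw [dist_pol_pol dist_nonneg hR₀ dist_nonneg hRt hθ₀ hθ,
        coneDist_of_pi_le dist_nonneg dist_nonneg hcon]
    -- If the angle at x were at least π, the distance would be that of the path through the apex.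
    -- The point of c at the same distance from `c a` as x, being different from x, forms isosceles
    -- triangles with x and each of `c a`, `c t`; their angles at x are acute, and their sum is less
    -- than π.
    set s := a + dist x (c a) with hs
    have hs' : s ∈ Ioo a b := ⟨by linarith, by linarith [ht.2]⟩
    have hsy : c s ≠ x := by
      rcases hx with hx | hx
      · exact absurd hx hax
      · exact hx s hs'
    have hRs := hball s (Ioo_subset_Icc_self hs')
    obtain ⟨h1, h2⟩ := (h.mono (Icc_subset_Icc_right ht.2.le)).dist_sub_eq e (s := s)
      ⟨hs'.1.le, by linarith⟩
    obtain ⟨θ₁, hθ₁, hy⟩ := exists_pol (M := M) hRs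
    have hy0 : 0 < dist x (c s) := dist_pos.2 hsy.symm
    have e1 : coneDist (dist x (c a)) (dist x (c s)) (M.ldist x θ₀ θ₁) = dist x (c a) := by
      rw [← dist_pol_pol dist_nonneg hR₀ dist_nonneg hRs hθ₀ hθ₁, ← hp, ← hy, h1]; linarith
    have e2 : coneDist (dist x (c t)) (dist x (c s)) (M.ldist x θ θ₁) = dist x (c t) := by
      rw [← dist_pol_pol dist_nonneg hRt dist_nonneg hRs hθ hθ₁, ← hm, ← hy, dist_comm, h2]
      linarith
    have f1 := angle_lt_of_isosceles dist_nonneg hy0 e1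
    have f2 := angle_lt_of_isosceles dist_nonneg hy0 e2
    have f3 := linkDist_triangle (x ∈ M.bdry) (M.k x) θ₀ θ₁ θ
    rw [linkDist_comm _ _ θ₁ θ] at f3
    unfold ldist at hcon f1 f2
    linarith

lemma IsLocalGeodesicOn.comp_neg {X : Type*} [MetricSpace X] {c : ℝ → X} {a b : ℝ}
    (h : IsLocalGeodesicOn c (Icc a b)) : IsLocalGeodesicOn (fun t => c (-t)) (Icc (-b) (-a)) := by
  intro t ht
  have hm : ∀ s ∈ Icc (-b) (-a), -s ∈ Icc a b := fun s hs => ⟨by linarith [hs.2], by linarith [hs.1]⟩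
  obtain ⟨ε, hε, H⟩ := h (-t) (hm t ht)
  refine ⟨ε, hε, fun s hs s' hs' h1 h2 => ?_⟩
  rw [H _ (hm s hs) _ (hm s' hs') (by rwa [neg_sub_neg, abs_sub_comm])
    (by rwa [neg_sub_neg, abs_sub_comm]), neg_sub_neg, abs_sub_comm]

/-- A local geodesic which stays in the ball of a polar chart is a geodesic. -/
lemma IsLocalGeodesicOn.dist_eq_of_mem_ball {c : ℝ → S} {a b : ℝ} {x : S} (hab : a ≤ b)
    (h : IsLocalGeodesicOn c (Icc a b)) (hball : ∀ t ∈ Icc a b, dist x (c t) < M.rad x) :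
    dist (c a) (c b) = b - a := by
  have hb : b ∈ Icc a b := ⟨hab, le_rfl⟩
  by_cases hx : ∀ t ∈ Ioo a b, c t ≠ x
  · exact h.dist_eq_of_avoid hball (Or.inr hx) b hb
  push Not at hx
  -- If c passes through the centre, the previous lemma makes both halves radii. Their angle is seen
  -- arbitrarily close to the centre, where c is an isometry, hence is at least π, and the two
  -- lengths add up.
  obtain ⟨t, ht, rfl⟩ := hx
  have hp := (h.mono (Icc_subset_Icc_left ht.1.le)).dist_eq_of_avoid (x := c t)
    (fun s hs => hball s ⟨ht.1.le.trans hs.1, hs.2⟩) (Or.inl rfl)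
  have hm' := (h.mono (Icc_subset_Icc_right ht.2.le)).comp_neg.dist_eq_of_avoid (x := c t)
    (M := M) (fun s hs => hball _ ⟨by linarith [hs.2], by linarith [hs.1, ht.2]⟩)
    (Or.inl (by rw [neg_neg]))
  have hm : ∀ s ∈ Icc a t, dist (c t) (c s) = t - s := by
    intro s hs
    have := hm' (-s) ⟨by linarith [hs.2], by linarith [hs.1]⟩
    simp only [neg_neg] at this
    rw [this]; ring
  obtain ⟨ε, hε, H⟩ := h t (Ioo_subset_Icc_self ht)
  set u := min (ε / 2) (min (t - a) (b - t)) with hu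
  have hu0 : 0 < u := lt_min (by linarith) (lt_min (by linarith [ht.1]) (by linarith [ht.2]))
  have u1 : u < ε := (min_le_left _ _).trans_lt (by linarith)
  have u2 : u ≤ t - a := (min_le_right _ _).trans (min_le_left _ _)
  have u3 : u ≤ b - t := (min_le_right _ _).trans (min_le_right _ _)
  have ha' : a ∈ Icc a t := ⟨le_rfl, ht.1.le⟩
  have hb' : b ∈ Icc t b := ⟨ht.2.le, le_rfl⟩
  have hl' : t - u ∈ Icc a t := ⟨by linarith, by linarith⟩
  have hr' : t + u ∈ Icc t b := ⟨by linarith, by linarith⟩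
  have dA := hm a ha'
  have dB := hp b hb'
  have dU := hm _ hl'
  have dV := hp _ hr'
  have hmemU : t - u ∈ Icc a b := ⟨hl'.1, by linarith [hl'.2, ht.2]⟩
  have hmemV : t + u ∈ Icc a b := ⟨by linarith [hr'.1, ht.1], hr'.2⟩
  have dUV : dist (c (t - u)) (c (t + u)) = u + u := by
    rw [H _ hmemU _ hmemV (by rw [sub_sub_cancel_left, abs_neg, abs_of_pos hu0]; exact u1)
      (by rw [add_sub_cancel_left, abs_of_pos hu0]; exact u1), abs_sub_comm, abs_of_pos
      (by linarith)]
    ring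
  have dAU : dist (c (t - u)) (c a) = t - a - u := by
    rw [dist_comm, ((h.mono (Icc_subset_Icc_right ht.2.le)).dist_sub_eq
      (by rw [dist_comm]; exact dA) hl').1]; ring
  have dBV : dist (c (t + u)) (c b) = b - t - u := by
    rw [((h.mono (Icc_subset_Icc_left ht.1.le)).dist_sub_eq dB hr').2]; ring
  have hA := hball a ⟨le_rfl, hab⟩
  have hB := hball b hb
  have hU := hball _ hmemU
  have hV := hball _ hmemV
  obtain ⟨θa, ma, ea⟩ := exists_pol (M := M) hA
  obtain ⟨θb, mb, eb⟩ := exists_pol (M := M) hB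
  obtain ⟨θu, mu, eu⟩ := exists_pol (M := M) hU
  obtain ⟨θv, mv, ev⟩ := exists_pol (M := M) hV
  rw [dA] at hA ea
  rw [dB] at hB eb
  rw [dU, sub_sub_cancel] at hU eu
  rw [dV, add_sub_cancel_left] at hV ev
  have pa : 0 < t - a := by linarith [ht.1]
  have pb : 0 < b - t := by linarith [ht.2]
  have l1 : Real.pi ≤ M.ldist (c t) θu θv := by
    refine pi_le_ldist hu0 hU hu0 hV mu mv ?_
    rw [← eu, ← ev, dUV]
  have l2 : M.ldist (c t) θu θa = 0 := by
    refine eq_zero_of_coneDist hu0 pa (linkDist_nonneg _ _ _ _) ?_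
    rw [← dist_pol_pol hu0.le hU pa.le hA mu ma, ← eu, ← ea, dAU, abs_sub_comm,
      abs_of_nonneg (by linarith)]
  have l3 : M.ldist (c t) θv θb = 0 := by
    refine eq_zero_of_coneDist hu0 pb (linkDist_nonneg _ _ _ _) ?_
    rw [← dist_pol_pol hu0.le hV pb.le hB mv mb, ← ev, ← eb, dBV, abs_sub_comm,
      abs_of_nonneg (by linarith)]
  have l4 : Real.pi ≤ M.ldist (c t) θa θb := by
    have t1 := linkDist_triangle (c t ∈ M.bdry) (M.k (c t)) θu θa θv
    have t2 := linkDist_triangle (c t ∈ M.bdry) (M.k (c t)) θa θb θv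
    rw [linkDist_comm _ _ θb θv] at t2
    unfold ldist at *
    linarith
  rw [ea, eb, dist_pol_pol pa.le hA pb.le hB ma mb, coneDist_of_pi_le pa.le pb.le l4]
  ring

end LocalGeodesicsInCones

/-! ### Properness, and compactness of spaces of local geodesics -/

section Proper

/-- On an almost shortest curve from x to y, take a point at distance R from x: the length left is
less than δ. -/
lemma IsLengthMetric.exists_between {X : Type*} [MetricSpace X] (h : IsLengthMetric X) {x y : X}
    {R δ : ℝ} (hR : 0 ≤ R) (hδ : 0 < δ) (hxy : dist x y < R + δ) :
    ∃ z, dist x z ≤ R ∧ dist z y < δ := by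
  rcases le_or_gt (dist x y) R with hle | hlt
  · exact ⟨y, hle, by rwa [dist_self]⟩
  have hη : 0 < (R + δ - dist x y) / 2 := by linarith
  obtain ⟨γ, hγ, rfl, rfl, hv⟩ := h x y _ hη
  have hc : ContinuousOn (fun s => dist (γ 0) (γ s)) (Icc 0 1) :=
    ((continuous_const (y := γ 0)).dist continuous_id).comp_continuousOn hγ
  obtain ⟨s, hs, e⟩ := intermediate_value_Icc zero_le_one hc
    (show R ∈ Icc (dist (γ 0) (γ 0)) (dist (γ 0) (γ 1)) by rw [dist_self]; exact ⟨hR, hlt.le⟩)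
  simp only at e
  refine ⟨γ s, e.le, ?_⟩
  have h0 : (0 : ℝ) ∈ Icc (0 : ℝ) 1 := ⟨le_rfl, zero_le_one⟩
  have h1 : (1 : ℝ) ∈ Icc (0 : ℝ) 1 := ⟨zero_le_one, le_rfl⟩
  have hadd := eVariationOn.Icc_add_Icc γ hs.1 hs.2 hs
  rw [inter_self, inter_eq_self_of_subset_right (Icc_subset_Icc_right hs.2),
    inter_eq_self_of_subset_right (Icc_subset_Icc_left hs.1)] at hadd
  have e1 := eVariationOn.edist_le γ (s := Icc 0 s) (x := 0) (y := s) ⟨le_rfl, hs.1⟩ ⟨hs.1, le_rfl⟩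
  have e2 := eVariationOn.edist_le γ (s := Icc s 1) (x := s) (y := 1) ⟨le_rfl, hs.2⟩ ⟨hs.2, le_rfl⟩
  have e3 := (add_le_add e1 e2).trans (hadd.le.trans hv)
  rw [edist_dist, edist_dist, ← ENNReal.ofReal_add dist_nonneg dist_nonneg,
    ENNReal.ofReal_le_ofReal_iff (by positivity)] at e3
  linarith

/-- Hopf-Rinow theorem. -/
lemma IsLengthMetric.isCompact_closedBall {X : Type*} [MetricSpace X] [CompleteSpace X]
    (h : IsLengthMetric X) (hloc : ∀ x : X, ∃ r > 0, IsCompact (Metric.closedBall x r)) (x : X)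
    (r : ℝ) : IsCompact (Metric.closedBall x r) := by
  by_contra hr
  set I := {r | IsCompact (Metric.closedBall x r)} with hI
  have hdown : ∀ r ∈ I, ∀ r' ≤ r, r' ∈ I := fun r hr r' hle =>
    hr.of_isClosed_subset Metric.isClosed_closedBall (Metric.closedBall_subset_closedBall hle)
  have h0 : (0 : ℝ) ∈ I := by
    simp only [hI, mem_ofPred_eq, Metric.closedBall_zero]; exact isCompact_singleton
  have hbdd : BddAbove I := ⟨r, fun s hs => by
    by_contra hlt
    exact hr (hdown s hs r (le_of_not_ge hlt))⟩
  set s := sSup I with hs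
  have hs0 : 0 ≤ s := le_csSup hbdd h0
  -- The ball of radius s is totally bounded, because each of its points is close to a compact ball
  -- of slightly smaller radius; local compactness then enlarges s, which contradicts its
  -- definition.
  have hcs : IsCompact (Metric.closedBall x s) := by
    refine isCompact_iff_totallyBounded_isComplete.2 ⟨?_, Metric.isClosed_closedBall.isComplete⟩
    rw [Metric.totallyBounded_iff]
    intro ε hε
    obtain ⟨r₀, hr₀, hlt⟩ := exists_lt_of_lt_csSup ⟨0, h0⟩ (show s - ε / 2 < sSup I by linarith)
    obtain ⟨r', hr', hle, hr0⟩ : ∃ r' ∈ I, r₀ ≤ r' ∧ 0 ≤ r' := by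
      rcases le_total r₀ 0 with h | h
      · exact ⟨0, h0, h, le_rfl⟩
      · exact ⟨r₀, hr₀, le_rfl, h⟩
    obtain ⟨t, ht, hcov⟩ := Metric.totallyBounded_iff.1 (IsCompact.totallyBounded hr') (ε / 2)
      (half_pos hε)
    refine ⟨t, ht, fun y hy => ?_⟩
    rw [Metric.mem_closedBall, dist_comm] at hy
    obtain ⟨z, hz, hzy⟩ := h.exists_between hr0 (half_pos hε) (show dist x y < r' + ε / 2 by
      linarith)
    have := hcov (show z ∈ Metric.closedBall x r' by rwa [Metric.mem_closedBall, dist_comm])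
    simp only [mem_iUnion, Metric.mem_ball, exists_prop] at this ⊢
    obtain ⟨w, hw, hzw⟩ := this
    refine ⟨w, hw, ?_⟩
    have := dist_triangle y z w
    rw [dist_comm y z] at this
    linarith
  have : WeaklyLocallyCompactSpace X := ⟨fun y => by
    obtain ⟨r, hr, hc⟩ := hloc y
    exact ⟨_, hc, Metric.closedBall_mem_nhds y hr⟩⟩
  obtain ⟨K, hK, hsub⟩ := exists_compact_superset hcs
  obtain ⟨δ, hδ, hth⟩ := hcs.exists_thickening_subset_open isOpen_interior hsub
  have hmem : s + δ / 2 ∈ I := by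
    refine hK.of_isClosed_subset Metric.isClosed_closedBall fun y hy => interior_subset (hth ?_)
    rw [Metric.mem_closedBall, dist_comm] at hy
    obtain ⟨z, hz, hzy⟩ := h.exists_between hs0 hδ (show dist x y < s + δ by linarith)
    rw [Metric.mem_thickening_iff]
    exact ⟨z, by rwa [Metric.mem_closedBall, dist_comm], by rwa [dist_comm]⟩
  have := le_csSup hbdd hmem
  linarith

namespace HalfTranslationSurface

variable {S : Type*} [MetricSpace S] (M : HalfTranslationSurface S)

/-- At an interior point angles range over ℝ; one period of them suffices, and it is compact. -/
lemma exists_isCompact_angles (x : S) : ∃ Θ ⊆ M.link x, IsCompact Θ ∧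
    ∀ y, dist x y < M.rad x → ∃ θ ∈ Θ, y = M.pol x (dist x y) θ := by
  by_cases hb : x ∈ M.bdry
  · refine ⟨Icc (M.τ x) (M.τ x + M.k x * Real.pi), fun θ hθ _ => hθ, isCompact_Icc, fun y hy => ?_⟩
    obtain ⟨θ, hθ, e⟩ := exists_pol hy
    exact ⟨θ, hθ hb, e⟩
  · have hC0 : (M.k x : ℝ) * Real.pi ≠ 0 := by
      have : (2 : ℝ) ≤ M.k x := by exact_mod_cast M.two_le_k x hb
      have := Real.pi_pos
      positivity
    refine ⟨Icc (-(|(M.k x : ℝ) * Real.pi| / 2)) (|(M.k x : ℝ) * Real.pi| / 2),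
      fun θ _ h => absurd h hb, isCompact_Icc, fun y hy => ?_⟩
    obtain ⟨θ, hθ, e, he⟩ := exists_pol_near hy 0
    refine ⟨θ, ?_, e⟩
    rw [sub_zero] at he
    rw [mem_Icc, ← abs_le, he]
    simp only [ldist, linkDist, hb, if_false]
    exact AddCircle.norm_le_half_period _ hC0

lemma isCompact_closedBall_of_lt {x : S} {r : ℝ} (hr : r < M.rad x) :
    IsCompact (Metric.closedBall x r) := by
  obtain ⟨Θ, hΘ, hc, hex⟩ := M.exists_isCompact_angles x
  have hcont : ContinuousOn (fun q : ℝ × ℝ => M.pol x q.1 q.2) (Icc 0 r ×ˢ Θ) := by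
    rintro ⟨ρ, θ⟩ ⟨hρ, hθ⟩
    have hlim : Tendsto (fun q : ℝ × ℝ => |ρ - q.1| + ρ * |θ - q.2|)
        (𝓝[Icc 0 r ×ˢ Θ] (ρ, θ)) (𝓝 0) := by
      have : Continuous fun q : ℝ × ℝ => |ρ - q.1| + ρ * |θ - q.2| := by fun_prop
      have := this.tendsto (ρ, θ)
      simp only [sub_self, abs_zero, mul_zero, add_zero] at this
      exact this.mono_left nhdsWithin_le_nhds
    rw [ContinuousWithinAt, tendsto_iff_dist_tendsto_zero]
    refine squeeze_zero' (Eventually.of_forall fun _ => dist_nonneg) ?_ hlim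
    filter_upwards [self_mem_nhdsWithin] with q hq
    rw [dist_comm, dist_pol_pol hρ.1 (hρ.2.trans_lt hr) hq.1.1 (hq.1.2.trans_lt hr) (hΘ hθ)
      (hΘ hq.2)]
    refine (coneDist_le hρ.1 hq.1.1 (linkDist_nonneg _ _ _ _)).trans ?_
    have : ρ * M.ldist x θ q.2 ≤ ρ * |θ - q.2| :=
      mul_le_mul_of_nonneg_left (linkDist_le_abs _ _ _ _) hρ.1
    unfold ldist at this
    linarith
  refine ((isCompact_Icc.prod hc).image_of_continuousOn hcont).of_isClosed_subset
    Metric.isClosed_closedBall fun y hy => ?_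
  rw [Metric.mem_closedBall, dist_comm] at hy
  obtain ⟨θ, hθ, e⟩ := hex y (hy.trans_lt hr)
  exact ⟨(dist x y, θ), ⟨⟨dist_nonneg, hy⟩, hθ⟩, e.symm⟩

lemma isCompact_closedBall (M : HalfTranslationSurface S) [CompleteSpace S] (x : S) (r : ℝ) :
    IsCompact (Metric.closedBall x r) :=
  M.lengthMetric.isCompact_closedBall (fun y => ⟨M.rad y / 2, half_pos (M.rad_pos y),
    M.isCompact_closedBall_of_lt (half_lt_self (M.rad_pos y))⟩) x r

/-- Local geodesics are isometric on intervals whose length is controlled by the position of one of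
their points. -/
lemma isLocalGeodesicOn_univ_iff {f : ℝ → S} : IsLocalGeodesicOn f univ ↔
    ∀ x t s s', |s - t| ≤ M.rad x / 4 → |s' - t| ≤ M.rad x / 4 → dist (f t) x < M.rad x / 4 →
      dist (f s) (f s') = |s - s'| := by
  constructor
  · intro hf x t s s' hs hs' hx
    wlog hle : s ≤ s'
    · rw [dist_comm, abs_sub_comm]; exact this M hf x t s' s hs' hs hx (le_of_not_ge hle)
    have hR := M.rad_pos x
    rw [(hf.mono (subset_univ _)).dist_eq_of_mem_ball (M := M) (x := x) hle, abs_sub_comm,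
      abs_of_nonneg (by linarith)]
    -- The two bounds by a quarter of the radius keep f within half the radius of x, where
    -- `dist_eq_of_mem_ball` applies.
    intro u hu
    have hu' : |u - t| ≤ M.rad x / 4 := by
      rw [abs_le] at *; constructor <;> linarith [hu.1, hu.2]
    have h1 := LocalGeodesic.dist_le (⟨⟨f, continuousOn_univ.1 hf.continuousOn⟩, hf⟩ :
      LocalGeodesic S) u t
    change dist (f u) (f t) ≤ |u - t| at h1
    have h2 := dist_triangle (f u) (f t) x
    rw [dist_comm]
    linarith
  · intro h t _
    have hR := M.rad_pos (f t)
    exact ⟨M.rad (f t) / 4, by positivity, fun s _ s' _ hs hs' =>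
      h (f t) t s s' hs.le hs'.le (by rw [dist_self]; positivity)⟩

/-- The space of the local geodesics whose origin is in a compact set is compact. -/
lemma isCompact_localGeodesic (M : HalfTranslationSurface S) [CompleteSpace S] {C : Set S}
    (hC : IsCompact C) : IsCompact {h : LocalGeodesic S | h 0 ∈ C} := by
  have hind : IsInducing (fun h : LocalGeodesic S => h.1) := IsInducing.subtypeVal
  rw [hind.isCompact_iff]
  have lip : ∀ f : C(ℝ, S), IsLocalGeodesicOn f univ → ∀ s t, dist (f s) (f t) ≤ |s - t| :=
    fun f hf s t => LocalGeodesic.dist_le (⟨f, hf⟩ : LocalGeodesic S) s t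
  refine ArzelaAscoli.isCompact_of_equicontinuous _ ?_ ?_
  · rcases C.eq_empty_or_nonempty with hne | ⟨x₀, hx₀⟩
    · simp [hne]
    obtain ⟨B, hB⟩ := hC.isBounded.subset_closedBall x₀
    -- Being a local geodesic, with its unspecified scale, is not visibly a closed condition. With
    -- the scale fixed by x it becomes one for pointwise convergence: for each x, either f t is far
    -- from x or an equality of distances holds.
    have hcl : IsClosed ({f : ℝ → S | f 0 ∈ C} ∩ ⋂ (x) (t) (s) (s') (_ : |s - t| ≤ M.rad x / 4)
        (_ : |s' - t| ≤ M.rad x / 4),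
          ({f : ℝ → S | M.rad x / 4 ≤ dist (f t) x} ∪ {f | dist (f s) (f s') = |s - s'|})) := by
      refine (hC.isClosed.preimage (continuous_apply 0)).inter ?_
      refine isClosed_iInter fun x => isClosed_iInter fun t => isClosed_iInter fun s =>
        isClosed_iInter fun s' => isClosed_iInter fun _ => isClosed_iInter fun _ => ?_
      exact (isClosed_le continuous_const (by fun_prop)).union (isClosed_eq (by fun_prop)
        continuous_const)
    have heq : ContinuousMap.toFun '' ((fun h : LocalGeodesic S => h.1) '' {h | h 0 ∈ C}) =
        ({f : ℝ → S | f 0 ∈ C} ∩ ⋂ (x) (t) (s) (s') (_ : |s - t| ≤ M.rad x / 4)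
        (_ : |s' - t| ≤ M.rad x / 4),
          ({f : ℝ → S | M.rad x / 4 ≤ dist (f t) x} ∪ {f | dist (f s) (f s') = |s - s'|})) := by
      ext f
      simp only [mem_inter_iff, mem_iInter, mem_union, mem_ofPred_eq]
      constructor
      · rintro ⟨_, ⟨h, hh, rfl⟩, rfl⟩
        refine ⟨hh, fun x t s s' hs hs' => ?_⟩
        rw [or_iff_not_imp_left, not_le]
        exact (M.isLocalGeodesicOn_univ_iff.1 h.2) x t s s' hs hs'
      · rintro ⟨hf0, hf⟩
        have hg : IsLocalGeodesicOn f univ := M.isLocalGeodesicOn_univ_iff.2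
          fun x t s s' hs hs' hx => (hf x t s s' hs hs').resolve_left (not_le.2 hx)
        exact ⟨⟨f, continuousOn_univ.1 hg.continuousOn⟩, ⟨⟨⟨f, continuousOn_univ.1
          hg.continuousOn⟩, hg⟩, hf0, rfl⟩, rfl⟩
    refine (isCompact_univ_pi fun t : ℝ => M.isCompact_closedBall x₀ (|t| + B)).of_isClosed_subset
      (heq ▸ hcl) ?_
    rintro _ ⟨_, ⟨h, hh, rfl⟩, rfl⟩ t -
    have h1 := h.dist_le t 0
    have h2 := hB hh
    rw [Metric.mem_closedBall] at h2 ⊢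
    rw [sub_zero] at h1
    exact (dist_triangle _ (h 0) _).trans (add_le_add h1 h2)
  · refine (LipschitzWith.uniformEquicontinuous _ 1 ?_).equicontinuous
    rintro ⟨_, ⟨h, hh, rfl⟩⟩
    refine LipschitzWith.of_dist_le_mul fun s t => ?_
    rw [NNReal.coe_one, one_mul]
    exact h.dist_le s t

end HalfTranslationSurface

end Proper

/-! ### Crossings of a perpendicular by a recurrent leaf -/

section Recurrence

open HalfTranslationSurface

variable {S E : Type*} [MetricSpace S] [MetricSpace E] {M : HalfTranslationSurface S} {p : E → S}
  {g : LocalGeodesic S} {t R r : ℝ} {Ψ : ℂ → S} {D : Set ℂ}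

/-- The points of the perpendicular to the real axis at the centre of a flat chart. -/
def crossSegment (Ψ : ℂ → S) (D : Set ℂ) (r : ℝ) : Set S :=
  (fun s : ℝ => Ψ (s * Complex.I)) '' {s | |s| ≤ r ∧ (s * Complex.I : ℂ) ∈ D}

lemma norm_mul_I (s : ℝ) : ‖(s * Complex.I : ℂ)‖ = |s| := by simp

/-- The transversal used in the final argument. In a disc the perpendicular extends on both sides of
the leaf; in a half disc it starts on the boundary. -/
lemma IsFlatChart.exists_cross_arc (hp : IsIsometricUniversalCover p) (Λ : FlatLamination M p)
    (hg : g.cls ∈ Λ.leaves) (hΨ : IsFlatChart M g t Ψ R D) :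
    ∃ r > 0, r ≤ R / 4 ∧ ∃ α : Arc M, α.TransverseToLeaves Λ.leaves ∧
      α.image = crossSegment Ψ D r := by
  have hR := hΨ.pos
  have key : ∀ r > 0, r ≤ R / 4 → ∀ α : Arc M, IsC1On M α.ext 0 1 →
      α.image = crossSegment Ψ D r → ∃ r > 0, r ≤ R / 4 ∧ ∃ α : Arc M,
      α.TransverseToLeaves Λ.leaves ∧ α.image = crossSegment Ψ D r := by
    intro r hr hle α hC him
    refine ⟨r, hr, hle, α, hΨ.transverseToLeaves hp Λ hg norm_I_im.1 norm_I_im.2.ne' hC ?_, him⟩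
    intro q hq
    rw [him] at hq
    obtain ⟨s, hs, rfl⟩ := hq
    exact ⟨s, hs.1.trans hle, hs.2, rfl⟩
  have hmem : ∀ s : ℝ, |s| ≤ R / 4 → (s * Complex.I : ℂ) ∈ Metric.ball 0 R := fun s hs => by
    rw [mem_ball_zero_iff, norm_mul_I]; linarith
  have a1 : |R / 4| = R / 4 := abs_of_pos (by linarith)
  rcases hΨ.domain with hD | hD <;> subst hD
  · have e1 : ((-(R / 4) : ℝ) * Complex.I : ℂ) + (R / 2 : ℝ) * Complex.I =
        (R / 4 : ℝ) * Complex.I := by push_cast; ring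
    obtain ⟨α, x1, x2, x3⟩ := hΨ.isFlatMap.exists_arc (z₀ := (-(R / 4) : ℝ) * Complex.I)
      (d := (R / 2 : ℝ) * Complex.I) (by simp [hR.ne'])
      ⟨mem_univ _, hmem _ (by rw [abs_neg, a1])⟩ ⟨mem_univ _, by rw [e1]; exact hmem _ a1.le⟩
    refine key (R / 4) (by linarith) le_rfl α x2 ?_
    rw [x3, crossSegment]
    ext q
    constructor
    · rintro ⟨s, hs, rfl⟩
      refine ⟨-(R / 4) + s * (R / 2), ⟨?_, mem_univ _⟩, ?_⟩
      · rw [abs_le]; constructor <;> nlinarith [hs.1, hs.2]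
      · simp only; congr 1; push_cast; ring
    · rintro ⟨s, ⟨hs, -⟩, rfl⟩
      rw [abs_le] at hs
      refine ⟨(s + R / 4) / (R / 2), ⟨div_nonneg (by linarith) (by linarith),
        (div_le_one (by linarith)).2 (by linarith)⟩, ?_⟩
      have : (R : ℂ) ≠ 0 := by exact_mod_cast hR.ne'
      simp only; congr 1; push_cast; field_simp; ring
  · obtain ⟨α, x1, x2, x3⟩ := hΨ.isFlatMap.exists_arc (z₀ := (0 : ℝ) * Complex.I)
      (d := (R / 4 : ℝ) * Complex.I) (by simp [hR.ne'])
      ⟨by simp, hmem _ (by rw [abs_zero]; linarith)⟩ ⟨by simp; linarith, by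
        rw [Complex.ofReal_zero, zero_mul, zero_add]; exact hmem _ a1.le⟩
    refine key (R / 4) (by linarith) le_rfl α x2 ?_
    rw [x3, crossSegment]
    ext q
    constructor
    · rintro ⟨s, hs, rfl⟩
      refine ⟨s * (R / 4), ⟨?_, ?_⟩, ?_⟩
      · rw [abs_mul, a1, abs_of_nonneg hs.1]; nlinarith [hs.2]
      · rw [mem_ofPred_eq, Complex.im_ofReal_mul, Complex.I_im, mul_one]
        exact mul_nonneg hs.1 (by linarith)
      · simp only; congr 1; push_cast; ring
    · rintro ⟨s, ⟨hs, hs'⟩, rfl⟩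
      rw [mem_ofPred_eq, Complex.im_ofReal_mul, Complex.I_im, mul_one] at hs'
      rw [abs_of_nonneg hs'] at hs
      refine ⟨s / (R / 4), ⟨div_nonneg hs' (by linarith), (div_le_one (by linarith)).2 hs⟩, ?_⟩
      have : (R : ℂ) ≠ 0 := by exact_mod_cast hR.ne'
      simp only; congr 1; push_cast; field_simp; ring

/-- A leaf which meets the perpendicular crosses it. -/
lemma IsFlatChart.exists_line_of_mem (hp : IsIsometricUniversalCover p) (Λ : FlatLamination M p)
    (hg : g.cls ∈ Λ.leaves) (hΨ : IsFlatChart M g t Ψ R D) {w : ℂ} (hw : w ∈ D)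
    (hwR : ‖w‖ ≤ R / 4) {a : ℝ} (ha : g a = Ψ w) : ∃ v : ℂ, ‖v‖ = 1 ∧ 1 / 2 ≤ |v.re| ∧
      ∀ u : ℝ, |u| ≤ R / 2 → w + u * v ∈ D ∧ ‖w + u * v‖ < R ∧ g (a + u) = Ψ (w + u * v) := by
  have hR := hΨ.pos
  obtain ⟨v, hv, him, hline⟩ := hΨ.exists_line hp Λ hg hg hw hwR ha
  refine ⟨v, hv, ?_, hline⟩
  have h1 : |v.im| * (R / 2) ≤ R / 4 := him.trans ((Complex.abs_im_le_norm w).trans hwR)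
  have h2 : |v.im| ≤ 1 / 2 := by nlinarith
  have h3 := Complex.norm_le_abs_re_add_abs_im v
  rw [hv] at h3
  linarith

/-- After a crossing the real part of the leaf in the chart moves at speed at least 1/2, so the leaf
cannot be again on the imaginary axis within the time R/2. -/
lemma IsFlatChart.notMem_crossSegment (hp : IsIsometricUniversalCover p) (Λ : FlatLamination M p)
    (hg : g.cls ∈ Λ.leaves) (hΨ : IsFlatChart M g t Ψ R D) (hr : r ≤ R / 4) {a u : ℝ}
    (ha : g a ∈ crossSegment Ψ D r) (hu : |u| ≤ R / 2) (hu0 : u ≠ 0) :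
    g (a + u) ∉ crossSegment Ψ D r := by
  have hR := hΨ.pos
  obtain ⟨s, ⟨hs, hsD⟩, e⟩ := ha
  obtain ⟨v, -, hv, hline⟩ := hΨ.exists_line_of_mem hp Λ hg hsD
    (by rw [norm_mul_I]; linarith) e.symm
  rintro ⟨s', ⟨hs', hsD'⟩, e'⟩
  obtain ⟨l1, l2, l3⟩ := hline u hu
  have := hΨ.isFlatMap.injOn ⟨hsD', by rw [mem_ball_zero_iff, norm_mul_I]; linarith⟩
    ⟨l1, by rwa [mem_ball_zero_iff]⟩ (e'.trans l3)
  have := congrArg Complex.re this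
  simp only [Complex.add_re, Complex.re_ofReal_mul, Complex.I_re, mul_zero, zero_add] at this
  rcases mul_eq_zero.1 this.symm with h | h
  · exact hu0 h
  · rw [h, abs_zero] at hv; linarith

/-- Crossing times are isolated by the previous lemma, and a set of reals whose points are isolated
on the right is countable. -/
lemma IsFlatChart.countable_crossing (hp : IsIsometricUniversalCover p) (Λ : FlatLamination M p)
    (hg : g.cls ∈ Λ.leaves) (hΨ : IsFlatChart M g t Ψ R D) (hr : r ≤ R / 4) :
    {a | g a ∈ crossSegment Ψ D r}.Countable := by
  have hR := hΨ.pos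
  refine (countable_setOfPred_isolated_right_within (s := {a | g a ∈ crossSegment Ψ D r})).mono ?_
  intro a ha
  refine ⟨ha, ?_⟩
  rw [← empty_mem_iff_bot, mem_nhdsWithin_iff_exists_mem_nhds_inter]
  refine ⟨Metric.ball a (R / 2), Metric.ball_mem_nhds a (half_pos hR), ?_⟩
  rintro b ⟨hb, hb', hlt⟩
  rw [Metric.mem_ball, Real.dist_eq] at hb
  have := hΨ.notMem_crossSegment hp Λ hg hr ha hb.le (sub_ne_zero.2 (ne_of_gt hlt))
  rw [add_sub_cancel] at this
  exact this hb'

/-- A leaf which comes back close to the centre of a flat chart meets the perpendicular. -/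
lemma IsFlatChart.exists_crossing (hp : IsIsometricUniversalCover p) (Λ : FlatLamination M p)
    (hg : g.cls ∈ Λ.leaves) (hΨ : IsFlatChart M g t Ψ R D) (hr : r ≤ R / 4) {b : ℝ}
    (hb : dist (g b) (g t) < r / 3) : ∃ a, b - R / 2 ≤ a ∧ g a ∈ crossSegment Ψ D r := by
  have hR := hΨ.pos
  have h0 : (0 : ℂ) ∈ D := by rcases hΨ.domain with h | h <;> rw [h] <;> simp
  have hr0 : 0 < r / 3 := dist_nonneg.trans_lt hb
  obtain ⟨w, hw, hwR, e⟩ := hΨ.surj (g b) (by rw [dist_comm]; linarith)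
  have hn : ‖w‖ < r / 3 := by
    have h1 := hΨ.axis 0 (by simpa using hR)
    rw [add_zero, Complex.ofReal_zero] at h1
    rwa [← e, ← h1, hΨ.iso w hw hwR 0 h0 (by simpa using hR), dist_zero_right] at hb
  obtain ⟨v, hv1, hv, hline⟩ := hΨ.exists_line_of_mem hp Λ hg hw (by linarith) e.symm
  have hv0 : v.re ≠ 0 := fun h => by rw [h, abs_zero] at hv; linarith
  -- The time at which the line meets the imaginary axis; it is short because the slope is bounded.
  set u := -w.re / v.re with hu
  have hle : |u| ≤ 2 * ‖w‖ := by
    rw [hu, abs_div, abs_neg, div_le_iff₀ (abs_pos.2 hv0)]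
    have := Complex.abs_re_le_norm w
    nlinarith [norm_nonneg w]
  have hule : |u| ≤ R / 2 := by linarith
  obtain ⟨l1, l2, l3⟩ := hline u hule
  have hre : w + u * v = ((w + u * v).im : ℝ) * Complex.I := by
    apply Complex.ext
    · simp only [Complex.add_re, Complex.re_ofReal_mul, Complex.I_re, mul_zero]
      rw [hu]; field_simp; ring
    · simp
  refine ⟨b + u, by linarith [(abs_le.1 hule).1], (w + u * v).im, ⟨?_, ?_⟩, ?_⟩
  · refine (Complex.abs_im_le_norm _).trans ((norm_add_le _ _).trans ?_)
    rw [norm_mul, hv1, mul_one, Complex.norm_real, Real.norm_eq_abs]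
    linarith
  · rwa [← hre]
  · simp only
    rw [← hre, l3]

/-- The masses of the points of a leaf on the perpendicular. -/
lemma IsFlatChart.atom_eq_of_hasMass (hp : IsIsometricUniversalCover p) (Λ : FlatLamination M p)
    (μ : TransverseMeasure M Λ.leaves) (hg : g.cls ∈ Λ.leaves) (hΨ : IsFlatChart M g t Ψ R D)
    (hr0 : 0 < r) (hr : r ≤ R / 4) {α : Arc M} (hα : α.TransverseToLeaves Λ.leaves)
    (him : α.image = crossSegment Ψ D r) {m : ENNReal}
    (hm : ∀ a, g a ∉ M.sing → HasMass μ g a m) {a : ℝ} (ha : g a ∈ α.image) :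
    μ.μ α {x | x.1 = g.shift a} = m := by
  have hR := hΨ.pos
  rw [him] at ha
  obtain ⟨s, ⟨hs, hsD⟩, e⟩ := ha
  simp only at e
  have hball : ∀ s : ℝ, |s| ≤ r → ‖(s * Complex.I : ℂ)‖ < R := fun s hs => by
    rw [norm_mul_I]; linarith
  have hreg : g a ∉ M.sing := by rw [← e]; exact hΨ.regular _ hsD (hball s hs)
  obtain ⟨v, -, hv, hline⟩ := hΨ.exists_line_of_mem hp Λ hg hsD
    (by rw [norm_mul_I]; linarith) e.symm
  have key : ∀ υ : ℝ, |υ| = 1 → ∀ σ, 0 < σ → σ ≤ r →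
      (∀ x ∈ Icc 0 σ, |s + υ * x| ≤ r ∧ ((s + υ * x : ℝ) * Complex.I : ℂ) ∈ D) →
      μ.μ α {x | x.1 = g.shift a} = m := by
    intro υ hυ σ hσ hσr H
    refine hm a hreg α hα (fun x => Ψ ((s + υ * x : ℝ) * Complex.I)) σ
      ⟨hσ, by simp only [mul_zero, add_zero]; exact e, fun x hx x' hx' => ?_, fun x hx => ?_⟩ ?_
    · rw [hΨ.iso _ (H x hx).2 (hball _ (H x hx).1) _ (H x' hx').2 (hball _ (H x' hx').1),
        dist_eq_norm, ← sub_mul, ← Complex.ofReal_sub, norm_mul_I, add_sub_add_left_eq_sub,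
        ← mul_sub, abs_mul, hυ, one_mul]
    · have hne : ∀ y : ℝ, |y| ≤ R / 2 → y ≠ 0 →
          Ψ ((s + υ * x : ℝ) * Complex.I) ≠ g (a + y) := by
        intro y hy hy0 e'
        obtain ⟨h1, h2⟩ := H x ⟨hx.1.le, hx.2⟩
        refine hΨ.notMem_crossSegment hp Λ hg hr (a := a) (u := y) ⟨s, ⟨hs, hsD⟩, e⟩ hy hy0
          ⟨_, ⟨h1, h2⟩, e'⟩
      have hx1 : |x| ≤ R / 2 := by rw [abs_of_pos hx.1]; linarith [hx.2]
      refine ⟨hne x hx1 hx.1.ne', ?_⟩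
      rw [sub_eq_add_neg]
      exact hne (-x) (by rwa [abs_neg]) (neg_ne_zero.2 hx.1.ne')
    · rw [him]
      rintro _ ⟨x, hx, rfl⟩
      exact ⟨_, H x hx, rfl⟩
  rw [abs_le] at hs
  -- The crossing may be an end point of α, so the segment is taken towards the inside: upwards from
  -- a nonpositive height, down to 0 from a positive one. Both choices stay in a half disc.
  rcases le_or_gt s 0 with h | h
  · refine key 1 (by simp) r hr0 le_rfl fun x hx => ⟨?_, ?_⟩
    · rw [abs_le]; constructor <;> linarith [hx.1, hx.2]
    · rcases hΨ.domain with hD | hD <;> rw [hD] at hsD ⊢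
      · exact mem_univ _
      · simp only [mem_ofPred_eq, Complex.im_ofReal_mul, Complex.I_im, mul_one] at hsD ⊢
        linarith [hx.1]
  · refine key (-1) (by simp) s h hs.2 fun x hx => ⟨?_, ?_⟩
    · rw [abs_le]; constructor <;> linarith [hx.1, hx.2]
    · rcases hΨ.domain with hD | hD <;> rw [hD] at hsD ⊢
      · exact mem_univ _
      · simp only [mem_ofPred_eq, Complex.im_ofReal_mul, Complex.I_im, mul_one] at hsD ⊢
        linarith [hx.2]

lemma LocalGeodesic.continuous_cls {X : Type*} [MetricSpace X] :
    Continuous (LocalGeodesic.cls : LocalGeodesic X → GeodesicClass X) := continuous_quotient_mk'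

/-- The transverse measures are finite on the set of leaves. -/
lemma TransverseMeasure.measure_leaves_lt_top [CompleteSpace S] {Λ : FlatLamination M p}
    (μ : TransverseMeasure M Λ.leaves) {α : Arc M} (hα : α.TransverseToLeaves Λ.leaves) :
    μ.μ α {x | x.1.cls ∈ Λ.leaves} < ⊤ := by
  have := μ.locallyFinite α hα
  refine IsCompact.measure_lt_top ?_
  rw [Subtype.isCompact_iff]
  -- Transversality of α to the lamination puts every leaf with origin on α in G(α). The leaves thus
  -- form a closed part of a compact set, although G(α) itself need not be closed.
  have e : ((↑) : α.geodesics → LocalGeodesic S) '' {x | x.1.cls ∈ Λ.leaves} =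
      {h : LocalGeodesic S | h 0 ∈ α.image} ∩ LocalGeodesic.cls ⁻¹' Λ.leaves := by
    ext h
    constructor
    · rintro ⟨x, hx, rfl⟩
      exact ⟨x.2.2, hx⟩
    · rintro ⟨h0, hl⟩
      exact ⟨⟨h, hα h hl, h0⟩, hl, rfl⟩
  rw [e]
  have hc : IsCompact α.image := isCompact_range α.toMap.continuous
  exact (M.isCompact_localGeodesic hc).inter_right
    (Λ.isClosed.preimage LocalGeodesic.continuous_cls)

/-- Two equal shifts would exhibit a period. This is the only use of non-periodicity: different
crossing times give different atoms. -/
lemma LocalGeodesic.injective_shift (h : ¬ IsPeriodicLeaf g.cls) : Function.Injective g.shift := by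
  have key : ∀ a b, a < b → g.shift a ≠ g.shift b := by
    intro a b hab e
    refine h ⟨g, rfl, b - a, by linarith, fun t => ?_⟩
    have := congrArg (fun h : LocalGeodesic S => h (t - a)) e
    simp only [LocalGeodesic.shift_apply, sub_add_cancel] at this
    rw [this]; congr 1; ring
  intro a b e
  rcases lt_trichotomy a b with h | h | h
  · exact absurd e (key a b h)
  · exact h
  · exact absurd e.symm (key b a h)

end Recurrence

/-! ### The contradiction -/

theorem mainTheorem10 {S E : Type*} [MetricSpace S] [CompleteSpace S] [MetricSpace E]
    (M : HalfTranslationSurface S) (p : E → S) (hp : IsIsometricUniversalCover p)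
    (Λ : FlatLamination M p) (μ : TransverseMeasure M Λ.leaves) :
    ¬ ∃ l ∈ Λ.leaves, IsIsolatedLeaf Λ.leaves l ∧ PositivelyRecurrent M l ∧
      ¬ IsPeriodicLeaf l := by
  rintro ⟨l, hg, ⟨U, hU, hUl⟩, ⟨g, rfl, hreg, hrec⟩, hper⟩
  obtain ⟨Ψ, R, D, hΨ⟩ := exists_isFlatChart (M := M) g g.2 hreg
  obtain ⟨r, hr0, hr, α, hα, him⟩ := hΨ.exists_cross_arc hp Λ hg
  obtain ⟨m, hm⟩ := exists_forall_hasMass hp Λ μ hg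
  set A : Set ℝ := {a | g a ∈ α.image} with hA
  have hcount : A.Countable := by rw [hA, him]; exact hΨ.countable_crossing hp Λ hg hr
  have hinf : A.Infinite := by
    refine infinite_of_not_bddAbove fun ⟨B, hB⟩ => ?_
    -- The crossing given by a return at time b may occur earlier, by at most R/2; this margin keeps
    -- it beyond B.
    obtain ⟨b, hb, hb'⟩ := hrec (|B| + R / 2 + 1) (by have := hΨ.pos; positivity) (r / 3)
      (by linarith)
    obtain ⟨a, ha, ha'⟩ := hΨ.exists_crossing hp Λ hg hr hb'
    have := hB (show a ∈ A by rw [hA, mem_ofPred_eq, him]; exact ha')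
    linarith [le_abs_self B]
  have hatom : ∀ a ∈ A, μ.μ α {x | x.1 = g.shift a} = m := fun a ha =>
    hΨ.atom_eq_of_hasMass hp Λ μ hg hr0 hr hα him hm ha
  have hmeas : ∀ a, MeasurableSet {x : α.geodesics | x.1 = g.shift a} := fun a =>
    measurable_subtype_coe (measurableSet_singleton (g.shift a))
  have hm0 : m = 0 := by
    by_contra hne
    have hdisj : A.PairwiseDisjoint fun a => {x : α.geodesics | x.1 = g.shift a} := by
      intro a _ b _ hab
      rw [Function.onFun, Set.disjoint_left]
      intro x hx hx'
      exact hab (LocalGeodesic.injective_shift hper (hx.symm.trans hx'))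
    have hsum := measure_biUnion (μ := μ.μ α) hcount hdisj fun a _ => hmeas a
    have htop : ∑' a : A, μ.μ α {x | x.1 = g.shift a} = ⊤ := by
      have := hinf.to_subtype
      rw [tsum_congr fun a : A => hatom a a.2]
      exact ENNReal.tsum_const_eq_top_of_ne_zero hne
    have hle : μ.μ α (⋃ a ∈ A, {x | x.1 = g.shift a}) ≤ μ.μ α {x | x.1.cls ∈ Λ.leaves} := by
      refine measure_mono (iUnion₂_subset fun a _ x hx => ?_)
      rw [mem_ofPred_eq] at hx ⊢
      rwa [hx, LocalGeodesic.cls_shift]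
    rw [hsum, htop] at hle
    exact (μ.measure_leaves_lt_top hα).not_ge hle
  have h0 : g 0 ∈ α.image := by
    rw [him]
    refine ⟨0, ⟨by rw [abs_zero]; exact hr0.le, ?_⟩, ?_⟩
    · rcases hΨ.domain with h | h <;> rw [h] <;> simp
    · have := hΨ.axis 0 (by simpa using hΨ.pos)
      simpa using this
  -- The isolating open set of classes pulls back to an open neighbourhood of g in G(α); it will
  -- turn out to be null.
  have hopen : IsOpen {x : α.geodesics | x.1.cls ∈ U} :=
    (hU.preimage LocalGeodesic.continuous_cls).preimage continuous_subtype_val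
  have hgU : g.cls ∈ U := by
    have : g.cls ∈ U ∩ Λ.leaves := by rw [hUl]; exact mem_singleton _
    exact this.1
  have hsupp := μ.support_eq α hα
  have hmem : (⟨g, hα g hg, h0⟩ : α.geodesics) ∈ (μ.μ α).support := by rw [hsupp]; exact hg
  have hpos := (Measure.mem_support_iff_forall _).1 hmem _ (hopen.mem_nhds hgU)
  -- Inner regularity makes the complement of the support null, and countability of the crossings
  -- makes the union of the atoms null.
  have hnull : μ.μ α ((μ.μ α).supportᶜ ∪ ⋃ a ∈ A, {x | x.1 = g.shift a}) = 0 := by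
    have := μ.innerRegular α hα
    have : BorelSpace α.geodesics := inferInstance
    rw [measure_union_null_iff, measure_biUnion_null_iff hcount]
    exact ⟨Measure.measure_compl_support_of_innerRegular, fun a ha => by rw [hatom a ha, hm0]⟩
  refine hpos.ne' (measure_mono_null (fun x hx => ?_) hnull)
  by_cases hxs : x ∈ (μ.μ α).support
  -- A point of the support is a leaf, and in U the only leaf is g. So the point is a shift of g, by
  -- a crossing time since its origin is on α.
  · right
    rw [hsupp] at hxs
    have hcls : x.1.cls ∈ U ∩ Λ.leaves := ⟨hx, hxs⟩
    rw [hUl, mem_singleton_iff] at hcls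
    obtain ⟨a, ha⟩ := Quotient.exact hcls.symm
    have hxa : x.1 = g.shift a := LocalGeodesic.ext ha
    simp only [mem_iUnion]
    refine ⟨a, ?_, hxa⟩
    have := x.2.2
    rw [hxa, LocalGeodesic.shift_apply, zero_add] at this
    exact this
  · exact Or.inl hxs
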